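/- Let $\mathfrak g$ be a finite-dimensional complex simple Lie algebra with a Cartan subalgebra $\mathfrak h$, root system $\Delta$ and simple roots $\alpha_1,\dots,\alpha_r$. Let $(\cdot,\cdot)$ be the bilinear form on $\mathfrak h^*$ induced by the Killing form, rescaled so that short roots satisfy $(\alpha,\alpha)=2$. Put $d_i=(\alpha_i,\alpha_i)/2$, $(\alpha_i,\alpha_j)=d_ia_{ij}$, and let $2\rho$ be the sum of the positive roots. Let $q>0$ be real, $q\ne 1$, and $q_i=q^{d_i}$. Let $U_q(\mathfrak g)$ be the algebra generated by $E_i,F_i,K_i^{\pm1}$ ($1\le i\le r$) with the relations $K_iK_i^{-1}=K_i^{-1}K_i=1$, $K_iK_j=K_jK_i$, $K_iE_jK_i^{-1}=q_i^{a_{ij}}E_j$, $K_iF_jK_i^{-1}=q_i^{-a_{ij}}F_j$, $E_iF_j-F_jE_i=\delta_{ij}\frac{K_i-K_i^{-1}}{q_i-q_i^{-1}}$ and the quantum Serre relations. It is a Hopf $*$-algebra with $\Delta(K_i)=K_i\otimes K_i$, $\Delta(E_i)=E_i\otimes K_i+1\otimes E_i$, $\Delta(F_i)=F_i\otimes 1+K_i^{-1}\otimes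 F_i$, $\varepsilon(K_i)=1$, $\varepsilon(E_i)=\varepsilon(F_i)=0$, $S(K_i)=K_i^{-1}$, $S(E_i)=-E_iK_i^{-1}$, $S(F_i)=-K_iF_i$, $K_i^*=K_i$, $E_i^*=K_iF_i$, $F_i^*=E_iK_i^{-1}$. For $\lambda=\sum_i n_i\alpha_i$ with $n_i\in\mathbb Z$ write $K_\lambda=K_1^{n_1}\cdots K_r^{n_r}$. Let $\mathbb C_q[G]\subset U_q(\mathfrak g)^*$ be the span of the matrix coefficients $X\mapsto f(Xv)$ of the finite-dimensional representations of type one (those spanned by vectors on which each $K_i$ acts by an integral power of $q_i$). The product is $(\phi\psi)(X)=(\phi\otimes\psi)(\Delta X)$, the unit is $\varepsilon$, and $\phi^*(X)=\overline{\phi(S(X)^*)}$. Put $(X\triangleright\phi)(Y)=\phi(YX)$, $(\phi\triangleleft X)(Y)=\phi(XY)$ and $$\mathbb C_q[G/T]=\{a\in\mathbb C_q[G]: K_\lambda\triangleright a=a\ \ \forall\lambda\},\qquad \mathbb C_q[T\backslash G]=\{a\in\mathbb C_q[G]: a\triangleleft K_\lambda=a\ \ \forall\lambda\},$$ where $\lambda$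 runs over the root lattice. The modular automorphism $\theta(a)=K_{2\rho}\triangleright a\triangleleft K_{2\rho}$ restricts to an automorphism of each of these algebras. For an algebra $A$ over $\mathbb C$ and $\sigma\in\mathrm{Aut}(A)$, let $HH^\sigma_\bullet(A)$ be the homology of the chain spaces $A^{\otimes(n+1)}$ under $$b_\sigma(a_0\otimes\cdots\otimes a_n)=\sum_{i=0}^{n-1}(-1)^i a_0\otimes\cdots\otimes a_ia_{i+1}\otimes\cdots\otimes a_n+(-1)^n\sigma(a_n)a_0\otimes a_1\otimes\cdots\otimes a_{n-1}.$$ In degree $2$ it is identified with the homology of the normalized complex with chain spaces $A\otimes(A/\mathbb C1)^{\otimes n}$ through the canonical projection; in this way every $2$-cycle of the normalized complex has a class in $HH^\sigma_2(A)$. Let $V(\Lambda)$ be a finite-dimensional irreducible representation $\pi$ of $U_q(\mathfrak g)$ of highest weight $\Lambda$ (the highest weight vector being a weight vector in the sense below), with an inner product for which $\pi(X)^\dagger=\pi(X^*)$ for all $X$. Let $(v_i)$ be an orthonormal basis of weight vectors, $v_i$ of weight $\lambda_i$, that is, $K_jv_i=q^{(\alpha_j,\lambda_i)}v_i$ for all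 $j$, where $\lambda_i$ is integral. Let $u^i_j\in\mathbb C_q[G]$, $u^i_j(X)=\langle v_i, Xv_j\rangle$ (linear in the second entry). For an index $m$ define the matrices $$(\mathsf M^m_m)^i_j=(u^m_i)^*u^m_j,\qquad (\mathsf N^m_m)^i_j=u^i_m(u^j_m)^*,$$ and the $2$-chains $$C(\mathsf M^m_m)=\mathrm{Tr}\big(\pi(K_{2\rho}^{-1})(2\mathsf M^m_m-\mathrm{Id})\otimes\mathsf M^m_m\otimes\mathsf M^m_m\big),\qquad C(\mathsf N^m_m)=\mathrm{Tr}\big(\pi(K_{2\rho})(2\mathsf N^m_m-\mathrm{Id})\otimes\mathsf N^m_m\otimes\mathsf N^m_m\big),$$ where $\mathrm{Tr}(A\otimes B\otimes C)=\sum_{i,k,l}A^i_k\otimes B^k_l\otimes C^l_i$. Suppose that $\lambda_m\neq0$. Then $\mathsf M^m_m$ has entries in $\mathbb C_q[T\backslash G]$, $\mathsf N^m_m$ has entries in $\mathbb C_q[G/T]$, the chains $C(\mathsf M^m_m)$ and $C(\mathsf N^m_m)$ are cycles of the normalized complexes twisted by $\theta$, and the classes $$[C(\mathsf M^m_m)]\in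 HH_2^\theta(\mathbb C_q[T\backslash G]),\qquad [C(\mathsf N^m_m)]\in HH_2^\theta(\mathbb C_q[G/T])$$ are both non-zero. -/

import Mathlib

open scoped TensorProduct

noncomputable section

namespace Hochschild

variable {A : Type*} [Ring A] [Algebra ℂ A] (σ : A ≃ₐ[ℂ] A)

/-- The multiplication `a ⊗ b ↦ σ(a) b`, giving the left action on the twisted bimodule `_σ A`. -/
def twistedMul : A ⊗[ℂ] A →ₗ[ℂ] A :=
  LinearMap.mul' ℂ A ∘ₗ LinearMap.rTensor A σ.toLinearMap

/-- The twisted Hochschild boundary `b_σ` on `A ⊗ A^{⊗ 2}`; see `b₂_tmul`. -/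
def b₂ : A ⊗[ℂ] (A ⊗[ℂ] A) →ₗ[ℂ] A ⊗[ℂ] A :=
  LinearMap.rTensor A (LinearMap.mul' ℂ A) ∘ₗ (TensorProduct.assoc ℂ A A A).symm.toLinearMap
  - LinearMap.lTensor A (LinearMap.mul' ℂ A)
  + LinearMap.rTensor A (twistedMul σ) ∘ₗ (TensorProduct.assoc ℂ A A A).symm.toLinearMap ∘ₗ
      (TensorProduct.comm ℂ (A ⊗[ℂ] A) A).toLinearMap ∘ₗ
      (TensorProduct.assoc ℂ A A A).symm.toLinearMap

/-- The twisted Hochschild boundary `b_σ` on `A ⊗ A^{⊗ 3}`; see `b₃_tmul`. -/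
def b₃ : A ⊗[ℂ] (A ⊗[ℂ] (A ⊗[ℂ] A)) →ₗ[ℂ] A ⊗[ℂ] (A ⊗[ℂ] A) :=
  LinearMap.rTensor (A ⊗[ℂ] A) (LinearMap.mul' ℂ A) ∘ₗ
      (TensorProduct.assoc ℂ A A (A ⊗[ℂ] A)).symm.toLinearMap
  - LinearMap.lTensor A (LinearMap.rTensor A (LinearMap.mul' ℂ A) ∘ₗ
      (TensorProduct.assoc ℂ A A A).symm.toLinearMap)
  + LinearMap.lTensor A (LinearMap.lTensor A (LinearMap.mul' ℂ A))
  - LinearMap.rTensor (A ⊗[ℂ] A) (twistedMul σ) ∘ₗ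
      (TensorProduct.assoc ℂ A A (A ⊗[ℂ] A)).symm.toLinearMap ∘ₗ
      (TensorProduct.comm ℂ (A ⊗[ℂ] (A ⊗[ℂ] A)) A).toLinearMap ∘ₗ
      (TensorProduct.assoc ℂ A (A ⊗[ℂ] A) A).symm.toLinearMap ∘ₗ
      LinearMap.lTensor A (TensorProduct.assoc ℂ A A A).symm.toLinearMap

@[simp] theorem b₂_tmul (a₀ a₁ a₂ : A) :
    b₂ σ (a₀ ⊗ₜ (a₁ ⊗ₜ a₂)) =
      (a₀ * a₁) ⊗ₜ a₂ - a₀ ⊗ₜ (a₁ * a₂) + (σ a₂ * a₀) ⊗ₜ a₁ := by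
  simp [b₂, twistedMul]

@[simp] theorem b₃_tmul (a₀ a₁ a₂ a₃ : A) :
    b₃ σ (a₀ ⊗ₜ (a₁ ⊗ₜ (a₂ ⊗ₜ a₃))) =
      (a₀ * a₁) ⊗ₜ (a₂ ⊗ₜ a₃) - a₀ ⊗ₜ ((a₁ * a₂) ⊗ₜ a₃) + a₀ ⊗ₜ (a₁ ⊗ₜ (a₂ * a₃))
        - (σ a₃ * a₀) ⊗ₜ (a₁ ⊗ₜ a₂) := by
  simp [b₃, twistedMul]

theorem b₂_comp_b₃ : b₂ σ ∘ₗ b₃ σ = 0 := by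
  ext a₀ a₁ a₂ a₃
  simp [mul_assoc]
  abel

/-- The quotient `Z / (Z ∩ B)` of a space `Z` of cycles by a space `B` of boundaries. -/
abbrev Subquotient {C : Type*} [AddCommGroup C] [Module ℂ C] (Z B : Submodule ℂ C) : Type _ :=
  Z ⧸ B.submoduleOf Z

/-- The twisted Hochschild homology `HH_2^σ(A) = ker b₂ / im b₃`. -/
abbrev HH2 : Type _ := Subquotient (LinearMap.ker (b₂ σ)) (LinearMap.range (b₃ σ))

variable (A) in
/-- The degenerate `1`-chains. -/
def D₁ : Submodule ℂ (A ⊗[ℂ] A) := Submodule.span ℂ {x | ∃ a : A, x = a ⊗ₜ 1}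

variable (A) in
/-- The degenerate `2`-chains. -/
def D₂ : Submodule ℂ (A ⊗[ℂ] (A ⊗[ℂ] A)) :=
  Submodule.span ℂ {x | ∃ a b : A, x = a ⊗ₜ (1 ⊗ₜ b) ∨ x = a ⊗ₜ (b ⊗ₜ 1)}

/-- The `2`-chains that are cycles in the normalized Hochschild complex, that is, modulo degenerate
chains. -/
def normalizedCycles : Submodule ℂ (A ⊗[ℂ] (A ⊗[ℂ] A)) := (D₁ A).comap (b₂ σ)

/-- The `2`-chains that are boundaries in the normalized Hochschild complex. -/
def normalizedBoundaries : Submodule ℂ (A ⊗[ℂ] (A ⊗[ℂ] A)) := LinearMap.range (b₃ σ) ⊔ D₂ A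

/-- The homology of the normalized Hochschild complex in degree `2`. -/
abbrev NormalizedHH2 : Type _ := Subquotient (normalizedCycles σ) (normalizedBoundaries σ)

theorem ker_le_normalizedCycles : LinearMap.ker (b₂ σ) ≤ normalizedCycles σ := by
  intro x hx
  rw [LinearMap.mem_ker] at hx
  simp [normalizedCycles, hx]

/-- The map induced on homology by the projection onto the normalized complex. -/
def toNormalized : HH2 σ →ₗ[ℂ] NormalizedHH2 σ :=
  Submodule.mapQ _ _ (Submodule.inclusion (ker_le_normalizedCycles σ)) (by
    rintro ⟨x, hx⟩ h
    exact (le_sup_left : LinearMap.range (b₃ σ) ≤ normalizedBoundaries σ) h)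

theorem mem_D₁_iff (x : A ⊗[ℂ] A) : x ∈ D₁ A ↔ ∃ a : A, x = a ⊗ₜ 1 := by
  constructor
  · intro h
    induction h using Submodule.span_induction with
    | mem x hx => exact hx
    | zero => exact ⟨0, by simp⟩
    | add x y _ _ hx hy =>
      obtain ⟨a, rfl⟩ := hx
      obtain ⟨b, rfl⟩ := hy
      exact ⟨a + b, by rw [TensorProduct.add_tmul]⟩
    | smul c x _ hx =>
      obtain ⟨a, rfl⟩ := hx
      exact ⟨c • a, by rw [TensorProduct.smul_tmul']⟩
  · rintro h
    exact Submodule.subset_span h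

theorem b₂_one (a : A) : b₂ σ (a ⊗ₜ (1 ⊗ₜ 1)) = a ⊗ₜ 1 := by simp

theorem D₂_le (x : A ⊗[ℂ] (A ⊗[ℂ] A)) (hx : x ∈ D₂ A) :
    ∃ a : A, x - a ⊗ₜ (1 ⊗ₜ 1) ∈ LinearMap.range (b₃ σ) := by
  induction hx using Submodule.span_induction with
  | mem x hx =>
    have key (a b : A) : ∃ w, b₃ σ w = a ⊗ₜ (b ⊗ₜ 1) - (a * b) ⊗ₜ (1 ⊗ₜ 1) :=
      ⟨- a ⊗ₜ (b ⊗ₜ (1 ⊗ₜ 1)), by rw [map_neg, b₃_tmul]; simp⟩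
    obtain ⟨a, b, rfl | rfl⟩ := hx
    · obtain ⟨w, hw⟩ := key (σ b * a) 1
      refine ⟨σ b * a, a ⊗ₜ (1 ⊗ₜ (1 ⊗ₜ b)), ?_⟩
      rw [b₃_tmul]; simp
    · obtain ⟨w, hw⟩ := key a b
      exact ⟨a * b, w, hw⟩
  | zero => exact ⟨0, by simp⟩
  | add x y _ _ hx hy =>
    obtain ⟨a, ha⟩ := hx
    obtain ⟨b, hb⟩ := hy
    refine ⟨a + b, ?_⟩
    have := add_mem ha hb
    rwa [show x - a ⊗ₜ[ℂ] (1 ⊗ₜ[ℂ] 1) + (y - b ⊗ₜ[ℂ] (1 ⊗ₜ[ℂ] 1)) =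
      x + y - (a + b) ⊗ₜ[ℂ] ((1 : A) ⊗ₜ[ℂ] (1 : A)) by rw [TensorProduct.add_tmul]; abel] at this
  | smul c x _ hx =>
    obtain ⟨a, ha⟩ := hx
    refine ⟨c • a, ?_⟩
    have := Submodule.smul_mem _ c ha
    rwa [smul_sub, TensorProduct.smul_tmul'] at this

theorem toNormalized_injective : Function.Injective (toNormalized σ) := by
  rw [← LinearMap.ker_eq_bot, eq_bot_iff]
  intro x hx
  obtain ⟨⟨z, hz⟩, rfl⟩ := Submodule.Quotient.mk_surjective _ x
  rw [LinearMap.mem_ker, toNormalized, Submodule.mapQ_apply, Submodule.Quotient.mk_eq_zero] at hx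
  rw [Submodule.mem_bot, Submodule.Quotient.mk_eq_zero]
  change z ∈ LinearMap.range (b₃ σ)
  change z ∈ normalizedBoundaries σ at hx
  obtain ⟨y, hy, d, hd, rfl⟩ := Submodule.mem_sup.1 hx
  obtain ⟨a, ha⟩ := D₂_le σ d hd
  have hb (w) (hw : w ∈ LinearMap.range (b₃ σ)) : b₂ σ w = 0 := by
    obtain ⟨v, rfl⟩ := hw
    exact LinearMap.congr_fun (b₂_comp_b₃ σ) v
  have h1 := hb _ hy
  have h2 := hb _ ha
  rw [LinearMap.mem_ker, map_add, h1, zero_add] at hz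
  rw [map_sub, hz, b₂_one, zero_sub, neg_eq_zero] at h2
  have h3 : a = 0 := by simpa using congrArg (LinearMap.mul' ℂ A) h2
  rw [h3, TensorProduct.zero_tmul, sub_zero] at ha
  exact add_mem hy ha

theorem toNormalized_surjective : Function.Surjective (toNormalized σ) := by
  intro x
  obtain ⟨⟨z, hz⟩, rfl⟩ := Submodule.Quotient.mk_surjective _ x
  obtain ⟨a, ha⟩ := (mem_D₁_iff _).1 hz
  have hk : z - a ⊗ₜ (1 ⊗ₜ 1) ∈ LinearMap.ker (b₂ σ) := by
    rw [LinearMap.mem_ker, map_sub, b₂_one, ha, sub_self]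
  refine ⟨Submodule.Quotient.mk ⟨_, hk⟩, ?_⟩
  rw [toNormalized, Submodule.mapQ_apply, Submodule.Quotient.eq]
  change z - a ⊗ₜ (1 ⊗ₜ 1) - z ∈ normalizedBoundaries σ
  rw [sub_sub_cancel_left]
  exact neg_mem ((le_sup_right : D₂ A ≤ normalizedBoundaries σ)
    (Submodule.subset_span ⟨a, 1, Or.inl rfl⟩))

/-- The normalized complex computes `HH_2^σ(A)`. -/
def normalizedEquiv : HH2 σ ≃ₗ[ℂ] NormalizedHH2 σ :=
  LinearEquiv.ofBijective (toNormalized σ) ⟨toNormalized_injective σ, toNormalized_surjective σ⟩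

/-- The class in `HH_2^σ(A)` of a cycle of the normalized Hochschild complex. -/
def hochschildClass (z : A ⊗[ℂ] (A ⊗[ℂ] A)) (hz : z ∈ normalizedCycles σ) : HH2 σ :=
  (normalizedEquiv σ).symm (Submodule.Quotient.mk ⟨z, hz⟩)

/-- The chain `Tr (V (2P - 1) ⊗ P ⊗ P)`, for a scalar matrix `V` and a matrix `P` over `A`. -/
def chernChain {κ : Type*} [Fintype κ] (V : Matrix κ κ ℂ) (P : Matrix κ κ A) :
    A ⊗[ℂ] (A ⊗[ℂ] A) := by
  classical
  exact ∑ i, ∑ j, ∑ k, ∑ l,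
    V i j • ((2 • P - 1 : Matrix κ κ A) j k ⊗ₜ[ℂ] (P k l ⊗ₜ[ℂ] P l i))

/-- The chain `z` is a cycle of the normalized Hochschild complex, and its class in `HH_2^σ(A)` is
non-trivial. -/
def HasNontrivialClass (z : A ⊗[ℂ] (A ⊗[ℂ] A)) : Prop :=
  ∃ hz : z ∈ normalizedCycles σ, hochschildClass σ z hz ≠ 0

end Hochschild

namespace Quantum

/-- The `q`-integer `[n]_q = (q^n - q^{-n}) / (q - q^{-1})`. -/
def qInt (q : ℝ) (n : ℕ) : ℝ := (q ^ n - q⁻¹ ^ n) / (q - q⁻¹)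

/-- The `q`-factorial `[n]_q!`. -/
def qFactorial (q : ℝ) : ℕ → ℝ
  | 0 => 1
  | n + 1 => qInt q (n + 1) * qFactorial q n

/-- The `q`-binomial coefficient. -/
def qBinom (q : ℝ) (n k : ℕ) : ℝ :=
  qFactorial q n / (qFactorial q k * qFactorial q (n - k))

theorem sub_inv_ne_zero' {q : ℝ} (hq : 0 < q) (hq1 : q ≠ 1) : q - q⁻¹ ≠ 0 := by
  intro h
  have h1 : q * q = 1 := by
    rw [sub_eq_zero] at h
    nth_rw 2 [h]
    exact mul_inv_cancel₀ hq.ne'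
  exact hq1 (by nlinarith)

theorem qInt_ne_zero {q : ℝ} (hq : 0 < q) (hq1 : q ≠ 1) {n : ℕ} (hn : n ≠ 0) : qInt q n ≠ 0 := by
  refine div_ne_zero ?_ (sub_inv_ne_zero' hq hq1)
  rw [inv_pow]
  exact sub_inv_ne_zero' (pow_pos hq n) (by rwa [ne_eq, pow_eq_one_iff_of_nonneg hq.le hn])

theorem qFactorial_ne_zero {q : ℝ} (hq : 0 < q) (hq1 : q ≠ 1) (n : ℕ) : qFactorial q n ≠ 0 := by
  induction n with
  | zero => simp [qFactorial]
  | succ n ih => exact mul_ne_zero (qInt_ne_zero hq hq1 (by simp)) ih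

theorem qInt_inv (q : ℝ) (n : ℕ) : qInt q⁻¹ n = qInt q n := by
  simp only [qInt, inv_inv]
  rw [← neg_sub (q ^ n), ← neg_sub q, neg_div_neg_eq]

theorem qFactorial_inv (q : ℝ) (n : ℕ) : qFactorial q⁻¹ n = qFactorial q n := by
  induction n with
  | zero => rfl
  | succ n ih => simp only [qFactorial, ih, qInt_inv]

theorem qBinom_inv (q : ℝ) (n k : ℕ) : qBinom q⁻¹ n k = qBinom q n k := by
  simp only [qBinom, qFactorial_inv]

theorem qBinom_symm (q : ℝ) {n k : ℕ} (h : k ≤ n) : qBinom q n (n - k) = qBinom q n k := by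
  simp only [qBinom, Nat.sub_sub_self h, mul_comm]

theorem qBinom_zero {q : ℝ} (hq : 0 < q) (hq1 : q ≠ 1) (n : ℕ) : qBinom q n 0 = 1 := by
  have := qFactorial_ne_zero hq hq1 n
  simp [qBinom, qFactorial, this]

theorem qBinom_self {q : ℝ} (hq : 0 < q) (hq1 : q ≠ 1) (n : ℕ) : qBinom q n n = 1 := by
  have := qFactorial_ne_zero hq hq1 n
  simp [qBinom, qFactorial, this]

/-- Pascal's rule. -/
theorem qBinom_succ {q : ℝ} (hq : 0 < q) (hq1 : q ≠ 1) {n k : ℕ} (h : k + 1 ≤ n) :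
    qBinom q (n + 1) (k + 1) = q ^ (k + 1) * qBinom q n (k + 1) + q⁻¹ ^ (n - k) * qBinom q n k := by
  obtain ⟨m, rfl⟩ := Nat.exists_eq_add_of_le h
  have e1 : k + 1 + m + 1 - (k + 1) = m + 1 := by omega
  have e2 : k + 1 + m - (k + 1) = m := by omega
  have e3 : k + 1 + m - k = m + 1 := by omega
  simp only [qBinom, e1, e2, e3, qFactorial]
  have hk := qFactorial_ne_zero hq hq1 k
  have hm := qFactorial_ne_zero hq hq1 m
  have hk1 := qInt_ne_zero hq hq1 (n := k + 1) (by simp)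
  have hm1 := qInt_ne_zero hq hq1 (n := m + 1) (by simp)
  have key : qInt q (k + 1 + m + 1) =
      q ^ (k + 1) * qInt q (m + 1) + q⁻¹ ^ (m + 1) * qInt q (k + 1) := by
    have := sub_inv_ne_zero' hq hq1
    simp only [qInt]
    field_simp
    ring
  rw [key]
  field_simp

variable {B : Type*} [Ring B] [Algebra ℂ B]

/-- The quantum Serre expression
`∑_{k=0}^{n} (-1)^k [n choose k]_q x^{n-k} y x^k`. -/
def serre (q : ℝ) (n : ℕ) (x y : B) : B :=
  ∑ k ∈ Finset.range (n + 1), (((-1) ^ k * qBinom q n k : ℝ) : ℂ) • (x ^ (n - k) * y * x ^ k)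

theorem serre_inv (q : ℝ) (n : ℕ) (x y : B) : serre q⁻¹ n x y = serre q n x y := by
  simp only [serre, qBinom_inv]

theorem map_serre {B' : Type*} [Ring B'] [Algebra ℂ B'] (f : B →ₐ[ℂ] B') (q : ℝ) (n : ℕ)
    (x y : B) : f (serre q n x y) = serre q n (f x) (f y) := by
  simp only [serre, map_sum, map_smul, map_mul, map_pow]

theorem serre_smul (q : ℝ) (n : ℕ) (c d : ℂ) (x y : B) :
    serre q n (c • x) (d • y) = (c ^ n * d) • serre q n x y := by
  simp only [serre, Finset.smul_sum]
  refine Finset.sum_congr rfl fun k hk => ?_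
  have hk : k ≤ n := by simpa [Nat.lt_succ_iff] using hk
  simp only [smul_pow, smul_mul_assoc, mul_smul_comm, smul_smul]
  congr 1
  rw [← Nat.sub_add_cancel hk, pow_add, Nat.add_sub_cancel]
  ring

/-- Reversal of the order of factors. -/
theorem serre_reverse (q : ℝ) (n : ℕ) (x y : B) :
    ∑ k ∈ Finset.range (n + 1), (((-1) ^ k * qBinom q n k : ℝ) : ℂ) • (x ^ k * y * x ^ (n - k)) =
      (-1 : ℂ) ^ n • serre q n x y := by
  rw [serre, ← Finset.sum_range_reflect, Finset.smul_sum]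
  refine Finset.sum_congr rfl fun k hk => ?_
  have hk : k ≤ n := by simpa [Nat.lt_succ_iff] using hk
  rw [show n + 1 - 1 - k = n - k by omega, Nat.sub_sub_self hk, qBinom_symm q hk, smul_smul]
  congr 1
  push_cast
  rw [← mul_assoc]
  congr 1
  rw [← pow_add]
  rw [neg_one_pow_congr]
  rw [Nat.even_sub hk, Nat.even_add]

/-- Iterated `q`-commutators, `T_{k+1} = x T_k - q^{-(a+2k)} T_k x`. -/
def iterComm (q : ℝ) (a : ℤ) (x y : B) : ℕ → B
  | 0 => y
  | k + 1 => x * iterComm q a x y k - ((q ^ (-(a + 2 * k)) : ℝ) : ℂ) • (iterComm q a x y k * x)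

theorem iterComm_eq_sum {q : ℝ} (hq : 0 < q) (hq1 : q ≠ 1) (a : ℤ) (x y : B) (n : ℕ) :
    iterComm q a x y n = ∑ k ∈ Finset.range (n + 1),
      (((-1) ^ k * (qBinom q n k * q ^ (-(k * (a + n - 1)) : ℤ)) : ℝ) : ℂ) •
        (x ^ (n - k) * y * x ^ k) := by
  induction n with
  | zero => simp [iterComm, qBinom_zero hq hq1]
  | succ n ih =>
    rw [iterComm, ih, Finset.mul_sum, Finset.sum_mul, Finset.smul_sum]
    rw [Finset.sum_range_succ' _ n, Finset.sum_range_succ _ n]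
    rw [Finset.sum_range_succ' _ (n + 1), Finset.sum_range_succ _ n]
    have h1 : ∀ k ∈ Finset.range n,
        (((-1) ^ (k + 1) * (qBinom q (n + 1) (k + 1) *
          q ^ (-(((k + 1 : ℕ) : ℤ) * (a + ((n + 1 : ℕ) : ℤ) - 1)))) : ℝ) : ℂ) •
          (x ^ (n + 1 - (k + 1)) * y * x ^ (k + 1)) =
        x * ((((-1) ^ (k + 1) * (qBinom q n (k + 1) * q ^ (-(((k + 1 : ℕ) : ℤ) * (a + n - 1)) : ℤ))
          : ℝ) : ℂ) • (x ^ (n - (k + 1)) * y * x ^ (k + 1))) -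
        ((q ^ (-(a + 2 * n)) : ℝ) : ℂ) • ((((-1) ^ k * (qBinom q n k *
          q ^ (-(k * (a + n - 1)) : ℤ)) : ℝ) : ℂ) • (x ^ (n - k) * y * x ^ k) * x) := by
      intro k hk
      have hk : k + 1 ≤ n := by simpa using hk
      have e : x * (x ^ (n - (k + 1)) * y * x ^ (k + 1)) = x ^ (n - k) * y * x ^ (k + 1) := by
        rw [← mul_assoc, ← mul_assoc, ← pow_succ']
        congr 4
        omega
      rw [mul_smul_comm, e, smul_mul_assoc, mul_assoc (x ^ (n - k) * y), ← pow_succ, smul_smul,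
        ← sub_smul, show n + 1 - (k + 1) = n - k by omega]
      congr 1
      norm_cast
      rw [qBinom_succ hq hq1 hk]
      have q0 := hq.ne'
      have z1 : q ^ (-(((k + 1 : ℕ) : ℤ) * (a + ((n + 1 : ℕ) : ℤ) - 1))) =
          q ^ (-(((k + 1 : ℕ) : ℤ) * (a + n - 1))) * (q ^ (k + 1))⁻¹ := by
        rw [← zpow_natCast, ← zpow_neg, ← zpow_add₀ q0]
        congr 1; push_cast; ring
      have z2 : q⁻¹ ^ (n - k) * q ^ (-(((k + 1 : ℕ) : ℤ) * (a + ((n + 1 : ℕ) : ℤ) - 1))) =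
          q ^ (-(a + 2 * n)) * q ^ (-(k * (a + n - 1)) : ℤ) := by
        rw [inv_pow, ← zpow_natCast, ← zpow_neg, ← zpow_add₀ q0, ← zpow_add₀ q0]
        congr 1; push_cast [Nat.cast_sub (show k ≤ n by omega)]; ring
      have hqk : q ^ (k + 1) * (q ^ (k + 1))⁻¹ = 1 := mul_inv_cancel₀ (pow_ne_zero _ q0)
      push_cast at z1 z2 ⊢
      linear_combination (-1) ^ (k + 1) * qBinom q n k * z2 +
        (-1) ^ (k + 1) * q ^ (k + 1) * qBinom q n (k + 1) * z1 +
        (-1) ^ (k + 1) * qBinom q n (k + 1) * q ^ (-(((k + 1 : ℤ)) * (a + n - 1))) * hqk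
    rw [Finset.sum_congr rfl h1, Finset.sum_sub_distrib]
    have h2 : (((-1) ^ (n + 1) * (qBinom q (n + 1) (n + 1) *
          q ^ (-(((n + 1 : ℕ) : ℤ) * (a + ((n + 1 : ℕ) : ℤ) - 1)))) : ℝ) : ℂ) •
          (x ^ (n + 1 - (n + 1)) * y * x ^ (n + 1)) =
        - (((q ^ (-(a + 2 * n)) : ℝ) : ℂ) • ((((-1) ^ n * (qBinom q n n *
          q ^ (-(n * (a + n - 1)) : ℤ)) : ℝ) : ℂ) • (x ^ (n - n) * y * x ^ n) * x)) := by
      rw [smul_mul_assoc, mul_assoc (x ^ (n - n) * y), ← pow_succ, smul_smul, ← neg_smul,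
        Nat.sub_self, Nat.sub_self, qBinom_self hq hq1, qBinom_self hq hq1]
      rw [← Complex.ofReal_mul, ← Complex.ofReal_neg]
      congr 2
      have z : q ^ (-(((n + 1 : ℕ) : ℤ) * (a + ((n + 1 : ℕ) : ℤ) - 1))) =
          q ^ (-(a + 2 * n)) * q ^ (-(n * (a + n - 1)) : ℤ) := by
        rw [← zpow_add₀ hq.ne']
        congr 1; push_cast; ring
      rw [z]
      ring
    have h3 : x * ((((-1) ^ 0 * (qBinom q n 0 * q ^ (-(((0 : ℕ) : ℤ) * (a + n - 1)) : ℤ)) : ℝ) : ℂ)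
          • (x ^ (n - 0) * y * x ^ 0)) =
        (((-1) ^ 0 * (qBinom q (n + 1) 0 *
          q ^ (-(((0 : ℕ) : ℤ) * (a + ((n + 1 : ℕ) : ℤ) - 1)))) : ℝ) : ℂ) •
          (x ^ (n + 1 - 0) * y * x ^ 0) := by
      simp [qBinom_zero hq hq1, pow_succ', mul_assoc]
    rw [h2, h3]
    abel

theorem serre_eq_iterComm {q : ℝ} (hq : 0 < q) (hq1 : q ≠ 1) {a : ℤ} {n : ℕ} (ha : a = 1 - n)
    (x y : B) : serre q n x y = iterComm q a x y n := by
  subst ha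
  rw [iterComm_eq_sum hq hq1, serre]
  simp

theorem serre_eq_iterComm_inv {q : ℝ} (hq : 0 < q) (hq1 : q ≠ 1) {a : ℤ} {n : ℕ} (ha : a = 1 - n)
    (x y : B) : serre q n x y = iterComm q⁻¹ a x y n := by
  rw [← serre_inv, serre_eq_iterComm (inv_pos.2 hq) (by simpa using hq1) ha]

theorem iterComm_add_right (q : ℝ) (a : ℤ) (x s t : B) (k : ℕ) :
    iterComm q a x (s + t) k = iterComm q a x s k + iterComm q a x t k := by
  induction k with
  | zero => rfl
  | succ k ih => simp only [iterComm, ih, mul_add, add_mul, smul_add]; abel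

/-- Moving a `q`-commuting element past an iterated commutator. -/
theorem qcomm_iterComm {q : ℝ} (hq : 0 < q) {a u v : ℤ} {r x y : B}
    (hx : r * x = ((q ^ u : ℝ) : ℂ) • (x * r)) (hy : r * y = ((q ^ v : ℝ) : ℂ) • (y * r)) (k : ℕ) :
    r * iterComm q a x y k = ((q ^ (v + u * k) : ℝ) : ℂ) • (iterComm q a x y k * r) := by
  induction k with
  | zero => simpa [iterComm] using hy
  | succ k ih =>
    have e : q ^ (v + u * ((k + 1 : ℕ) : ℤ)) = q ^ u * q ^ (v + u * k) := by
      rw [← zpow_add₀ hq.ne']; congr 1; push_cast; ring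
    rw [e, iterComm]
    set T := iterComm q a x y k
    have h1 : r * (x * T) = ((q ^ u * q ^ (v + u * k) : ℝ) : ℂ) • (x * T * r) := by
      rw [← mul_assoc, hx, smul_mul_assoc, mul_assoc x, ih, mul_smul_comm, smul_smul, mul_assoc]
      push_cast; rfl
    have h2 : r * (T * x) = ((q ^ u * q ^ (v + u * k) : ℝ) : ℂ) • (T * x * r) := by
      rw [← mul_assoc, ih, smul_mul_assoc, mul_assoc T, hx, mul_smul_comm, smul_smul, mul_assoc]
      push_cast; rw [mul_comm]
    rw [mul_sub, mul_smul_comm, h1, h2, sub_mul, smul_sub, smul_mul_assoc, smul_comm]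

/-- Additivity of `iterComm` in `x` when the additional term drops out. -/
theorem iterComm_add_left {q : ℝ} (hq : 0 < q) {a : ℤ} {r x y : B}
    (hx : r * x = ((q ^ (-2 : ℤ) : ℝ) : ℂ) • (x * r))
    (hy : r * y = ((q ^ (-a) : ℝ) : ℂ) • (y * r)) (k : ℕ) :
    iterComm q a (x + r) y k = iterComm q a x y k := by
  induction k with
  | zero => rfl
  | succ k ih =>
    rw [iterComm, ih, iterComm, add_mul, mul_add, qcomm_iterComm hq hx hy k, smul_add,
      show -a + -2 * (k : ℤ) = -(a + 2 * k) by ring]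
    abel

theorem serre_add {q : ℝ} (hq : 0 < q) (hq1 : q ≠ 1) {a : ℤ} {n : ℕ} (ha : a = 1 - n)
    {p r s t : B} (hrp : r * p = ((q ^ (-2 : ℤ) : ℝ) : ℂ) • (p * r))
    (hrs : r * s = ((q ^ (-a) : ℝ) : ℂ) • (s * r)) (hpt : p * t = ((q ^ a : ℝ) : ℂ) • (t * p))
    (hps : serre q n p s = 0) (hrt : serre q n r t = 0) :
    serre q n (p + r) (s + t) = 0 := by
  have q0 := hq.ne'
  have hpr : p * r = ((q⁻¹ ^ (-2 : ℤ) : ℝ) : ℂ) • (r * p) := by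
    rw [hrp, smul_smul, inv_zpow', neg_neg, ← Complex.ofReal_mul, ← zpow_add₀ q0]
    simp
  have h1 : serre q n (p + r) s = 0 := by
    rw [serre_eq_iterComm hq hq1 ha, iterComm_add_left hq hrp hrs, ← serre_eq_iterComm hq hq1 ha,
      hps]
  have h2 : serre q n (p + r) t = 0 := by
    rw [serre_eq_iterComm_inv hq hq1 ha, add_comm,
      iterComm_add_left (inv_pos.2 hq) hpr (by rw [hpt, inv_zpow', neg_neg]),
      ← serre_eq_iterComm_inv hq hq1 ha, hrt]
  rw [serre_eq_iterComm hq hq1 ha, iterComm_add_right, ← serre_eq_iterComm hq hq1 ha,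
    ← serre_eq_iterComm hq hq1 ha, h1, h2, add_zero]

/-- The Serre expression of elements multiplied by `q`-commuting elements. -/
theorem serre_mul {q : ℝ} (hq : 0 < q) (hq1 : q ≠ 1) {a e : ℤ} {n : ℕ} (ha : a = 1 - n)
    {κ μ x y : B} (hκμ : κ * μ = μ * κ) (hκx : κ * x = ((q ^ (2 * e) : ℝ) : ℂ) • (x * κ))
    (hκy : κ * y = ((q ^ (e * a) : ℝ) : ℂ) • (y * κ))
    (hμx : μ * x = ((q ^ (e * a) : ℝ) : ℂ) • (x * μ)) (h : serre q n x y = 0) :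
    serre q n (x * κ) (y * μ) = 0 := by
  have q0 := hq.ne'
  have hμκ (k : ℕ) : κ ^ k * μ * κ = κ ^ (k + 1) * μ := by
    rw [mul_assoc, ← hκμ, ← mul_assoc, ← pow_succ]
  have hx (k : ℕ) : κ ^ k * μ * x = ((q ^ (e * a + 2 * e * k) : ℝ) : ℂ) • (x * (κ ^ k * μ)) := by
    induction k with
    | zero => simpa using hμx
    | succ k ih =>
      rw [pow_succ', mul_assoc κ, mul_assoc κ, ih, mul_smul_comm, ← mul_assoc κ, hκx,
        smul_mul_assoc, smul_smul, ← Complex.ofReal_mul, ← zpow_add₀ q0, mul_assoc x, ← mul_assoc κ,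
        show e * a + 2 * e * k + 2 * e = e * a + 2 * e * ((k + 1 : ℕ) : ℤ) by push_cast; ring]
  have key (k : ℕ) : ∃ c : ℂ, iterComm q a (x * κ) (y * μ) k =
      c • (iterComm q a x y k * (κ ^ k * μ)) := by
    induction k with
    | zero => exact ⟨1, by simp [iterComm]⟩
    | succ k ih =>
      obtain ⟨c, hc⟩ := ih
      have h1 := qcomm_iterComm hq (a := a) hκx hκy k
      have h2 := hx k
      refine ⟨c * ((q ^ (e * a + 2 * e * k) : ℝ) : ℂ), ?_⟩
      rw [iterComm, hc, iterComm]
      set T := iterComm q a x y k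
      set z : ℂ := ((q ^ (e * a + 2 * e * k) : ℝ) : ℂ)
      have h3 : x * κ * (T * (κ ^ k * μ)) = z • (x * T * (κ ^ (k + 1) * μ)) := by
        rw [mul_assoc x, ← mul_assoc κ, h1, smul_mul_assoc, mul_smul_comm, pow_succ']
        simp only [mul_assoc]
      have h4 : T * (κ ^ k * μ) * (x * κ) = z • (T * x * (κ ^ (k + 1) * μ)) := by
        rw [← hμκ, mul_assoc T, ← mul_assoc (κ ^ k * μ), h2, smul_mul_assoc, mul_smul_comm]
        simp only [mul_assoc]
      rw [mul_smul_comm, smul_mul_assoc, h3, h4, sub_mul, smul_sub, smul_smul, smul_smul,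
        smul_mul_assoc, smul_comm, smul_smul]
      rw [mul_left_comm z, mul_comm z c, smul_smul, mul_comm (c * z)]
  obtain ⟨c, hc⟩ := key n
  rw [serre_eq_iterComm hq hq1 ha, hc, ← serre_eq_iterComm hq hq1 ha, h, zero_mul, smul_zero]


/-- A generalized Cartan matrix `(a_ij)` with deformation parameters `q_i` such that
`q_i^{a_ij} = q_j^{a_ji}`. It serves to write down `U_q(𝔤)`; the Cartan matrix and the parameters
of a simple Lie algebra are given in `SimpleLie.datum`. -/
structure QuantumDatum (I : Type*) where
  a : I → I → ℤ
  qi : I → ℝ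
  a_self : ∀ i, a i i = 2
  a_nonpos : ∀ i j, i ≠ j → a i j ≤ 0
  qi_pos : ∀ i, 0 < qi i
  qi_ne_one : ∀ i, qi i ≠ 1
  symm : ∀ i j, qi i ^ a i j = qi j ^ a j i

/-- The symbols for the generators `E_i, F_i, K_i, K_i⁻¹`. -/
inductive Gen (I : Type*) : Type _
  | E (i : I)
  | F (i : I)
  | K (i : I)
  | Kinv (i : I)

variable {I : Type*}

/-- The exponent `1 - a_ij` in the quantum Serre relations. -/
def QuantumDatum.serreExp (D : QuantumDatum I) (i j : I) : ℕ := (1 - D.a i j).toNat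

theorem QuantumDatum.a_eq (D : QuantumDatum I) {i j : I} (h : i ≠ j) :
    D.a i j = 1 - (D.serreExp i j : ℤ) := by
  have := D.a_nonpos i j h
  rw [serreExp, Int.toNat_of_nonneg (by omega)]
  omega

theorem QuantumDatum.serreExp_pos (D : QuantumDatum I) {i j : I} (h : i ≠ j) :
    D.serreExp i j ≠ 0 := by
  have := D.a_nonpos i j h
  have := D.a_eq h
  omega

/-- The defining relations of `U_q(𝔤)`, for families of elements of an algebra. -/
structure IsUqTuple (D : QuantumDatum I) {B : Type*} [Ring B] [Algebra ℂ B]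
    (e f k k' : I → B) : Prop where
  k_mul_k' : ∀ i, k i * k' i = 1
  k'_mul_k : ∀ i, k' i * k i = 1
  k_comm : ∀ i j, k i * k j = k j * k i
  k_e : ∀ i j, k i * e j * k' i = ((D.qi i ^ D.a i j : ℝ) : ℂ) • e j
  k_f : ∀ i j, k i * f j * k' i = ((D.qi i ^ (-D.a i j) : ℝ) : ℂ) • f j
  e_f_same : ∀ i, e i * f i - f i * e i =
    (((D.qi i - (D.qi i)⁻¹)⁻¹ : ℝ) : ℂ) • (k i - k' i)
  e_f_ne : ∀ i j, i ≠ j → e i * f j - f j * e i = 0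
  serre_e : ∀ i j, i ≠ j → serre (D.qi i) (D.serreExp i j) (e i) (e j) = 0
  serre_f : ∀ i j, i ≠ j → serre (D.qi i) (D.serreExp i j) (f i) (f j) = 0

open FreeAlgebra in
/-- The defining relations of `U_q(𝔤)` in the free algebra. -/
inductive UqRel (D : QuantumDatum I) : FreeAlgebra ℂ (Gen I) → FreeAlgebra ℂ (Gen I) → Prop
  | K_mul_Kinv (i) : UqRel D (ι ℂ (.K i) * ι ℂ (.Kinv i)) 1
  | Kinv_mul_K (i) : UqRel D (ι ℂ (.Kinv i) * ι ℂ (.K i)) 1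
  | K_comm (i j) : UqRel D (ι ℂ (.K i) * ι ℂ (.K j)) (ι ℂ (.K j) * ι ℂ (.K i))
  | K_E (i j) : UqRel D (ι ℂ (.K i) * ι ℂ (.E j) * ι ℂ (.Kinv i))
      (((D.qi i ^ D.a i j : ℝ) : ℂ) • ι ℂ (.E j))
  | K_F (i j) : UqRel D (ι ℂ (.K i) * ι ℂ (.F j) * ι ℂ (.Kinv i))
      (((D.qi i ^ (-D.a i j) : ℝ) : ℂ) • ι ℂ (.F j))
  | E_F_same (i) : UqRel D (ι ℂ (.E i) * ι ℂ (.F i) - ι ℂ (.F i) * ι ℂ (.E i))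
      ((((D.qi i - (D.qi i)⁻¹)⁻¹ : ℝ) : ℂ) • (ι ℂ (.K i) - ι ℂ (.Kinv i)))
  | E_F_ne (i j) (h : i ≠ j) : UqRel D (ι ℂ (.E i) * ι ℂ (.F j) - ι ℂ (.F j) * ι ℂ (.E i)) 0
  | serre_E (i j) (h : i ≠ j) :
      UqRel D (serre (D.qi i) (D.serreExp i j) (ι ℂ (.E i)) (ι ℂ (.E j))) 0
  | serre_F (i j) (h : i ≠ j) :
      UqRel D (serre (D.qi i) (D.serreExp i j) (ι ℂ (.F i)) (ι ℂ (.F j))) 0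

/-- The quantized universal enveloping algebra `U_q(𝔤)`. -/
def Uq (D : QuantumDatum I) : Type _ := RingQuot (UqRel D)

instance (D : QuantumDatum I) : Ring (Uq D) := inferInstanceAs (Ring (RingQuot (UqRel D)))

instance instAlgebraUq (D : QuantumDatum I) : Algebra ℂ (Uq D) :=
  inferInstanceAs (Algebra ℂ (RingQuot (UqRel D)))

namespace Uq

variable (D : QuantumDatum I)

/-- The quotient map from the free algebra. -/
def mk : FreeAlgebra ℂ (Gen I) →ₐ[ℂ] Uq D := RingQuot.mkAlgHom ℂ (UqRel D)

/-- The generator `E_i`. -/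
def E (i : I) : Uq D := mk D (FreeAlgebra.ι ℂ (.E i))
/-- The generator `F_i`. -/
def F (i : I) : Uq D := mk D (FreeAlgebra.ι ℂ (.F i))
/-- The generator `K_i`. -/
def K (i : I) : Uq D := mk D (FreeAlgebra.ι ℂ (.K i))
/-- The generator `K_i⁻¹`. -/
def Kinv (i : I) : Uq D := mk D (FreeAlgebra.ι ℂ (.Kinv i))

theorem mk_eq {x y : FreeAlgebra ℂ (Gen I)} (h : UqRel D x y) : mk D x = mk D y :=
  RingQuot.mkAlgHom_rel ℂ h

theorem isUqTuple : IsUqTuple D (E D) (F D) (K D) (Kinv D) where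
  k_mul_k' i := by simpa [K, Kinv] using mk_eq D (.K_mul_Kinv i)
  k'_mul_k i := by simpa [K, Kinv] using mk_eq D (.Kinv_mul_K i)
  k_comm i j := by simpa [K] using mk_eq D (.K_comm i j)
  k_e i j := by simpa only [K, Kinv, E, map_mul, map_smul] using mk_eq D (.K_E i j)
  k_f i j := by simpa only [K, Kinv, F, map_mul, map_smul] using mk_eq D (.K_F i j)
  e_f_same i := by
    simpa only [K, Kinv, E, F, map_mul, map_smul, map_sub] using mk_eq D (.E_F_same i)
  e_f_ne i j h := by
    simpa only [E, F, map_mul, map_sub, map_zero] using mk_eq D (.E_F_ne i j h)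
  serre_e i j h := by simpa only [E, map_serre, map_zero] using mk_eq D (.serre_E i j h)
  serre_f i j h := by simpa only [F, map_serre, map_zero] using mk_eq D (.serre_F i j h)

variable {D} {B : Type*} [Ring B] [Algebra ℂ B]

/-- The universal property of `U_q(𝔤)`. -/
def lift {e f k k' : I → B} (h : IsUqTuple D e f k k') : Uq D →ₐ[ℂ] B :=
  RingQuot.liftAlgHom ℂ ⟨FreeAlgebra.lift ℂ (fun g => match g with
    | .E i => e i
    | .F i => f i
    | .K i => k i
    | .Kinv i => k' i), by
      intro x y r
      induction r with
      | K_mul_Kinv i => simpa using h.k_mul_k' i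
      | Kinv_mul_K i => simpa using h.k'_mul_k i
      | K_comm i j => simpa using h.k_comm i j
      | K_E i j => simpa only [map_mul, map_smul, FreeAlgebra.lift_ι_apply] using h.k_e i j
      | K_F i j => simpa only [map_mul, map_smul, FreeAlgebra.lift_ι_apply] using h.k_f i j
      | E_F_same i =>
        simpa only [map_mul, map_smul, map_sub, FreeAlgebra.lift_ι_apply] using h.e_f_same i
      | E_F_ne i j hij =>
        simpa only [map_mul, map_sub, map_zero, FreeAlgebra.lift_ι_apply] using h.e_f_ne i j hij
      | serre_E i j hij =>
        simpa only [map_serre, map_zero, FreeAlgebra.lift_ι_apply] using h.serre_e i j hij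
      | serre_F i j hij =>
        simpa only [map_serre, map_zero, FreeAlgebra.lift_ι_apply] using h.serre_f i j hij⟩

section lift
variable {e f k k' : I → B} (h : IsUqTuple D e f k k') (i : I)

theorem lift_mk (x : FreeAlgebra ℂ (Gen I)) : lift h (mk D x) = FreeAlgebra.lift ℂ (fun g => match g with
    | .E i => e i
    | .F i => f i
    | .K i => k i
    | .Kinv i => k' i) x := by
  unfold lift mk
  exact RingQuot.liftAlgHom_mkAlgHom_apply ..

@[simp] theorem lift_E : lift h (E D i) = e i := by rw [E, lift_mk, FreeAlgebra.lift_ι_apply]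
@[simp] theorem lift_F : lift h (F D i) = f i := by rw [F, lift_mk, FreeAlgebra.lift_ι_apply]
@[simp] theorem lift_K : lift h (K D i) = k i := by rw [K, lift_mk, FreeAlgebra.lift_ι_apply]
@[simp] theorem lift_Kinv : lift h (Kinv D i) = k' i := by
  rw [Kinv, lift_mk, FreeAlgebra.lift_ι_apply]

end lift

theorem algHom_ext {φ ψ : Uq D →ₐ[ℂ] B} (hE : ∀ i, φ (E D i) = ψ (E D i))
    (hF : ∀ i, φ (F D i) = ψ (F D i)) (hK : ∀ i, φ (K D i) = ψ (K D i))
    (hKinv : ∀ i, φ (Kinv D i) = ψ (Kinv D i)) : φ = ψ := by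
  refine RingQuot.ringQuot_ext' ℂ φ ψ (FreeAlgebra.hom_ext (funext fun g => ?_))
  cases g with
  | E i => exact hE i
  | F i => exact hF i
  | K i => exact hK i
  | Kinv i => exact hKinv i


/-! ### Hopf structure -/

theorem K_E (i j : I) :
    K D i * E D j = ((D.qi i ^ D.a i j : ℝ) : ℂ) • (E D j * K D i) := by
  rw [← smul_mul_assoc, ← (isUqTuple D).k_e, mul_assoc, (isUqTuple D).k'_mul_k, mul_one]

theorem K_F (i j : I) :
    K D i * F D j = ((D.qi i ^ (-D.a i j) : ℝ) : ℂ) • (F D j * K D i) := by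
  rw [← smul_mul_assoc, ← (isUqTuple D).k_f, mul_assoc, (isUqTuple D).k'_mul_k, mul_one]

@[simp] theorem K_Kinv (i : I) : K D i * Kinv D i = 1 := (isUqTuple D).k_mul_k' i
@[simp] theorem Kinv_K (i : I) : Kinv D i * K D i = 1 := (isUqTuple D).k'_mul_k i
theorem K_K (i j : I) : K D i * K D j = K D j * K D i := (isUqTuple D).k_comm i j

/-- Inverting a `q`-commutation relation. -/
theorem qcomm_inv {k k' x : B} (h : k * k' = 1) (h' : k' * k = 1) {r : ℝ} (hr : r ≠ 0)
    (hx : k * x = ((r : ℝ) : ℂ) • (x * k)) : k' * x = ((r⁻¹ : ℝ) : ℂ) • (x * k') := by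
  have h1 : x * k' = ((r : ℝ) : ℂ) • (k' * x) := by
    calc x * k' = k' * (k * x) * k' := by rw [← mul_assoc k', h', one_mul]
      _ = _ := by rw [hx, mul_smul_comm, smul_mul_assoc, ← mul_assoc, mul_assoc, h, mul_one]
  rw [h1, smul_smul, ← Complex.ofReal_mul, inv_mul_cancel₀ hr]
  simp

theorem Kinv_E (i j : I) :
    Kinv D i * E D j = ((D.qi i ^ (-D.a i j) : ℝ) : ℂ) • (E D j * Kinv D i) := by
  rw [qcomm_inv (K_Kinv i) (Kinv_K i) (zpow_ne_zero _ (D.qi_pos i).ne') (K_E i j), zpow_neg]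

theorem Kinv_F (i j : I) :
    Kinv D i * F D j = ((D.qi i ^ D.a i j : ℝ) : ℂ) • (F D j * Kinv D i) := by
  rw [qcomm_inv (K_Kinv i) (Kinv_K i) (zpow_ne_zero _ (D.qi_pos i).ne') (K_F i j), zpow_neg,
    inv_inv]

theorem Kinv_K' (i j : I) : Kinv D i * K D j = K D j * Kinv D i := by
  have := qcomm_inv (K_Kinv (D := D) i) (Kinv_K i) one_ne_zero (x := K D j)
    (by simpa using K_K i j)
  simpa using this

theorem Kinv_Kinv (i j : I) : Kinv D i * Kinv D j = Kinv D j * Kinv D i := by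
  have := qcomm_inv (K_Kinv (D := D) i) (Kinv_K i) one_ne_zero (x := Kinv D j)
    (by simpa using (Kinv_K' j i).symm)
  simpa using this

theorem E_K (i j : I) :
    E D j * K D i = ((D.qi i ^ (-D.a i j) : ℝ) : ℂ) • (K D i * E D j) := by
  rw [K_E, smul_smul, ← Complex.ofReal_mul, ← zpow_add₀ (D.qi_pos i).ne']
  simp

theorem F_K (i j : I) :
    F D j * K D i = ((D.qi i ^ (D.a i j) : ℝ) : ℂ) • (K D i * F D j) := by
  rw [K_F, smul_smul, ← Complex.ofReal_mul, ← zpow_add₀ (D.qi_pos i).ne']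
  simp

theorem E_Kinv (i j : I) :
    E D j * Kinv D i = ((D.qi i ^ (D.a i j) : ℝ) : ℂ) • (Kinv D i * E D j) := by
  rw [Kinv_E, smul_smul, ← Complex.ofReal_mul, ← zpow_add₀ (D.qi_pos i).ne']
  simp

theorem F_Kinv (i j : I) :
    F D j * Kinv D i = ((D.qi i ^ (-D.a i j) : ℝ) : ℂ) • (Kinv D i * F D j) := by
  rw [Kinv_F, smul_smul, ← Complex.ofReal_mul, ← zpow_add₀ (D.qi_pos i).ne']
  simp

theorem E_F_ne {i j : I} (h : i ≠ j) : E D i * F D j = F D j * E D i :=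
  sub_eq_zero.1 ((isUqTuple D).e_f_ne i j h)

theorem E_F_same (i : I) : E D i * F D i = F D i * E D i +
    (((D.qi i - (D.qi i)⁻¹)⁻¹ : ℝ) : ℂ) • (K D i - Kinv D i) :=
  eq_add_of_sub_eq' ((isUqTuple D).e_f_same i)

/-- `q_j^{a_ji}` in terms of `q_i`. -/
theorem symm_neg (i j : I) : D.qi j ^ (-D.a j i) = D.qi i ^ (-D.a i j) := by
  rw [zpow_neg, zpow_neg, D.symm]

/-- A sufficient condition for the relations, in commutation form. -/
theorem _root_.Quantum.IsUqTuple.of_comm {e f k k' : I → B}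
    (k_mul_k' : ∀ i, k i * k' i = 1) (k'_mul_k : ∀ i, k' i * k i = 1)
    (k_comm : ∀ i j, k i * k j = k j * k i)
    (k_e : ∀ i j, k i * e j = ((D.qi i ^ D.a i j : ℝ) : ℂ) • (e j * k i))
    (k_f : ∀ i j, k i * f j = ((D.qi i ^ (-D.a i j) : ℝ) : ℂ) • (f j * k i))
    (e_f_same : ∀ i, e i * f i - f i * e i =
      (((D.qi i - (D.qi i)⁻¹)⁻¹ : ℝ) : ℂ) • (k i - k' i))
    (e_f_ne : ∀ i j, i ≠ j → e i * f j - f j * e i = 0)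
    (serre_e : ∀ i j, i ≠ j → serre (D.qi i) (D.serreExp i j) (e i) (e j) = 0)
    (serre_f : ∀ i j, i ≠ j → serre (D.qi i) (D.serreExp i j) (f i) (f j) = 0) :
    IsUqTuple D e f k k' where
  k_mul_k' := k_mul_k'
  k'_mul_k := k'_mul_k
  k_comm := k_comm
  k_e i j := by rw [k_e, smul_mul_assoc, mul_assoc, k_mul_k', mul_one]
  k_f i j := by rw [k_f, smul_mul_assoc, mul_assoc, k_mul_k', mul_one]
  e_f_same := e_f_same
  e_f_ne := e_f_ne
  serre_e := serre_e
  serre_f := serre_f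

theorem serre_zero_right (q : ℝ) (n : ℕ) (x : B) : serre q n x 0 = 0 := by simp [serre]

variable (D) in
theorem counit_tuple : IsUqTuple D (fun _ => (0 : ℂ)) (fun _ => 0) (fun _ => 1) (fun _ => 1) :=
  .of_comm (by simp) (by simp) (by simp) (by simp) (by simp) (by simp) (by simp)
    (by simp [serre_zero_right]) (by simp [serre_zero_right])

variable (D) in
/-- The counit `ε`. -/
def counitHom : Uq D →ₐ[ℂ] ℂ := lift (counit_tuple D)

theorem map_serre_eq_zero {B' : Type*} [Ring B'] [Algebra ℂ B'] (φ : B →ₐ[ℂ] B') {q : ℝ} {n : ℕ}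
    {x y : B} (h : serre q n x y = 0) : serre q n (φ x) (φ y) = 0 := by
  rw [← map_serre, h, map_zero]

theorem serre_of_comm {q : ℝ} (hq : 0 < q) (hq1 : q ≠ 1) {a : ℤ} {n : ℕ} (ha : a = 1 - n)
    {κ μ x y : B} (hκμ : κ * μ = μ * κ) (hκx : κ * x = x * κ)
    (hκy : κ * y = y * κ) (hμx : μ * x = x * μ) (h : serre q n x y = 0) :
    serre q n (x * κ) (y * μ) = 0 :=
  serre_mul hq hq1 (e := 0) ha hκμ (by simpa using hκx) (by simpa using hκy)
    (by simpa using hμx) h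

variable (D) in
theorem comul_tuple : IsUqTuple D (B := Uq D ⊗[ℂ] Uq D)
    (fun i => E D i ⊗ₜ K D i + 1 ⊗ₜ E D i) (fun i => F D i ⊗ₜ 1 + Kinv D i ⊗ₜ F D i)
    (fun i => K D i ⊗ₜ K D i) (fun i => Kinv D i ⊗ₜ Kinv D i) := by
  have hsE (i j : I) (h : i ≠ j) :
      serre (D.qi i) (D.serreExp i j) (E D i ⊗ₜ[ℂ] K D i) (E D j ⊗ₜ[ℂ] K D j) = 0 := by
    have h1 := map_serre_eq_zero (Algebra.TensorProduct.includeLeft (R := ℂ) (S := ℂ) (A := Uq D)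
      (B := Uq D)) ((isUqTuple D).serre_e i j h)
    have := serre_of_comm (D.qi_pos i) (D.qi_ne_one i) (D.a_eq h) (κ := 1 ⊗ₜ[ℂ] K D i)
      (μ := 1 ⊗ₜ[ℂ] K D j) (by simp [K_K i j]) (by simp) (by simp) (by simp) h1
    simpa using this
  have hsF (i j : I) (h : i ≠ j) :
      serre (D.qi i) (D.serreExp i j) (Kinv D i ⊗ₜ[ℂ] F D i) (Kinv D j ⊗ₜ[ℂ] F D j) = 0 := by
    have h1 := map_serre_eq_zero (Algebra.TensorProduct.includeRight (R := ℂ) (A := Uq D)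
      (B := Uq D)) ((isUqTuple D).serre_f i j h)
    have := serre_of_comm (D.qi_pos i) (D.qi_ne_one i) (D.a_eq h) (κ := Kinv D i ⊗ₜ[ℂ] 1)
      (μ := Kinv D j ⊗ₜ[ℂ] 1) (by simp [Kinv_Kinv i j]) (by simp) (by simp) (by simp) h1
    simpa using this
  refine .of_comm ?_ ?_ ?_ ?_ ?_ ?_ ?_ ?_ ?_
  · intro i; simp [Algebra.TensorProduct.one_def]
  · intro i; simp [Algebra.TensorProduct.one_def]
  · intro i j; simp [K_K i j]
  · intro i j
    simp only [mul_add, add_mul, Algebra.TensorProduct.tmul_mul_tmul, mul_one, one_mul, K_E,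
      K_K i j, smul_add, TensorProduct.smul_tmul', TensorProduct.tmul_smul]
  · intro i j
    simp only [mul_add, add_mul, Algebra.TensorProduct.tmul_mul_tmul, mul_one, one_mul, K_F,
      Kinv_K', smul_add, TensorProduct.smul_tmul', TensorProduct.tmul_smul]
  · intro i
    have h1 : (E D i * Kinv D i) ⊗ₜ[ℂ] (K D i * F D i) =
        (Kinv D i * E D i) ⊗ₜ[ℂ] (F D i * K D i) := by
      rw [E_Kinv, K_F, TensorProduct.smul_tmul, smul_smul, ← Complex.ofReal_mul,
        ← zpow_add₀ (D.qi_pos i).ne']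
      simp
    simp only [mul_add, add_mul, Algebra.TensorProduct.tmul_mul_tmul, mul_one, one_mul, h1,
      E_F_same, TensorProduct.add_tmul, TensorProduct.tmul_add, TensorProduct.sub_tmul,
      TensorProduct.tmul_sub, ← TensorProduct.smul_tmul', TensorProduct.tmul_smul, smul_sub]
    abel
  · intro i j h
    have h1 : (E D i * Kinv D j) ⊗ₜ[ℂ] (K D i * F D j) =
        (Kinv D j * E D i) ⊗ₜ[ℂ] (F D j * K D i) := by
      rw [E_Kinv, K_F, TensorProduct.smul_tmul, smul_smul, ← Complex.ofReal_mul, D.symm j i,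
        ← zpow_add₀ (D.qi_pos i).ne']
      simp
    simp only [mul_add, add_mul, Algebra.TensorProduct.tmul_mul_tmul, mul_one, one_mul, h1,
      E_F_ne h]
    abel
  · intro i j h
    have h1 := map_serre_eq_zero (Algebra.TensorProduct.includeRight (R := ℂ) (A := Uq D)
      (B := Uq D)) ((isUqTuple D).serre_e i j h)
    refine serre_add (D.qi_pos i) (D.qi_ne_one i) (D.a_eq h) ?_ ?_ ?_ (hsE i j h) h1
    · simp [E_K, D.a_self]
    · simp only [Algebra.TensorProduct.tmul_mul_tmul, mul_one, one_mul, E_K, symm_neg i j,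
        TensorProduct.tmul_smul]
    · simp only [Algebra.TensorProduct.tmul_mul_tmul, mul_one, one_mul, K_E,
        TensorProduct.tmul_smul]
  · intro i j h
    have h1 := map_serre_eq_zero (Algebra.TensorProduct.includeLeft (R := ℂ) (S := ℂ) (A := Uq D)
      (B := Uq D)) ((isUqTuple D).serre_f i j h)
    have := serre_add (D.qi_pos i) (D.qi_ne_one i) (D.a_eq h) (p := Kinv D i ⊗ₜ[ℂ] F D i)
      (s := Kinv D j ⊗ₜ[ℂ] F D j) (r := F D i ⊗ₜ[ℂ] 1) (t := F D j ⊗ₜ[ℂ] 1)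
      ?_ ?_ ?_ (hsF i j h) h1
    · rwa [add_comm, add_comm (Kinv D j ⊗ₜ[ℂ] F D j)] at this
    · simp only [Algebra.TensorProduct.tmul_mul_tmul, mul_one, one_mul, F_Kinv, D.a_self,
        TensorProduct.smul_tmul']
    · simp only [Algebra.TensorProduct.tmul_mul_tmul, mul_one, one_mul, F_Kinv, symm_neg i j,
        TensorProduct.smul_tmul']
    · simp only [Algebra.TensorProduct.tmul_mul_tmul, mul_one, one_mul, Kinv_F,
        TensorProduct.smul_tmul']

variable (D) in
/-- The coproduct `Δ`. -/
def comulHom : Uq D →ₐ[ℂ] Uq D ⊗[ℂ] Uq D := lift (comul_tuple D)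

instance instBialgebra : Bialgebra ℂ (Uq D) :=
  Bialgebra.ofAlgHom (comulHom D) (counitHom D)
    (by
      apply algHom_ext <;> intro i <;>
        simp [comulHom, TensorProduct.add_tmul, TensorProduct.tmul_add,
          Algebra.TensorProduct.one_def, add_assoc])
    (by apply algHom_ext <;> intro i <;> simp [comulHom, counitHom])
    (by apply algHom_ext <;> intro i <;> simp [comulHom, counitHom])

open MulOpposite

theorem serre_op {q : ℝ} {n : ℕ} {x y : B} (h : serre q n x y = 0) :
    serre q n (op x) (op y) = 0 := by
  have h1 : serre q n (op x) (op y) = op ((-1 : ℂ) ^ n • serre q n x y) := by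
    rw [← serre_reverse, serre, Finset.op_sum]
    refine Finset.sum_congr rfl fun k _ => ?_
    simp only [op_smul, op_mul, op_pow, mul_assoc]
  rw [h1, h, smul_zero, op_zero]

variable (D) in
theorem antipode_tuple : IsUqTuple D (B := (Uq D)ᵐᵒᵖ) (fun i => op (-(E D i * Kinv D i)))
    (fun i => op (-(K D i * F D i))) (fun i => op (Kinv D i)) (fun i => op (K D i)) := by
  refine .of_comm ?_ ?_ ?_ ?_ ?_ ?_ ?_ ?_ ?_
  · intro i; simp [← op_mul]
  · intro i; simp [← op_mul]
  · intro i j; simp only [← op_mul, Kinv_Kinv i j]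
  · intro i j
    simp only [← op_mul, ← op_smul, neg_mul, mul_neg, smul_neg]
    rw [← mul_assoc, Kinv_E, smul_mul_assoc, smul_smul, ← Complex.ofReal_mul,
      ← zpow_add₀ (D.qi_pos i).ne', mul_assoc, mul_assoc, Kinv_Kinv i j]
    simp
  · intro i j
    simp only [← op_mul, ← op_smul, neg_mul, mul_neg, smul_neg]
    rw [mul_assoc, F_Kinv, mul_smul_comm, ← mul_assoc, ← Kinv_K', mul_assoc]
  · intro i
    simp only [← op_mul, ← op_smul, ← op_sub, neg_mul_neg]
    congr 1
    have h1 : E D i * Kinv D i * (K D i * F D i) = E D i * F D i := by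
      rw [mul_assoc, ← mul_assoc (Kinv D i), Kinv_K, one_mul]
    have h2 : K D i * F D i * (E D i * Kinv D i) = F D i * E D i := by
      rw [K_F, E_Kinv, smul_mul_assoc, mul_smul_comm, smul_smul, ← Complex.ofReal_mul,
        ← zpow_add₀ (D.qi_pos i).ne', mul_assoc, ← mul_assoc (K D i), K_Kinv, one_mul]
      simp
    rw [h1, h2, E_F_same, sub_add_cancel_left, ← smul_neg, neg_sub]
  · intro i j h
    simp only [← op_mul, ← op_sub, neg_mul_neg]
    have h1 : E D i * Kinv D i * (K D j * F D j) = K D j * F D j * (E D i * Kinv D i) := by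
      rw [mul_assoc, ← mul_assoc (Kinv D i), Kinv_K', mul_assoc, Kinv_F, mul_smul_comm,
        mul_smul_comm, ← mul_assoc, E_K, smul_mul_assoc, smul_smul, symm_neg i j,
        ← Complex.ofReal_mul, ← zpow_add₀ (D.qi_pos i).ne', mul_assoc, ← mul_assoc (E D i),
        E_F_ne h]
      simp [mul_assoc]
    rw [h1, sub_self, op_zero]
  · intro i j h
    apply serre_op
    have := serre_mul (D.qi_pos i) (D.qi_ne_one i) (e := -1) (D.a_eq h) (Kinv_Kinv i j)
      (by simpa [D.a_self] using Kinv_E (D := D) i i) (by simpa using Kinv_E i j)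
      (by simpa [symm_neg i j] using Kinv_E j i) ((isUqTuple D).serre_e i j h)
    have h2 := serre_smul (D.qi i) (D.serreExp i j) (-1) (-1) (E D i * Kinv D i)
      (E D j * Kinv D j)
    rwa [this, smul_zero, neg_one_smul, neg_one_smul] at h2
  · intro i j h
    apply serre_op
    have := serre_mul (D.qi_pos i) (D.qi_ne_one i) (e := -1) (D.a_eq h) (K_K i j)
      (by simpa [D.a_self] using K_F (D := D) i i) (by simpa using K_F i j)
      (by simpa [symm_neg i j] using K_F j i) ((isUqTuple D).serre_f i j h)
    have h2 := serre_smul (D.qi i) (D.serreExp i j) (-((D.qi i ^ (-D.a i i) : ℝ) : ℂ))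
      (-((D.qi j ^ (-D.a j j) : ℝ) : ℂ)) (F D i * K D i) (F D j * K D j)
    rwa [this, smul_zero, neg_smul, neg_smul, ← K_F, ← K_F] at h2

variable (D) in
/-- The antipode `S`, as a homomorphism to the opposite algebra. -/
def antipodeHom : Uq D →ₐ[ℂ] (Uq D)ᵐᵒᵖ := lift (antipode_tuple D)

variable (D) in
/-- The antipode `S`. -/
def antipode : Uq D →ₗ[ℂ] Uq D :=
  (opLinearEquiv ℂ).symm.toLinearMap ∘ₗ (antipodeHom D).toLinearMap


end Uq

/-- The complex conjugate of a complex algebra: the same ring, with `c` acting as `conj c`. -/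
def ConjAlg (B : Type*) : Type _ := B

instance {B : Type*} [Ring B] : Ring (ConjAlg B) := inferInstanceAs (Ring B)

instance instAlgebraConjAlg {B : Type*} [Ring B] [Algebra ℂ B] : Algebra ℂ (ConjAlg B) :=
  RingHom.toAlgebra' (show ℂ →+* ConjAlg B from (algebraMap ℂ B).comp (starRingEnd ℂ))
    (fun c (x : B) => Algebra.commutes ((starRingEnd ℂ) c) x)

/-- The identity map to the conjugate algebra. -/
def toConj {B : Type*} [Ring B] : B ≃+* ConjAlg B := RingEquiv.refl B

theorem smul_toConj {B : Type*} [Ring B] [Algebra ℂ B] (c : ℂ) (x : B) :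
    c • toConj x = toConj ((starRingEnd ℂ) c • x) := by
  rw [Algebra.smul_def, Algebra.smul_def]
  rfl

theorem smul_toConj_real {B : Type*} [Ring B] [Algebra ℂ B] (c : ℝ) (x : B) :
    ((c : ℝ) : ℂ) • toConj x = toConj (((c : ℝ) : ℂ) • x) := by
  rw [smul_toConj, Complex.conj_ofReal]

theorem serre_toConj {B : Type*} [Ring B] [Algebra ℂ B] (q : ℝ) (n : ℕ) (x y : B) :
    serre q n (toConj x) (toConj y) = toConj (serre q n x y) := by
  simp only [serre, map_sum, ← smul_toConj_real, map_mul, map_pow]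

/-- The relations are real, so they pass to the conjugate algebra. -/
theorem IsUqTuple.conj {D : QuantumDatum I} {e f k k' : I → B} (h : IsUqTuple D e f k k') :
    IsUqTuple D (fun i => toConj (e i)) (fun i => toConj (f i)) (fun i => toConj (k i))
      (fun i => toConj (k' i)) where
  k_mul_k' i := by rw [← map_mul, h.k_mul_k', map_one]
  k'_mul_k i := by rw [← map_mul, h.k'_mul_k, map_one]
  k_comm i j := by rw [← map_mul, h.k_comm, map_mul]
  k_e i j := by rw [← map_mul, ← map_mul, h.k_e, smul_toConj_real]
  k_f i j := by rw [← map_mul, ← map_mul, h.k_f, smul_toConj_real]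
  e_f_same i := by rw [← map_mul, ← map_mul, ← map_sub, h.e_f_same, ← map_sub, smul_toConj_real]
  e_f_ne i j hij := by rw [← map_mul, ← map_mul, ← map_sub, h.e_f_ne i j hij, map_zero]
  serre_e i j hij := by rw [serre_toConj, h.serre_e i j hij, map_zero]
  serre_f i j hij := by rw [serre_toConj, h.serre_f i j hij, map_zero]

namespace Uq

open MulOpposite

variable {D : QuantumDatum I}

variable (D) in
theorem star_tuple : IsUqTuple D (B := (Uq D)ᵐᵒᵖ) (fun i => op (K D i * F D i))
    (fun i => op (E D i * Kinv D i)) (fun i => op (K D i)) (fun i => op (Kinv D i)) := by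
  refine .of_comm ?_ ?_ ?_ ?_ ?_ ?_ ?_ ?_ ?_
  · intro i; simp [← op_mul]
  · intro i; simp [← op_mul]
  · intro i j; simp only [← op_mul, K_K i j]
  · intro i j
    simp only [← op_mul, ← op_smul]
    rw [mul_assoc, F_K, mul_smul_comm, ← mul_assoc, K_K, mul_assoc]
  · intro i j
    simp only [← op_mul, ← op_smul]
    rw [mul_assoc, Kinv_K', ← mul_assoc, E_K, smul_mul_assoc, mul_assoc]
  · intro i
    simp only [← op_mul, ← op_smul, ← op_sub]
    congr 1
    have h1 : E D i * Kinv D i * (K D i * F D i) = E D i * F D i := by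
      rw [mul_assoc, ← mul_assoc (Kinv D i), Kinv_K, one_mul]
    have h2 : K D i * F D i * (E D i * Kinv D i) = F D i * E D i := by
      rw [K_F, E_Kinv, smul_mul_assoc, mul_smul_comm, smul_smul, ← Complex.ofReal_mul,
        ← zpow_add₀ (D.qi_pos i).ne', mul_assoc, ← mul_assoc (K D i), K_Kinv, one_mul]
      simp
    rw [h1, h2, E_F_same, add_sub_cancel_left]
  · intro i j h
    simp only [← op_mul, ← op_sub]
    have h1 : E D j * Kinv D j * (K D i * F D i) = K D i * F D i * (E D j * Kinv D j) := by
      rw [mul_assoc, ← mul_assoc (Kinv D j), Kinv_K', mul_assoc, Kinv_F, mul_smul_comm,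
        mul_smul_comm, ← mul_assoc, E_K, smul_mul_assoc, smul_smul, symm_neg j i,
        ← Complex.ofReal_mul, ← zpow_add₀ (D.qi_pos j).ne', mul_assoc, ← mul_assoc (E D j),
        E_F_ne h.symm]
      simp [mul_assoc]
    rw [h1, sub_self, op_zero]
  · intro i j h
    apply serre_op
    have := serre_mul (D.qi_pos i) (D.qi_ne_one i) (e := -1) (D.a_eq h) (K_K i j)
      (by simpa [D.a_self] using K_F (D := D) i i) (by simpa using K_F i j)
      (by simpa [symm_neg i j] using K_F j i) ((isUqTuple D).serre_f i j h)
    have h2 := serre_smul (D.qi i) (D.serreExp i j) ((D.qi i ^ (-D.a i i) : ℝ) : ℂ)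
      ((D.qi j ^ (-D.a j j) : ℝ) : ℂ) (F D i * K D i) (F D j * K D j)
    rwa [this, smul_zero, ← K_F, ← K_F] at h2
  · intro i j h
    apply serre_op
    exact serre_mul (D.qi_pos i) (D.qi_ne_one i) (e := -1) (D.a_eq h) (Kinv_Kinv i j)
      (by simpa [D.a_self] using Kinv_E (D := D) i i) (by simpa using Kinv_E i j)
      (by simpa [symm_neg i j] using Kinv_E j i) ((isUqTuple D).serre_e i j h)

variable (D) in
/-- The involution of the compact real form, as a homomorphism to the conjugate opposite algebra. -/
def starHom : Uq D →ₐ[ℂ] ConjAlg (Uq D)ᵐᵒᵖ := lift (star_tuple D).conj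

instance instStarUq : Star (Uq D) where
  star x := unop (toConj.symm (starHom D x))

theorem star_def (x : Uq D) : star x = unop (toConj.symm (starHom D x)) := rfl

theorem star_add' (x y : Uq D) : star (x + y) = star x + star y := by simp [star_def]

theorem star_mul' (x y : Uq D) : star (x * y) = star y * star x := by simp [star_def]

theorem star_smul' (c : ℂ) (x : Uq D) : star (c • x) = (starRingEnd ℂ) c • star x := by
  obtain ⟨z, hz⟩ := (toConj (B := (Uq D)ᵐᵒᵖ)).surjective (starHom D x)
  rw [star_def, star_def, map_smul, ← hz, smul_toConj]
  simp

@[simp] theorem star_E (i : I) : star (E D i) = K D i * F D i := by simp [star_def, starHom]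
@[simp] theorem star_F (i : I) : star (F D i) = E D i * Kinv D i := by simp [star_def, starHom]
@[simp] theorem star_K (i : I) : star (K D i) = K D i := by simp [star_def, starHom]
@[simp] theorem star_Kinv (i : I) : star (Kinv D i) = Kinv D i := by simp [star_def, starHom]
theorem star_one' : star (1 : Uq D) = 1 := by simp [star_def]

@[simp] theorem antipode_E (i : I) : antipode D (E D i) = -(E D i * Kinv D i) := by
  simp [antipode, antipodeHom]
@[simp] theorem antipode_F (i : I) : antipode D (F D i) = -(K D i * F D i) := by
  simp [antipode, antipodeHom]
@[simp] theorem antipode_K (i : I) : antipode D (K D i) = Kinv D i := by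
  simp [antipode, antipodeHom]
@[simp] theorem antipode_Kinv (i : I) : antipode D (Kinv D i) = K D i := by
  simp [antipode, antipodeHom]

@[simp] theorem comul_E (i : I) :
    Coalgebra.comul (R := ℂ) (E D i) = E D i ⊗ₜ K D i + 1 ⊗ₜ E D i :=
  lift_E (comul_tuple D) i
@[simp] theorem comul_F (i : I) :
    Coalgebra.comul (R := ℂ) (F D i) = F D i ⊗ₜ 1 + Kinv D i ⊗ₜ F D i :=
  lift_F (comul_tuple D) i
@[simp] theorem comul_K (i : I) : Coalgebra.comul (R := ℂ) (K D i) = K D i ⊗ₜ K D i :=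
  lift_K (comul_tuple D) i
@[simp] theorem counit_K (i : I) : Coalgebra.counit (R := ℂ) (K D i) = 1 :=
  lift_K (counit_tuple D) i
@[simp] theorem counit_E (i : I) : Coalgebra.counit (R := ℂ) (E D i) = 0 :=
  lift_E (counit_tuple D) i
@[simp] theorem counit_F (i : I) : Coalgebra.counit (R := ℂ) (F D i) = 0 :=
  lift_F (counit_tuple D) i

variable (D) in
/-- The invertible element `K_i`. -/
def Kunit (i : I) : (Uq D)ˣ := ⟨K D i, Kinv D i, K_Kinv i, Kinv_K i⟩

theorem Kunit_comm (i j : I) : Commute (Kunit D i) (Kunit D j) := Units.ext (K_K i j)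

variable [Fintype I]

variable (D) in
/-- `K_λ = ∏ K_i^{n_i}` for `λ = ∑ n_i α_i` in the root lattice. -/
def Kpow (n : I → ℤ) : (Uq D)ˣ :=
  Finset.univ.noncommProd (fun i => Kunit D i ^ n i)
    (fun i _ j _ _ => ((Kunit_comm i j).zpow_left _).zpow_right _)

variable (D) in
/-- The subgroup of group-like units. -/
def groupLikeUnits : Subgroup (Uq D)ˣ where
  carrier := {u | IsGroupLikeElem ℂ (u : Uq D)}
  one_mem' := .one
  mul_mem' := .mul
  inv_mem' := .unitsInv

theorem isGroupLikeElem_Kpow (n : I → ℤ) : IsGroupLikeElem ℂ (Kpow D n : Uq D) := by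
  have : Kpow D n ∈ groupLikeUnits D :=
    Subgroup.noncommProd_mem _ _ fun i _ => Subgroup.zpow_mem _
      (show IsGroupLikeElem ℂ (K D i) from ⟨counit_K i, comul_K i⟩) _
  exact this

theorem Kpow_comm (n m : I → ℤ) : Commute (Kpow D n) (Kpow D m) := by
  refine Finset.noncommProd_commute _ _ _ _ fun i _ => Commute.symm ?_
  exact Finset.noncommProd_commute _ _ _ _ fun j _ =>
    ((Kunit_comm i j).zpow_left _).zpow_right _

end Uq

/-! ### Quantized coordinate rings -/

open WithConv

/-- The full linear dual of `U_q(𝔤)`, with the convolution product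
`(φψ)(X) = (φ ⊗ ψ)(Δ X)`. -/
abbrev UqDual (D : QuantumDatum I) : Type _ := WithConv (Uq D →ₗ[ℂ] ℂ)

namespace UqDual

variable {D : QuantumDatum I}

/-- The left action `(X ▷ φ)(Y) = φ(YX)`. -/
def leftAct (X : Uq D) : UqDual D →ₗ[ℂ] UqDual D where
  toFun φ := toConv (φ.ofConv ∘ₗ LinearMap.mulRight ℂ X)
  map_add' _ _ := rfl
  map_smul' _ _ := rfl

/-- The right action `(φ ◁ X)(Y) = φ(XY)`. -/
def rightAct (X : Uq D) : UqDual D →ₗ[ℂ] UqDual D where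
  toFun φ := toConv (φ.ofConv ∘ₗ LinearMap.mulLeft ℂ X)
  map_add' _ _ := rfl
  map_smul' _ _ := rfl

@[simp] theorem leftAct_apply (X Y : Uq D) (φ : UqDual D) : leftAct X φ Y = φ (Y * X) := rfl
@[simp] theorem rightAct_apply (X Y : Uq D) (φ : UqDual D) : rightAct X φ Y = φ (X * Y) := rfl

theorem leftAct_leftAct (X Y : Uq D) (φ : UqDual D) :
    leftAct X (leftAct Y φ) = leftAct (X * Y) φ := by
  ext Z; simp [mul_assoc]

theorem rightAct_rightAct (X Y : Uq D) (φ : UqDual D) :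
    rightAct X (rightAct Y φ) = rightAct (Y * X) φ := by
  ext Z; simp [mul_assoc]

theorem leftAct_rightAct (X Y : Uq D) (φ : UqDual D) :
    leftAct X (rightAct Y φ) = rightAct Y (leftAct X φ) := by
  ext Z; simp [mul_assoc]

theorem leftAct_mul {g : Uq D} (hg : IsGroupLikeElem ℂ g) (φ ψ : UqDual D) :
    leftAct g (φ * ψ) = leftAct g φ * leftAct g ψ := by
  ext Y
  rw [leftAct_apply, LinearMap.convMul_apply, LinearMap.convMul_apply, Bialgebra.comul_mul,
    hg.comul_eq_tmul_self]
  congr 1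
  induction Coalgebra.comul (R := ℂ) Y using TensorProduct.induction_on with
  | zero => simp
  | tmul x y => simp only [Algebra.TensorProduct.tmul_mul_tmul, TensorProduct.map_tmul]; rfl
  | add x y hx hy => rw [add_mul, map_add, map_add, hx, hy]

theorem rightAct_mul {g : Uq D} (hg : IsGroupLikeElem ℂ g) (φ ψ : UqDual D) :
    rightAct g (φ * ψ) = rightAct g φ * rightAct g ψ := by
  ext Y
  rw [rightAct_apply, LinearMap.convMul_apply, LinearMap.convMul_apply, Bialgebra.comul_mul,
    hg.comul_eq_tmul_self]
  congr 1
  induction Coalgebra.comul (R := ℂ) Y using TensorProduct.induction_on with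
  | zero => simp
  | tmul x y => simp only [Algebra.TensorProduct.tmul_mul_tmul, TensorProduct.map_tmul]; rfl
  | add x y hx hy => rw [mul_add, map_add, map_add, hx, hy]

theorem leftAct_one {g : Uq D} (hg : IsGroupLikeElem ℂ g) : leftAct g (1 : UqDual D) = 1 := by
  ext Y
  simp [hg.counit_eq_one]

theorem rightAct_one {g : Uq D} (hg : IsGroupLikeElem ℂ g) : rightAct g (1 : UqDual D) = 1 := by
  ext Y
  simp [hg.counit_eq_one]

/-- The involution `φ^*(X) = conj (φ (S(X)^*))`. -/
instance instStarUqDual : Star (UqDual D) where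
  star φ := toConv
    { toFun := fun X => (starRingEnd ℂ) (φ (star (Uq.antipode D X)))
      map_add' := fun X Y => by simp [Uq.star_add']
      map_smul' := fun c X => by simp [Uq.star_smul'] }

theorem star_apply (φ : UqDual D) (X : Uq D) :
    (star φ) X = (starRingEnd ℂ) (φ (star (Uq.antipode D X))) := rfl

/-- `σ_{λ,μ}(a) = K_λ ▷ a ◁ K_μ` on the dual. -/
def sigmaHom [Fintype I] (n m : I → ℤ) : UqDual D →ₐ[ℂ] UqDual D :=
  AlgHom.ofLinearMap (leftAct (Uq.Kpow D n : Uq D) ∘ₗ rightAct (Uq.Kpow D m : Uq D))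
    (by
      simp only [LinearMap.comp_apply]
      rw [rightAct_one (Uq.isGroupLikeElem_Kpow m), leftAct_one (Uq.isGroupLikeElem_Kpow n)])
    (fun φ ψ => by
      simp only [LinearMap.comp_apply]
      rw [rightAct_mul (Uq.isGroupLikeElem_Kpow m), leftAct_mul (Uq.isGroupLikeElem_Kpow n)])

end UqDual

section Coefficients

variable {D : QuantumDatum I} {V : Type*} [AddCommGroup V] [Module ℂ V]

/-- The matrix coefficient `c_{f,v}(X) = f(X ▷ v)`. -/
def matrixCoeff (π : Uq D →ₐ[ℂ] Module.End ℂ V) (f : Module.Dual ℂ V) (v : V) : UqDual D :=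
  toConv (f ∘ₗ LinearMap.applyₗ v ∘ₗ π.toLinearMap)

@[simp] theorem matrixCoeff_apply (π : Uq D →ₐ[ℂ] Module.End ℂ V) (f : Module.Dual ℂ V) (v : V)
    (X : Uq D) : matrixCoeff π f v X = f (π X v) := rfl

/-- A representation of type one: it is spanned by common eigenvectors of the `K_i` on which `K_i`
acts by integral powers of `q_i`. -/
def IsTypeOne (π : Uq D →ₐ[ℂ] Module.End ℂ V) : Prop :=
  Submodule.span ℂ {v : V | ∀ i, ∃ z : ℤ, π (Uq.K D i) v = ((D.qi i ^ z : ℝ) : ℂ) • v} = ⊤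

end Coefficients

/-- The matrix coefficients of the finite-dimensional representations of type one. -/
def coeffSet (D : QuantumDatum I) : Set (UqDual D) :=
  {φ | ∃ (V : Type) (_ : AddCommGroup V) (_ : Module ℂ V) (_ : FiniteDimensional ℂ V)
    (π : Uq D →ₐ[ℂ] Module.End ℂ V) (f : Module.Dual ℂ V) (v : V),
      IsTypeOne π ∧ φ = matrixCoeff π f v}

section Tensor

variable {D : QuantumDatum I} {V W : Type*} [AddCommGroup V] [Module ℂ V] [AddCommGroup W]
  [Module ℂ W]

/-- The tensor product of representations. -/
def tensorRep (π : Uq D →ₐ[ℂ] Module.End ℂ V) (π' : Uq D →ₐ[ℂ] Module.End ℂ W) :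
    Uq D →ₐ[ℂ] Module.End ℂ (V ⊗[ℂ] W) :=
  Module.endTensorEndAlgHom.comp
    ((Algebra.TensorProduct.map π π').comp (Bialgebra.comulAlgHom ℂ (Uq D)))

theorem IsTypeOne.tensor {π : Uq D →ₐ[ℂ] Module.End ℂ V} {π' : Uq D →ₐ[ℂ] Module.End ℂ W}
    (h : IsTypeOne π) (h' : IsTypeOne π') : IsTypeOne (tensorRep π π') := by
  unfold IsTypeOne at h h' ⊢
  rw [eq_top_iff, ← TensorProduct.map₂_mk_top_top_eq_top, ← h, ← h', Submodule.map₂_span_span,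
    Submodule.span_le]
  rintro _ ⟨v, hv, w, hw, rfl⟩
  refine Submodule.subset_span fun i => ?_
  obtain ⟨y, hy⟩ := hv i
  obtain ⟨z, hz⟩ := hw i
  refine ⟨y + z, ?_⟩
  have : tensorRep π π' (Uq.K D i) (v ⊗ₜ w) = (π (Uq.K D i) v) ⊗ₜ (π' (Uq.K D i) w) := by
    simp [tensorRep, Module.endTensorEndAlgHom_apply]
  change tensorRep π π' (Uq.K D i) (v ⊗ₜ w) = _ • (v ⊗ₜ[ℂ] w)
  rw [this, hy, hz, TensorProduct.smul_tmul_smul, ← Complex.ofReal_mul,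
    ← zpow_add₀ (D.qi_pos i).ne']

theorem matrixCoeff_mul (π : Uq D →ₐ[ℂ] Module.End ℂ V) (π' : Uq D →ₐ[ℂ] Module.End ℂ W)
    (f : Module.Dual ℂ V) (g : Module.Dual ℂ W) (v : V) (w : W) :
    matrixCoeff π f v * matrixCoeff π' g w =
      matrixCoeff (tensorRep π π') (LinearMap.mul' ℂ ℂ ∘ₗ TensorProduct.map f g) (v ⊗ₜ w) := by
  ext X
  rw [LinearMap.convMul_apply, matrixCoeff_apply, tensorRep, AlgHom.comp_apply, AlgHom.comp_apply,
    Bialgebra.comulAlgHom_apply, LinearMap.comp_apply]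
  congr 1
  induction Coalgebra.comul (R := ℂ) X using TensorProduct.induction_on with
  | zero => simp
  | tmul x y => simp [Module.endTensorEndAlgHom_apply, matrixCoeff]
  | add x y hx hy => simp only [map_add, LinearMap.add_apply, hx, hy]

theorem coeffSet_mul {φ ψ : UqDual D} (hφ : φ ∈ coeffSet D) (hψ : ψ ∈ coeffSet D) :
    φ * ψ ∈ coeffSet D := by
  obtain ⟨V, _, _, _, π, f, v, h, rfl⟩ := hφ
  obtain ⟨W, _, _, _, π', g, w, h', rfl⟩ := hψ
  exact ⟨V ⊗[ℂ] W, inferInstance, inferInstance, inferInstance, tensorRep π π', _, _, h.tensor h',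
    matrixCoeff_mul π π' f g v w⟩

theorem coeffSet_one : (1 : UqDual D) ∈ coeffSet D := by
  refine ⟨ℂ, inferInstance, inferInstance, inferInstance,
    (Algebra.ofId ℂ (Module.End ℂ ℂ)).comp (Bialgebra.counitAlgHom ℂ (Uq D)), LinearMap.id, 1,
    ?_, ?_⟩
  · rw [IsTypeOne, eq_top_iff]
    refine fun x _ => Submodule.subset_span fun i => ⟨0, ?_⟩
    simp [Algebra.ofId_apply]
  · ext X
    simp [Algebra.ofId_apply, Algebra.algebraMap_eq_smul_one]

end Tensor

/-- The quantized coordinate ring `ℂ_q[G]`. -/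
def coordRing (D : QuantumDatum I) : Subalgebra ℂ (UqDual D) :=
  (Submodule.span ℂ (coeffSet D)).toSubalgebra (Submodule.subset_span coeffSet_one) (by
    intro x y hx hy
    induction hx, hy using Submodule.span_induction₂ with
    | mem_mem x y hx hy => exact Submodule.subset_span (coeffSet_mul hx hy)
    | zero_left y _ => simp
    | zero_right x _ => simp
    | add_left x y z _ _ _ h1 h2 => rw [add_mul]; exact add_mem h1 h2
    | add_right x y z _ _ _ h1 h2 => rw [mul_add]; exact add_mem h1 h2
    | smul_left r x y _ _ h => rw [smul_mul_assoc]; exact Submodule.smul_mem _ _ h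
    | smul_right r x y _ _ h => rw [mul_smul_comm]; exact Submodule.smul_mem _ _ h)

theorem mem_coordRing {D : QuantumDatum I} {φ : UqDual D} :
    φ ∈ coordRing D ↔ φ ∈ Submodule.span ℂ (coeffSet D) := Iff.rfl

theorem leftAct_mem {D : QuantumDatum I} (X : Uq D) {φ : UqDual D} (h : φ ∈ coordRing D) :
    UqDual.leftAct X φ ∈ coordRing D := by
  rw [mem_coordRing] at h ⊢
  induction h using Submodule.span_induction with
  | mem φ h =>
    obtain ⟨V, _, _, _, π, f, v, h, rfl⟩ := h
    exact Submodule.subset_span ⟨V, _, _, inferInstance, π, f, π X v, h, by ext Y; simp⟩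
  | zero => simp
  | add x y _ _ h1 h2 => rw [map_add]; exact add_mem h1 h2
  | smul c x _ h => rw [map_smul]; exact Submodule.smul_mem _ _ h

theorem rightAct_mem {D : QuantumDatum I} (X : Uq D) {φ : UqDual D} (h : φ ∈ coordRing D) :
    UqDual.rightAct X φ ∈ coordRing D := by
  rw [mem_coordRing] at h ⊢
  induction h using Submodule.span_induction with
  | mem φ h =>
    obtain ⟨V, _, _, _, π, f, v, h, rfl⟩ := h
    exact Submodule.subset_span ⟨V, _, _, inferInstance, π, f ∘ₗ π X, v, h, by ext Y; simp⟩
  | zero => simp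
  | add x y _ _ h1 h2 => rw [map_add]; exact add_mem h1 h2
  | smul c x _ h => rw [map_smul]; exact Submodule.smul_mem _ _ h

variable [Fintype I]

/-- `ℂ_q[G/T] = {a ∈ ℂ_q[G] : K_λ ▷ a = a}`. -/
def flagRight (D : QuantumDatum I) : Subalgebra ℂ (UqDual D) where
  carrier := {a | a ∈ coordRing D ∧ ∀ n : I → ℤ, UqDual.leftAct (Uq.Kpow D n : Uq D) a = a}
  mul_mem' ha hb := ⟨mul_mem ha.1 hb.1, fun n => by
    rw [UqDual.leftAct_mul (Uq.isGroupLikeElem_Kpow n), ha.2, hb.2]⟩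
  add_mem' ha hb := ⟨add_mem ha.1 hb.1, fun n => by rw [map_add, ha.2, hb.2]⟩
  algebraMap_mem' c := ⟨Subalgebra.algebraMap_mem _ c, fun n => by
    rw [Algebra.algebraMap_eq_smul_one, map_smul,
      UqDual.leftAct_one (Uq.isGroupLikeElem_Kpow n)]⟩

/-- The ring of `a ∈ ℂ_q[G]` with `a ◁ K_λ = a` for all `λ`, that is, `ℂ_q` of the left quotient
of `G` by `T`. -/
def flagLeft (D : QuantumDatum I) : Subalgebra ℂ (UqDual D) where
  carrier := {a | a ∈ coordRing D ∧ ∀ n : I → ℤ, UqDual.rightAct (Uq.Kpow D n : Uq D) a = a}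
  mul_mem' ha hb := ⟨mul_mem ha.1 hb.1, fun n => by
    rw [UqDual.rightAct_mul (Uq.isGroupLikeElem_Kpow n), ha.2, hb.2]⟩
  add_mem' ha hb := ⟨add_mem ha.1 hb.1, fun n => by rw [map_add, ha.2, hb.2]⟩
  algebraMap_mem' c := ⟨Subalgebra.algebraMap_mem _ c, fun n => by
    rw [Algebra.algebraMap_eq_smul_one, map_smul,
      UqDual.rightAct_one (Uq.isGroupLikeElem_Kpow n)]⟩

theorem sigma_mem_flagRight {D : QuantumDatum I} (n m : I → ℤ) {a : UqDual D}
    (ha : a ∈ flagRight D) : UqDual.sigmaHom n m a ∈ flagRight D := by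
  refine ⟨leftAct_mem _ (rightAct_mem _ ha.1), fun k => ?_⟩
  change UqDual.leftAct _ (UqDual.leftAct _ (UqDual.rightAct _ a)) = _
  rw [UqDual.leftAct_leftAct, ← Units.val_mul, (Uq.Kpow_comm k n).eq, Units.val_mul,
    ← UqDual.leftAct_leftAct, UqDual.leftAct_rightAct, ha.2]
  rfl

theorem sigma_mem_flagLeft {D : QuantumDatum I} (n m : I → ℤ) {a : UqDual D}
    (ha : a ∈ flagLeft D) : UqDual.sigmaHom n m a ∈ flagLeft D := by
  refine ⟨leftAct_mem _ (rightAct_mem _ ha.1), fun k => ?_⟩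
  change UqDual.rightAct _ (UqDual.leftAct _ (UqDual.rightAct _ a)) = _
  rw [← UqDual.leftAct_rightAct, UqDual.rightAct_rightAct, ← Units.val_mul,
    (Uq.Kpow_comm m k).eq, Units.val_mul, ← UqDual.rightAct_rightAct, ha.2]
  rfl

theorem Kpow_mul_neg (D : QuantumDatum I) (n : I → ℤ) : Uq.Kpow D n * Uq.Kpow D (-n) = 1 := by
  refine (Finset.noncommProd_mul_distrib _ _ _ _
    (fun i _ j _ _ => ((Uq.Kunit_comm i j).zpow_left _).zpow_right _)).symm.trans ?_
  rw [Finset.noncommProd_eq_pow_card _ _ _ 1 (by simp), one_pow]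

theorem sigma_sigma_neg (D : QuantumDatum I) (n m : I → ℤ) (a : UqDual D) :
    UqDual.sigmaHom n m (UqDual.sigmaHom (-n) (-m) a) = a := by
  change UqDual.leftAct _ (UqDual.rightAct _ (UqDual.leftAct _ (UqDual.rightAct _ a))) = _
  rw [← UqDual.leftAct_rightAct, UqDual.leftAct_leftAct, UqDual.rightAct_rightAct,
    ← Units.val_mul, ← Units.val_mul, Kpow_mul_neg, (Uq.Kpow_comm (-m) m).eq, Kpow_mul_neg]
  ext X
  simp

/-- Restriction of `σ_{λ,μ}` to an invariant subalgebra, as an automorphism. -/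
def sigmaEquiv (D : QuantumDatum I) (S : Subalgebra ℂ (UqDual D))
    (hS : ∀ n m : I → ℤ, ∀ a ∈ S, UqDual.sigmaHom n m a ∈ S) (n m : I → ℤ) : S ≃ₐ[ℂ] S :=
  AlgEquiv.ofAlgHom
    (((UqDual.sigmaHom n m).comp S.val).codRestrict S fun a => hS n m a a.2)
    (((UqDual.sigmaHom (-n) (-m)).comp S.val).codRestrict S fun a => hS (-n) (-m) a a.2)
    (by ext1 a; exact Subtype.ext (sigma_sigma_neg D n m a))
    (by
      ext1 a
      refine Subtype.ext ?_
      have := sigma_sigma_neg D (-n) (-m) a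
      rwa [neg_neg, neg_neg] at this)

/-- The modular automorphism `θ(a) = K_{2ρ} ▷ a ◁ K_{2ρ}` on `ℂ_q[G/T]`, given `n` with `2ρ = ∑ n_i α_i`. -/
def thetaRight (D : QuantumDatum I) (n : I → ℤ) : flagRight D ≃ₐ[ℂ] flagRight D :=
  sigmaEquiv D (flagRight D) (fun n m _ h => sigma_mem_flagRight n m h) n n

/-- The modular automorphism `θ(a) = K_{2ρ} ▷ a ◁ K_{2ρ}` on the ring `flagLeft D`, given `n` with
`2ρ = ∑ n_i α_i`. -/
def thetaLeft (D : QuantumDatum I) (n : I → ℤ) : flagLeft D ≃ₐ[ℂ] flagLeft D :=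
  sigmaEquiv D (flagLeft D) (fun n m _ h => sigma_mem_flagLeft n m h) n n

end Quantum

namespace SimpleLie

open LieAlgebra LieAlgebra.IsKilling Module

variable {𝔤 : Type*} [LieRing 𝔤] [LieAlgebra ℂ 𝔤] [FiniteDimensional ℂ 𝔤]
  [LieAlgebra.IsSimple ℂ 𝔤] (H : LieSubalgebra ℂ 𝔤) [H.IsCartanSubalgebra]

/-- The element `t_α` of the Cartan subalgebra that represents the root `α` through the
Killing form. -/
def rootVec (α : H.root) : H := (cartanEquivDual H).symm ((rootSystem H).root α)

/-- The squared length `(α, α)` in the form on `𝔥^*` induced by the Killing form. -/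
def killingSq (α : H.root) : ℝ := (killingForm ℂ 𝔤 (rootVec H α) (rootVec H α)).re

/-- The squared length of the coroot, as an integer. -/
def corootSq (α : H.root) : ℤ := ((rootSystem H).flip.posRootForm ℤ).rootLength α

theorem corootSq_pos (α : H.root) : 0 < corootSq H α := RootPairing.RootPositiveForm.rootLength_pos _ _

theorem killing_rootVec (α : H.root) :
    killingForm ℂ 𝔤 (rootVec H α) (rootVec H α) = (4 / (corootSq H α : ℝ) : ℝ) := by
  have hc : killingForm ℂ 𝔤 (rootVec H α) (rootVec H α) = α.1 (rootVec H α) := by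
    have : cartanEquivDual H (rootVec H α) (rootVec H α) = α.1 (rootVec H α) := by
      rw [rootVec, LinearEquiv.apply_symm_apply]
      rfl
    rw [← this]
    rfl
  have h0 : α.1 (rootVec H α) ≠ 0 :=
    root_apply_cartanEquivDual_symm_ne_zero (LieSubalgebra.isNonZero_coe_root (H := H) α)
  have hs : ((corootSq H α : ℤ) : ℂ) = (rootSystem H).CorootForm (coroot α.1) (coroot α.1) := by
    rw [corootSq, ← eq_intCast (algebraMap ℤ ℂ), RootPairing.RootPositiveForm.algebraMap_rootLength]
    rfl
  have hcor : coroot α.1 = (2 * (α.1 (rootVec H α))⁻¹) • rootVec H α := by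
    rw [mul_smul, two_smul, ← two_nsmul]
    rfl
  rw [corootForm_rootSystem_eq_killing, hcor] at hs
  simp only [map_smul, LinearMap.smul_apply, smul_eq_mul] at hs
  have hp : ((corootSq H α : ℤ) : ℂ) ≠ 0 := by exact_mod_cast (corootSq_pos H α).ne'
  change _ = _ * (_ * killingForm ℂ 𝔤 (rootVec H α) (rootVec H α)) at hs
  rw [hc] at hs ⊢
  push_cast
  rw [eq_div_iff hp, hs]
  field_simp
  norm_num

theorem killingSq_eq (α : H.root) : killingSq H α = 4 / corootSq H α := by
  rw [killingSq, killing_rootVec, Complex.ofReal_re]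

theorem killingSq_pos (α : H.root) : 0 < killingSq H α := by
  rw [killingSq_eq]
  have : (0 : ℝ) < corootSq H α := by exact_mod_cast corootSq_pos H α
  positivity

/-- `d_α = (α, α) / 2` for the multiple of the Killing form in which short roots have squared
length `2`. -/
def halfLength (α : H.root) : ℝ := killingSq H α / ⨅ β : H.root, killingSq H β

theorem halfLength_pos (α : H.root) : 0 < halfLength H α := by
  have : Nonempty H.root := ⟨α⟩
  obtain ⟨β, hβ⟩ := exists_eq_ciInf_of_finite (f := fun β : H.root => killingSq H β)
  rw [halfLength, ← hβ]
  exact div_pos (killingSq_pos H α) (killingSq_pos H β)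

theorem halfLength_mul (α β : H.root) :
    halfLength H α * (rootSystem H).pairingIn ℤ β α =
      halfLength H β * (rootSystem H).pairingIn ℤ α β := by
  have h := RootPairing.RootPositiveForm.pairingIn_mul_eq_pairingIn_mul_swap
    (B := (rootSystem H).flip.posRootForm ℤ) α β
  change (rootSystem H).flip.pairingIn ℤ β α * corootSq H α =
    (rootSystem H).flip.pairingIn ℤ α β * corootSq H β at h
  have e (γ δ : H.root) : (rootSystem H).flip.pairingIn ℤ γ δ = (rootSystem H).pairingIn ℤ δ γ := by
    apply (algebraMap ℤ ℂ).injective_int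
    rw [RootPairing.algebraMap_pairingIn, RootPairing.algebraMap_pairingIn]
    rfl
  rw [e, e] at h
  have h' : ((rootSystem H).pairingIn ℤ α β : ℝ) * corootSq H α =
    (rootSystem H).pairingIn ℤ β α * corootSq H β := by exact_mod_cast h
  have hα : (0 : ℝ) < corootSq H α := by exact_mod_cast corootSq_pos H α
  have hβ : (0 : ℝ) < corootSq H β := by exact_mod_cast corootSq_pos H β
  have key : killingSq H α * (rootSystem H).pairingIn ℤ β α =
      killingSq H β * (rootSystem H).pairingIn ℤ α β := by
    rw [killingSq_eq, killingSq_eq]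
    field_simp
    linear_combination -h'
  rw [halfLength, halfLength, div_mul_eq_mul_div, div_mul_eq_mul_div, key]

variable {H} (b : (rootSystem H).Base)

/-- `2ρ`, the sum of the positive roots. -/
def twoRhoVec : Dual ℂ H := by
  classical exact ∑ α ∈ Finset.univ.filter b.IsPos, (rootSystem H).root α

theorem exists_twoRho : ∃ n : b.support → ℤ,
    ∑ i, n i • (rootSystem H).root i = twoRhoVec b := by
  classical
  have key (α : H.root) : ∃ n : b.support → ℤ,
      ∑ i, n i • (rootSystem H).root i = (rootSystem H).root α := by
    obtain ⟨f, -, hf⟩ := b.exists_root_eq_sum_int α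
    refine ⟨fun i => f i, ?_⟩
    rw [hf.2]
    exact Finset.sum_coe_sort b.support fun j => f j • (rootSystem H).root j
  choose n hn using key
  refine ⟨∑ α ∈ Finset.univ.filter b.IsPos, n α, ?_⟩
  simp only [Finset.sum_apply, Finset.sum_smul]
  rw [Finset.sum_comm, twoRhoVec]
  exact Finset.sum_congr rfl fun α _ => hn α

/-- The coordinates of `2ρ` in the basis of simple roots. -/
def twoRho : b.support → ℤ := (exists_twoRho b).choose

theorem twoRho_spec : ∑ i, twoRho b i • (rootSystem H).root i = twoRhoVec b :=
  (exists_twoRho b).choose_spec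

section Datum

variable (q : ℝ) (hq0 : 0 < q) (hq1 : q ≠ 1)

/-- The Cartan matrix `a_ij = 2 (α_i, α_j) / (α_i, α_i)` (Mathlib's Cartan matrix is the transpose)
and the parameters `q_i = q^{d_i}`. -/
def datum : Quantum.QuantumDatum b.support where
  a i j := b.cartanMatrix j i
  qi i := q ^ halfLength H i
  a_self i := b.cartanMatrix_apply_same i
  a_nonpos i j h := b.cartanMatrix_le_zero_of_ne j i h.symm
  qi_pos i := Real.rpow_pos_of_pos hq0 _
  qi_ne_one i h := by
    have h1 := congrArg Real.log h
    rw [Real.log_rpow hq0, Real.log_one, mul_eq_zero] at h1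
    rcases h1 with h1 | h1
    · exact (halfLength_pos H i.1).ne' h1
    · exact Real.log_ne_zero_of_pos_of_ne_one hq0 hq1 h1
  symm i j := by
    rw [← Real.rpow_intCast, ← Real.rpow_intCast, ← Real.rpow_mul hq0.le, ← Real.rpow_mul hq0.le]
    congr 1
    exact halfLength_mul H i.1 j.1

/-- `U_q(𝔤)`, with `q_i = q^{d_i}`. -/
abbrev Uqg : Type _ := Quantum.Uq (datum b q hq0 hq1)

variable {b q hq0 hq1} {V : Type*} [AddCommGroup V] [Module ℂ V]
  (π : Uqg b q hq0 hq1 →ₐ[ℂ] Module.End ℂ V)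

/-- `v` has weight `λ`: one has `K_i v = q^{(α_i, λ)} v = q_i^{λ(α_i^∨)} v` for all `i`, with `λ`
integral. -/
def IsWeightVector (wt : Dual ℂ H) (v : V) : Prop :=
  ∀ i : b.support, ∃ z : ℤ, wt ((rootSystem H).coroot i) = z ∧
    π (Quantum.Uq.K _ i) v = (((datum b q hq0 hq1).qi i ^ z : ℝ) : ℂ) • v

/-- `V` is the irreducible representation `V(Λ)` of highest weight `Λ`. -/
structure IsIrrepOfHighestWeight (wt : Dual ℂ H) : Prop where
  irreducible : ∀ W : Submodule ℂ V, (∀ X, W ≤ W.comap (π X)) → W = ⊥ ∨ W = ⊤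
  highest : ∃ v : V, v ≠ 0 ∧ IsWeightVector π wt v ∧ ∀ i, π (Quantum.Uq.E _ i) v = 0

end Datum

end SimpleLie

namespace Quantum

variable {I : Type*} [Fintype I] {D : QuantumDatum I} {V : Type*} [NormedAddCommGroup V]
  [InnerProductSpace ℂ V] {κ : Type*} [Fintype κ]

/-- Unitarity of a representation for the compact real form. -/
def IsUnitaryRep (π : Uq D →ₐ[ℂ] Module.End ℂ V) : Prop :=
  ∀ (X : Uq D) (x y : V), inner ℂ (π X x) y = inner ℂ x (π (star X) y)

variable (π : Uq D →ₐ[ℂ] Module.End ℂ V) (v : OrthonormalBasis κ ℂ V)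

/-- The matrix coefficients `u^i_j(X) = f^i(X ▷ v_j)` in an orthonormal basis. -/
def coeffU (i j : κ) : UqDual D := matrixCoeff π (v.toBasis.coord i) (v j)

/-- The entries `(M^n_m)^i_j = (u^m_i)^* u^n_j`. -/
def unitM (m n i j : κ) : UqDual D := star (coeffU π v m i) * coeffU π v n j

/-- The entries `(N^n_m)^i_j = u^i_m (u^j_n)^*`. -/
def unitN (m n i j : κ) : UqDual D := coeffU π v i m * star (coeffU π v j n)

/-- The matrix `M^n_m` over the ring `flagLeft D`. -/
def matM (m n : κ) (h : ∀ i j, unitM π v m n i j ∈ flagLeft D) : Matrix κ κ (flagLeft D) :=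
  Matrix.of fun i j => ⟨unitM π v m n i j, h i j⟩

/-- The matrix `N^n_m` over the ring `flagRight D`. -/
def matN (m n : κ) (h : ∀ i j, unitN π v m n i j ∈ flagRight D) : Matrix κ κ (flagRight D) :=
  Matrix.of fun i j => ⟨unitN π v m n i j, h i j⟩

/-- The matrix of `π(X)` in an orthonormal basis. -/
def repMatrix [DecidableEq κ] (X : Uq D) : Matrix κ κ ℂ :=
  LinearMap.toMatrix v.toBasis v.toBasis (π X)

end Quantum

end

/-! Each class is detected by an explicit twisted 2-cocycle concentrated at one point of the quantum
flag manifold. Let `A` be either flag algebra and let `ε(a) = a(1)`. The coproducts of `E_i` and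
`F_i` make evaluation at these elements satisfy a Leibniz rule twisted by `K_i` and `K_i⁻¹`.
Elements of `A` take the same value at `K_i^{±1}` as at `1`, so on `A` both evaluations are genuine
`ε`-derivations. Moreover `ε ∘ θ = ε`, because `K_{2ρ}` also evaluates like `1`. Hence `a₀ ⊗ a₁ ⊗ a₂
↦ ε(a₀) a₁(E_i) a₂(F_i)`, a cup product of two derivations, is a normalized `θ`-twisted cocycle
(`pointFunctional_comp_b₃`), and a cycle on which it does not vanish has a non-zero class
(`hasNontrivialClass_of_derivations`).

The chains are normalized cycles for three reasons (`chernChain_mem_normalizedCycles`): the matrices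
are idempotent, by unitarity of `(u^i_j)`; `θ` acts on them as conjugation by the diagonal matrix
`π(K_{2ρ}^{∓1})`; and their trace weighted by that matrix is a scalar. The last point is where `2ρ`
is needed: it rests on the flipped antipode identities `sandwichAntipode_comm_comul` and
`antipodeSandwich_comm_comul`. These require `K_{2ρ}` to scale `E_i` by `q_i^2` and `F_i` by
`q_i^{-2}`, that is, `⟨2ρ, α_i^∨⟩ = 2` (`sum_pos_pairing`).

The pairing is a trace of scalar matrices. At `1` the projection becomes `p = e_{mm}`, and its two
derivatives are the commutators `[p, E_i]` and `[p, F_i]`, up to a sign and a factor `K_i^{±1}`. By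
`trace_projection` the trace is a non-zero multiple of the `(m, m)` entry of `F_i E_i - E_i F_i`,
which is `-(q_i^z - q_i^{-z}) / (q_i - q_i^{-1})` with `z = λ_m(α_i^∨)`. Since `λ_m ≠ 0` and the
simple coroots span the Cartan subalgebra, some `i` has `z ≠ 0`; for this `i` both pairings are
non-zero. -/

noncomputable section

namespace Hochschild

/-! ### Detecting twisted classes by pairs of point derivations. -/

section Cocycle

variable {A : Type*} [Ring A] [Algebra ℂ A] {σ : A ≃ₐ[ℂ] A}

/-- A normalized twisted `2`-cocycle that does not vanish on a normalized `2`-cycle detects its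
class. -/
theorem hasNontrivialClass_of_cocycle {z : A ⊗[ℂ] (A ⊗[ℂ] A)} (hz : z ∈ normalizedCycles σ)
    (φ : A ⊗[ℂ] (A ⊗[ℂ] A) →ₗ[ℂ] ℂ) (hb : φ ∘ₗ b₃ σ = 0)
    (hl : ∀ a b, φ (a ⊗ₜ (1 ⊗ₜ b)) = 0) (hr : ∀ a b, φ (a ⊗ₜ (b ⊗ₜ 1)) = 0) (hne : φ z ≠ 0) :
    HasNontrivialClass σ z := by
  refine ⟨hz, fun h => hne ?_⟩
  rw [hochschildClass, LinearEquiv.map_eq_zero_iff, Submodule.Quotient.mk_eq_zero] at h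
  have hle : normalizedBoundaries σ ≤ LinearMap.ker φ := by
    refine sup_le ?_ (Submodule.span_le.2 ?_)
    · rwa [LinearMap.range_le_ker_iff]
    · rintro _ ⟨a, b, rfl | rfl⟩
      exacts [hl a b, hr a b]
  exact hle h

/-- The functional `a₀ ⊗ a₁ ⊗ a₂ ↦ ε(a₀) D(a₁) D'(a₂)`. -/
def pointFunctional (ε : A →ₐ[ℂ] ℂ) (D D' : A →ₗ[ℂ] ℂ) : A ⊗[ℂ] (A ⊗[ℂ] A) →ₗ[ℂ] ℂ :=
  LinearMap.mul' ℂ ℂ ∘ₗ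
    TensorProduct.map ε.toLinearMap (LinearMap.mul' ℂ ℂ ∘ₗ TensorProduct.map D D')

@[simp] theorem pointFunctional_tmul (ε : A →ₐ[ℂ] ℂ) (D D' : A →ₗ[ℂ] ℂ) (a b c : A) :
    pointFunctional ε D D' (a ⊗ₜ (b ⊗ₜ c)) = ε a * (D b * D' c) := by
  simp [pointFunctional]

/-- After both Leibniz rules are expanded, the terms of the four faces cancel in pairs. The twist
occurs only in the last face, inside `ε`, where `hσ` removes it. No antisymmetrization in `D`, `D'`
is needed. -/
theorem pointFunctional_comp_b₃ {ε : A →ₐ[ℂ] ℂ} {D D' : A →ₗ[ℂ] ℂ} (hσ : ∀ a, ε (σ a) = ε a)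
    (hD : ∀ a b, D (a * b) = D a * ε b + ε a * D b)
    (hD' : ∀ a b, D' (a * b) = D' a * ε b + ε a * D' b) :
    pointFunctional ε D D' ∘ₗ b₃ σ = 0 := by
  ext a₀ a₁ a₂ a₃
  simp [hσ, hD, hD']
  ring

/-- A point derivation kills `1`, since `D 1 = D 1 + D 1`; the cocycle therefore vanishes on
degenerate chains and descends to the normalized complex. -/
theorem hasNontrivialClass_of_derivations {z : A ⊗[ℂ] (A ⊗[ℂ] A)} (hz : z ∈ normalizedCycles σ)
    {ε : A →ₐ[ℂ] ℂ} {D D' : A →ₗ[ℂ] ℂ} (hσ : ∀ a, ε (σ a) = ε a)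
    (hD : ∀ a b, D (a * b) = D a * ε b + ε a * D b)
    (hD' : ∀ a b, D' (a * b) = D' a * ε b + ε a * D' b)
    (hne : pointFunctional ε D D' z ≠ 0) : HasNontrivialClass σ z := by
  have h1 {D : A →ₗ[ℂ] ℂ} (hD : ∀ a b, D (a * b) = D a * ε b + ε a * D b) : D 1 = 0 := by
    simpa using hD 1 1
  exact hasNontrivialClass_of_cocycle hz _ (pointFunctional_comp_b₃ hσ hD hD')
    (by simp [h1 hD]) (by simp [h1 hD']) hne

end Cocycle

/-! ### The chain of a projection: cycle condition and pairing. -/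

section ChernChain

variable {A : Type*} [Ring A] [Algebra ℂ A] {σ : A ≃ₐ[ℂ] A} {κ : Type*} [Fintype κ]

/-- The identity matrix in the definition uses classical decidability of equality; here any instance
is allowed. -/
theorem chernChain_eq [DecidableEq κ] (V : Matrix κ κ ℂ) (P : Matrix κ κ A) :
    chernChain V P = ∑ i, ∑ j, ∑ k, ∑ l,
      V i j • ((2 • P - 1 : Matrix κ κ A) j k ⊗ₜ[ℂ] (P k l ⊗ₜ[ℂ] P l i)) := by
  rw [chernChain]
  congr!

/-- Invariant projections give normalized twisted cycles. -/
theorem chernChain_mem_normalizedCycles [DecidableEq κ] {d : κ → ℂ} {P : Matrix κ κ A}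
    (hP : P * P = P) (hσ : ∀ i j, d j • σ (P i j) = d i • P i j) {c : ℂ}
    (hc : ∑ i, d i • P i i = c • (1 : A)) :
    chernChain (Matrix.diagonal d) P ∈ normalizedCycles σ := by
  have hP' : (2 • P - 1) * P = P := by
    rw [sub_mul, smul_mul_assoc, hP, one_mul, two_smul, add_sub_cancel_right]
  have hP'' : P * (2 • P - 1) = P := by
    rw [mul_sub, mul_smul_comm, hP, mul_one, two_smul, add_sub_cancel_right]
  have s1 : ∑ i, ∑ k, ∑ l, d i • (((2 • P - 1 : Matrix κ κ A) i k * P k l) ⊗ₜ[ℂ] P l i) =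
      ∑ i, ∑ l, d i • (P i l ⊗ₜ[ℂ] P l i) := by
    refine Finset.sum_congr rfl fun i _ => ?_
    rw [Finset.sum_comm]
    refine Finset.sum_congr rfl fun l _ => ?_
    rw [← Finset.smul_sum, ← TensorProduct.sum_tmul, ← Matrix.mul_apply, hP']
  have s2 : ∑ i, ∑ k, ∑ l, d i • ((2 • P - 1 : Matrix κ κ A) i k ⊗ₜ[ℂ] (P k l * P l i)) =
      2 • ∑ i, ∑ l, d i • (P i l ⊗ₜ[ℂ] P l i) - c • ((1 : A) ⊗ₜ[ℂ] (1 : A)) := by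
    have : ∑ i, d i • ((1 : A) ⊗ₜ[ℂ] P i i) = c • ((1 : A) ⊗ₜ[ℂ] (1 : A)) := by
      simp only [← TensorProduct.tmul_smul, ← TensorProduct.tmul_sum, hc]
    rw [← this, Finset.smul_sum, ← Finset.sum_sub_distrib]
    refine Finset.sum_congr rfl fun i _ => ?_
    have h1 : ∑ k, (1 : Matrix κ κ A) i k ⊗ₜ[ℂ] P k i = (1 : A) ⊗ₜ[ℂ] P i i := by
      rw [Finset.sum_eq_single i, Matrix.one_apply_eq]
      · intro k _ hk
        rw [Matrix.one_apply_ne hk.symm, TensorProduct.zero_tmul]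
      · simp
    simp only [← Finset.smul_sum, ← TensorProduct.tmul_sum, ← Matrix.mul_apply, hP]
    simp only [Matrix.sub_apply, TensorProduct.sub_tmul, smul_sub, Finset.sum_sub_distrib, h1,
      two_smul, Matrix.add_apply, smul_add, TensorProduct.add_tmul, Finset.sum_add_distrib]
  -- The invariance `hσ` trades `d i • σ (P l i)` for `d l • P l i`. This is the cyclicity of the
  -- twisted trace; afterwards the sum over `i` is the matrix product `P (2P - 1) = P`.
  have s3 : ∑ i, ∑ k, ∑ l, d i • ((σ (P l i) * (2 • P - 1 : Matrix κ κ A) i k) ⊗ₜ[ℂ] P k l) =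
      ∑ i, ∑ l, d i • (P i l ⊗ₜ[ℂ] P l i) := by
    simp only [TensorProduct.smul_tmul', ← smul_mul_assoc, hσ]
    rw [Finset.sum_comm, Finset.sum_comm (f := fun i l => (d i • P i l) ⊗ₜ[ℂ] P l i)]
    refine Finset.sum_congr rfl fun k _ => ?_
    rw [Finset.sum_comm]
    refine Finset.sum_congr rfl fun l _ => ?_
    simp only [smul_mul_assoc]
    rw [← TensorProduct.sum_tmul, ← Finset.smul_sum, ← Matrix.mul_apply, hP'']
  -- With `X = ∑ d_i P_il ⊗ P_li`, the three faces contribute `X - (2X - c 1 ⊗ 1) + X`. What remains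
  -- is degenerate but need not vanish, so the chain is a cycle in the normalized complex only.
  have key : b₂ σ (chernChain (Matrix.diagonal d) P) = (c • 1 : A) ⊗ₜ[ℂ] (1 : A) := by
    rw [chernChain_eq]
    simp only [Matrix.diagonal_apply, ite_smul, zero_smul, Finset.sum_ite_irrel,
      Finset.sum_const_zero, Finset.sum_ite_eq, Finset.mem_univ, if_true]
    simp only [map_sum, map_smul, b₂_tmul, smul_add, smul_sub, Finset.sum_add_distrib,
      Finset.sum_sub_distrib, s1, s2, s3]
    rw [two_smul, TensorProduct.smul_tmul']
    abel
  rw [normalizedCycles, Submodule.mem_comap, mem_D₁_iff]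
  exact ⟨_, key⟩

/-- The functional is a product of three linear maps on `A`, so it can be applied entrywise; `ε`
being unital turns `2P - 1` into `2ε(P) - 1`. -/
theorem pointFunctional_chernChain [DecidableEq κ] (ε : A →ₐ[ℂ] ℂ) (D D' : A →ₗ[ℂ] ℂ)
    (V : Matrix κ κ ℂ) (P : Matrix κ κ A) :
    pointFunctional ε D D' (chernChain V P) =
      Matrix.trace (V * ((2 • P.map ε - 1) * (P.map D * P.map D'))) := by
  have h (j k : κ) : ε ((2 • P - 1 : Matrix κ κ A) j k) = (2 • P.map ε - 1 : Matrix κ κ ℂ) j k := by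
    simp only [Matrix.sub_apply, Matrix.smul_apply, map_sub, map_nsmul, Matrix.map_apply,
      Matrix.one_apply, apply_ite ε, map_one, map_zero]
  simp only [chernChain_eq, map_sum, map_smul, pointFunctional_tmul, h, smul_eq_mul, Matrix.trace,
    Matrix.diag_apply, Matrix.mul_apply, Finset.mul_sum, Matrix.map_apply]

end ChernChain

end Hochschild

/-! ### Antipode identities in `U_q(𝔤)`. -/

namespace Quantum.Uq

variable {I : Type*} {D : QuantumDatum I}

@[simp] theorem comul_Kinv (i : I) :
    Coalgebra.comul (R := ℂ) (Kinv D i) = Kinv D i ⊗ₜ Kinv D i :=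
  lift_Kinv (comul_tuple D) i

@[simp] theorem counit_Kinv (i : I) : Coalgebra.counit (R := ℂ) (Kinv D i) = 1 :=
  lift_Kinv (counit_tuple D) i

theorem antipode_mul (X Y : Uq D) : antipode D (X * Y) = antipode D Y * antipode D X := by
  simp [antipode]

@[simp] theorem antipode_one : antipode D 1 = 1 := by simp [antipode]

@[elab_as_elim]
theorem induction {p : Uq D → Prop} (scalar : ∀ c, p (algebraMap ℂ _ c)) (hE : ∀ i, p (E D i))
    (hF : ∀ i, p (F D i)) (hK : ∀ i, p (K D i)) (hKinv : ∀ i, p (Kinv D i))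
    (add : ∀ X Y, p X → p Y → p (X + Y)) (mul : ∀ X Y, p X → p Y → p (X * Y)) (X : Uq D) : p X := by
  obtain ⟨x, rfl⟩ : ∃ x, mk D x = X := RingQuot.mkAlgHom_surjective ℂ (UqRel D) X
  induction x using FreeAlgebra.induction with
  | grade0 c => rw [AlgHom.commutes]; exact scalar c
  | grade1 g => cases g with
    | E i => exact hE i
    | F i => exact hF i
    | K i => exact hK i
    | Kinv i => exact hKinv i
  | mul x y hx hy => rw [map_mul]; exact mul _ _ hx hy
  | add x y hx hy => rw [map_add]; exact add _ _ hx hy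

variable (D) in
/-- The map `x ⊗ y ↦ S(x) g y`. -/
def antipodeSandwich (g : Uq D) : Uq D ⊗[ℂ] Uq D →ₗ[ℂ] Uq D :=
  LinearMap.mul' ℂ (Uq D) ∘ₗ TensorProduct.map (LinearMap.mulRight ℂ g ∘ₗ antipode D) LinearMap.id

variable (D) in
/-- The map `x ⊗ y ↦ x g S(y)`. -/
def sandwichAntipode (g : Uq D) : Uq D ⊗[ℂ] Uq D →ₗ[ℂ] Uq D :=
  LinearMap.mul' ℂ (Uq D) ∘ₗ TensorProduct.map (LinearMap.mulRight ℂ g) (antipode D)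

@[simp] theorem antipodeSandwich_tmul (g x y : Uq D) :
    antipodeSandwich D g (x ⊗ₜ y) = antipode D x * g * y := by simp [antipodeSandwich]

@[simp] theorem sandwichAntipode_tmul (g x y : Uq D) :
    sandwichAntipode D g (x ⊗ₜ y) = x * g * antipode D y := by simp [sandwichAntipode]

theorem antipodeSandwich_smul (c : ℂ) (g : Uq D) (t : Uq D ⊗[ℂ] Uq D) :
    antipodeSandwich D (c • g) t = c • antipodeSandwich D g t := by
  induction t using TensorProduct.induction_on with
  | zero => simp
  | tmul x y => simp
  | add x y hx hy => rw [map_add, map_add, hx, hy, smul_add]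

theorem sandwichAntipode_smul (c : ℂ) (g : Uq D) (t : Uq D ⊗[ℂ] Uq D) :
    sandwichAntipode D (c • g) t = c • sandwichAntipode D g t := by
  induction t using TensorProduct.induction_on with
  | zero => simp
  | tmul x y => simp
  | add x y hx hy => rw [map_add, map_add, hx, hy, smul_add]

theorem antipodeSandwich_add (g h : Uq D) (t : Uq D ⊗[ℂ] Uq D) :
    antipodeSandwich D (g + h) t = antipodeSandwich D g t + antipodeSandwich D h t := by
  induction t using TensorProduct.induction_on with
  | zero => simp
  | tmul x y => simp [mul_add, add_mul]
  | add x y hx hy => rw [map_add, map_add, map_add, hx, hy]; abel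

theorem sandwichAntipode_add (g h : Uq D) (t : Uq D ⊗[ℂ] Uq D) :
    sandwichAntipode D (g + h) t = sandwichAntipode D g t + sandwichAntipode D h t := by
  induction t using TensorProduct.induction_on with
  | zero => simp
  | tmul x y => simp [mul_add, add_mul]
  | add x y hx hy => rw [map_add, map_add, map_add, hx, hy]; abel

/-- Since `S` reverses products, `S(xx') g yy' = S(x') (S(x) g y) y'`: the sandwich of a product is
nested. Letting the middle element `g` vary is what makes antipode identities multiplicative, so
that they need only be checked on generators. -/
theorem antipodeSandwich_mul (g : Uq D) (s t : Uq D ⊗[ℂ] Uq D) :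
    antipodeSandwich D g (s * t) = antipodeSandwich D (antipodeSandwich D g s) t := by
  induction s using TensorProduct.induction_on with
  | zero => simp [antipodeSandwich]
  | tmul x y =>
    induction t using TensorProduct.induction_on with
    | zero => simp
    | tmul x' y' => simp [antipode_mul, mul_assoc]
    | add t t' h h' => rw [mul_add, map_add, map_add, h, h']
  | add s s' h h' => rw [add_mul, map_add, map_add, antipodeSandwich_add, h, h']

/-- Here the right-hand factor `t` is the inner one: `x'x g S(y'y) = x' (x g S(y)) S(y')`. -/
theorem sandwichAntipode_mul (g : Uq D) (s t : Uq D ⊗[ℂ] Uq D) :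
    sandwichAntipode D g (s * t) = sandwichAntipode D (sandwichAntipode D g t) s := by
  induction t using TensorProduct.induction_on with
  | zero => simp [sandwichAntipode]
  | tmul x y =>
    induction s using TensorProduct.induction_on with
    | zero => simp
    | tmul x' y' => simp [antipode_mul, mul_assoc]
    | add t t' h h' => rw [add_mul, map_add, map_add, h, h']
  | add s s' h h' => rw [mul_add, map_add, map_add, sandwichAntipode_add, h, h']

/-- `S(X₁) X₂ = ε(X)`. -/
theorem antipodeSandwich_comul (X : Uq D) :
    antipodeSandwich D 1 (Coalgebra.comul (R := ℂ) X) = Coalgebra.counit (R := ℂ) X • 1 := by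
  induction X using induction with
  | scalar c => simp [Algebra.algebraMap_eq_smul_one, Algebra.TensorProduct.one_def]
  | hE i => simp [mul_assoc]
  | hF i => simp
  | hK i => simp
  | hKinv i => simp
  | add X Y hX hY => simp only [map_add, hX, hY, add_smul]
  | mul X Y hX hY =>
    rw [Bialgebra.comul_mul, antipodeSandwich_mul, hX, antipodeSandwich_smul, hY, smul_smul,
      Bialgebra.counit_mul]

/-- `X₁ S(X₂) = ε(X)`. -/
theorem sandwichAntipode_comul (X : Uq D) :
    sandwichAntipode D 1 (Coalgebra.comul (R := ℂ) X) = Coalgebra.counit (R := ℂ) X • 1 := by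
  induction X using induction with
  | scalar c => simp [Algebra.algebraMap_eq_smul_one, Algebra.TensorProduct.one_def]
  | hE i => simp
  | hF i => simp [← mul_assoc]
  | hK i => simp
  | hKinv i => simp
  | add X Y hX hY => simp only [map_add, hX, hY, add_smul]
  | mul X Y hX hY =>
    rw [Bialgebra.comul_mul, sandwichAntipode_mul, hY, sandwichAntipode_smul, hX, smul_smul,
      Bialgebra.counit_mul, mul_comm]

/-! ### Flipped antipode identities and the element `K_{2ρ}`. -/

/-- `g` acts by conjugation on `E_i` and `F_i` as multiplication by `q_i^e` and `q_i^{-e}`. -/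
structure QCommutes (e : ℤ) (g : Uq D) : Prop where
  mul_E : ∀ i, g * E D i = ((D.qi i ^ e : ℝ) : ℂ) • (E D i * g)
  mul_F : ∀ i, g * F D i = ((D.qi i ^ (-e) : ℝ) : ℂ) • (F D i * g)
  mul_K : ∀ i, g * K D i = K D i * g
  mul_Kinv : ∀ i, g * Kinv D i = Kinv D i * g

/-- `X₂ g S(X₁) = ε(X) g` for `g = K_{2ρ}⁻¹`. -/
theorem sandwichAntipode_comm_comul {g : Uq D} (hg : QCommutes (-2) g) (X : Uq D) :
    sandwichAntipode D g (TensorProduct.comm ℂ _ _ (Coalgebra.comul (R := ℂ) X)) =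
      Coalgebra.counit (R := ℂ) X • g := by
  induction X using induction with
  | scalar c => simp [Algebra.algebraMap_eq_smul_one, Algebra.TensorProduct.one_def]
  | hE i =>
    -- The flipped coproduct `K_i ⊗ E_i + E_i ⊗ 1` gives `-K_i g E_i K_i⁻¹ + E_i g`. This vanishes
    -- because the factor `q_i^{-2}` from moving `g` past `E_i` cancels `q_i^{a_ii} = q_i^2` from
    -- moving `K_i`; this fixes the exponent in the hypothesis on `g`.
    have h : K D i * g * (E D i * Kinv D i) = E D i * g := by
      rw [mul_assoc, ← mul_assoc g, hg.mul_E, smul_mul_assoc, mul_smul_comm, ← mul_assoc,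
        ← mul_assoc, K_E, smul_mul_assoc, smul_mul_assoc, mul_assoc (E D i), ← hg.mul_K, mul_assoc,
        mul_assoc g, K_Kinv, mul_one, smul_smul, D.a_self, ← Complex.ofReal_mul,
        ← zpow_add₀ (D.qi_pos i).ne']
      simp
    simp [h]
  | hF i =>
    have h : F D i * g * K D i = g * (K D i * F D i) := by
      rw [K_F, mul_smul_comm, ← mul_assoc, hg.mul_F, smul_mul_assoc, smul_smul, D.a_self,
        ← Complex.ofReal_mul, ← zpow_add₀ (D.qi_pos i).ne']
      simp
    simp [h]
  | hK i => simp [← hg.mul_K, mul_assoc]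
  | hKinv i => simp [← hg.mul_Kinv, mul_assoc]
  | add X Y hX hY => simp only [map_add, hX, hY, add_smul]
  | mul X Y hX hY =>
    -- The flip is an algebra map, so the nesting of sandwiches applies to the flipped coproduct as
    -- well.
    have h (s t : Uq D ⊗[ℂ] Uq D) : TensorProduct.comm ℂ _ _ (s * t) =
        TensorProduct.comm ℂ _ _ s * TensorProduct.comm ℂ _ _ t :=
      map_mul (Algebra.TensorProduct.comm ℂ (Uq D) (Uq D)) s t
    rw [Bialgebra.comul_mul, h, sandwichAntipode_mul, hY, sandwichAntipode_smul, hX, smul_smul,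
      Bialgebra.counit_mul, mul_comm]

/-- `S(X₂) g X₁ = ε(X) g` for `g = K_{2ρ}`. -/
theorem antipodeSandwich_comm_comul {g : Uq D} (hg : QCommutes 2 g) (X : Uq D) :
    antipodeSandwich D g (TensorProduct.comm ℂ _ _ (Coalgebra.comul (R := ℂ) X)) =
      Coalgebra.counit (R := ℂ) X • g := by
  induction X using induction with
  | scalar c => simp [Algebra.algebraMap_eq_smul_one, Algebra.TensorProduct.one_def]
  | hE i =>
    -- The mirror cancellation: `g` now contributes `q_i^2` and `K_i⁻¹` contributes `q_i^{-2}`.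
    have h : Kinv D i * g * E D i = E D i * Kinv D i * g := by
      rw [mul_assoc, hg.mul_E, mul_smul_comm, ← mul_assoc, Kinv_E, smul_mul_assoc, smul_smul,
        D.a_self, ← Complex.ofReal_mul, ← zpow_add₀ (D.qi_pos i).ne']
      simp
    simp [h]
  | hF i =>
    have h : K D i * F D i * g * Kinv D i = g * F D i := by
      rw [hg.mul_F, K_F, D.a_self, smul_mul_assoc, smul_mul_assoc, mul_assoc (F D i), ← hg.mul_K,
        mul_assoc, mul_assoc, K_Kinv, mul_one]
    simp [h]
  | hK i => simp [← hg.mul_Kinv, mul_assoc]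
  | hKinv i => simp [← hg.mul_K, mul_assoc]
  | add X Y hX hY => simp only [map_add, hX, hY, add_smul]
  | mul X Y hX hY =>
    have h (s t : Uq D ⊗[ℂ] Uq D) : TensorProduct.comm ℂ _ _ (s * t) =
        TensorProduct.comm ℂ _ _ s * TensorProduct.comm ℂ _ _ t :=
      map_mul (Algebra.TensorProduct.comm ℂ (Uq D) (Uq D)) s t
    rw [Bialgebra.comul_mul, h, antipodeSandwich_mul, hX, antipodeSandwich_smul, hY, smul_smul,
      Bialgebra.counit_mul]

/-- For group-like `u` the identity `S(X₁) X₂ = ε(X)` reads `S(u) u = 1`. -/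
theorem antipode_of_isGroupLikeElem {u : (Uq D)ˣ} (hu : IsGroupLikeElem ℂ (u : Uq D)) :
    antipode D u = (u⁻¹ : (Uq D)ˣ) := by
  have h := antipodeSandwich_comul (u : Uq D)
  rw [hu.comul_eq_tmul_self, antipodeSandwich_tmul, mul_one, hu.counit_eq_one, one_smul] at h
  exact Units.eq_inv_of_mul_eq_one_right h

theorem QCommutes.inv {e : ℤ} {u : (Uq D)ˣ} (h : QCommutes e (u : Uq D)) :
    QCommutes (-e) ((u⁻¹ : (Uq D)ˣ) : Uq D) where
  mul_E i := by
    rw [qcomm_inv u.mul_inv u.inv_mul (zpow_ne_zero _ (D.qi_pos i).ne') (h.mul_E i), zpow_neg]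
  mul_F i := by
    rw [qcomm_inv u.mul_inv u.inv_mul (zpow_ne_zero _ (D.qi_pos i).ne') (h.mul_F i), ← zpow_neg]
  mul_K i := (((show Commute (u : Uq D) (K D i) from h.mul_K i)).units_inv_left).eq
  mul_Kinv i := (((show Commute (u : Uq D) (Kinv D i) from h.mul_Kinv i)).units_inv_left).eq

theorem QCommutes.F_mul {e : ℤ} {g : Uq D} (h : QCommutes e g) (i : I) :
    F D i * g = ((D.qi i ^ e : ℝ) : ℂ) • (g * F D i) := by
  rw [h.mul_F, smul_smul, ← Complex.ofReal_mul, ← zpow_add₀ (D.qi_pos i).ne']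
  simp

/-- The pairs `(u, r)` with `u x = r x u`. -/
def qCommuteSubgroup (x : Uq D) : Subgroup ((Uq D)ˣ × ℝˣ) where
  carrier := {w | (w.1 : Uq D) * x = ((w.2 : ℝ) : ℂ) • (x * w.1)}
  one_mem' := by simp
  mul_mem' {a b} ha hb := by
    change (_ : Uq D) * x = _ at ha hb
    change ((a * b).1 : Uq D) * x = _ • (x * ((a * b).1 : Uq D))
    simp only [Prod.fst_mul, Prod.snd_mul, Units.val_mul, mul_assoc, hb, mul_smul_comm]
    rw [← mul_assoc, ha, smul_mul_assoc, smul_smul, mul_assoc, Complex.ofReal_mul, mul_comm]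
  inv_mem' {a} ha := by
    have := qcomm_inv a.1.mul_inv a.1.inv_mul a.2.ne_zero ha
    rwa [← Units.val_inv_eq_inv_val] at this

theorem prod_zpow_eq_zpow_sum {ι G : Type*} [CommGroup G] (s : Finset ι) (f : ι → ℤ) (x : G) :
    ∏ i ∈ s, x ^ f i = x ^ ∑ i ∈ s, f i := by
  classical
  induction s using Finset.induction_on with
  | empty => simp
  | insert i s hi ih => rw [Finset.prod_insert hi, Finset.sum_insert hi, zpow_add, ih]

variable [Fintype I]

/-- The pairs of a unit and its commutation factor with `x` form a subgroup. It contains every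
`(K_j, r_j)`, hence the product of their powers; the two projections of that product are `K_λ` and
its factor. -/
theorem Kpow_qcomm (n : I → ℤ) {x : Uq D} {r : I → ℝˣ}
    (h : ∀ j, K D j * x = ((r j : ℝ) : ℂ) • (x * K D j)) :
    (Kpow D n : Uq D) * x = (((∏ j, r j ^ n j : ℝˣ) : ℝ) : ℂ) • (x * Kpow D n) := by
  have hc : ((Finset.univ : Finset I) : Set I).Pairwise
      (Function.onFun Commute fun i => (Kunit D i, r i) ^ n i) := fun i _ j _ _ =>
    ((show Commute (Kunit D i, r i) (Kunit D j, r j) from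
      Prod.ext (Kunit_comm i j) (mul_comm _ _)).zpow_left _).zpow_right _
  have hm : Finset.univ.noncommProd (fun i => (Kunit D i, r i) ^ n i) hc ∈ qCommuteSubgroup x :=
    Subgroup.noncommProd_mem _ _ fun j _ => Subgroup.zpow_mem _ (h j) _
  have h1 := Finset.map_noncommProd Finset.univ _ hc (MonoidHom.fst (Uq D)ˣ ℝˣ)
  have h2 := Finset.map_noncommProd Finset.univ _ hc (MonoidHom.snd (Uq D)ˣ ℝˣ)
  rw [Finset.noncommProd_eq_prod] at h2
  change _ * x = _ • (x * _) at hm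
  simp only [MonoidHom.coe_fst, MonoidHom.coe_snd] at h1 h2
  rw [h1, h2] at hm
  exact hm

/-- `K_{2ρ}`, for the coordinates `n` of `2ρ`. -/
theorem qCommutes_Kpow {n : I → ℤ} (hn : ∀ i, ∑ j, n j * D.a i j = 2) :
    QCommutes 2 (Kpow D n : Uq D) where
  mul_E i := by
    -- The symmetry `q_j^{a_ji} = q_i^{a_ij}` writes every factor as a power of the single number
    -- `q_i`, so that the exponents add up to the sum in `hn`.
    have h := Kpow_qcomm (D := D) n (x := E D i)
      (r := fun j => Units.mk0 (D.qi i) (D.qi_pos i).ne' ^ D.a i j)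
      (fun j => by rw [K_E, D.symm]; simp)
    rw [h]
    simp only [← zpow_mul, mul_comm (D.a i _), prod_zpow_eq_zpow_sum, hn]
    simp
  mul_F i := by
    have h := Kpow_qcomm (D := D) n (x := F D i)
      (r := fun j => Units.mk0 (D.qi i) (D.qi_pos i).ne' ^ (-D.a i j))
      (fun j => by rw [K_F, symm_neg]; simp)
    rw [h]
    simp only [← zpow_mul, neg_mul, mul_comm (D.a i _), prod_zpow_eq_zpow_sum, hn,
      Finset.sum_neg_distrib]
    simp
  mul_K i := by
    simpa using Kpow_qcomm (D := D) n (x := K D i) (r := 1) (fun j => by simp [K_K j i])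
  mul_Kinv i := by
    simpa using Kpow_qcomm (D := D) n (x := Kinv D i) (r := 1) (fun j => by simp [Kinv_K' i j])

/-- Invariance in the flag algebras is stated for all `K_λ`; this recovers it for `K_i` and `K_i⁻¹`.
-/
theorem Kpow_single [DecidableEq I] (i : I) (z : ℤ) : Kpow D (Pi.single i z) = Kunit D i ^ z := by
  have hc : ((Finset.univ : Finset I) : Set I).Pairwise
      (Function.onFun Commute fun j => Kunit D j ^ (Pi.single i z : I → ℤ) j) :=
    fun i _ j _ _ => ((Kunit_comm i j).zpow_left _).zpow_right _
  have h1 : ∀ hc', (Finset.univ.erase i).noncommProd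
      (fun j => Kunit D j ^ (Pi.single i z : I → ℤ) j) hc' = 1 := fun hc' => by
    rw [Finset.noncommProd_eq_pow_card _ _ _ 1, one_pow]
    intro j hj
    rw [Pi.single_eq_of_ne (Finset.ne_of_mem_erase hj), zpow_zero]
  refine (Finset.mul_noncommProd_erase _ (Finset.mem_univ i) _ hc).symm.trans ?_
  exact (congrArg _ (h1 _)).trans (by rw [Pi.single_eq_same, mul_one])

end Quantum.Uq

namespace Quantum

/-! ### Matrix representations and their coefficients. -/

section MatrixRep

open MulOpposite

variable {I : Type*} {D : QuantumDatum I} {κ : Type*} [Fintype κ] [DecidableEq κ]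

/-- The matrix entries of a finite-dimensional representation of type one belong to `ℂ_q[G]`. -/
theorem entry_mem_coordRing (R : Uq D →ₐ[ℂ] Matrix κ κ ℂ) {z : I → κ → ℤ}
    (hR : ∀ i, R (Uq.K D i) = Matrix.diagonal fun k => ((D.qi i ^ z i k : ℝ) : ℂ))
    {φ : UqDual D} {i j : κ} (hφ : ∀ X, φ X = R X i j) : φ ∈ coordRing D := by
  -- `coeffSet` only admits representation spaces in `Type`, while `κ` lives in an arbitrary
  -- universe; the representation is carried over to functions on `Fin (card κ)`.
  let e := Fintype.equivFin κ
  let R' : Uq D →ₐ[ℂ] Module.End ℂ (Fin (Fintype.card κ) → ℂ) :=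
    (Matrix.toLinAlgEquiv'.toAlgHom.comp (Matrix.reindexAlgEquiv ℂ ℂ e).toAlgHom).comp R
  have hR' (X : Uq D) (k l : κ) : R' X (Pi.single (e l) 1) (e k) = R X k l := by
    simp [R']
  refine Submodule.subset_span ⟨Fin (Fintype.card κ) → ℂ, inferInstance, inferInstance,
    inferInstance, R', LinearMap.proj (e i), Pi.single (e j) 1, ?_, ?_⟩
  · rw [IsTypeOne, eq_top_iff, ← (Pi.basisFun ℂ (Fin (Fintype.card κ))).span_eq,
      Submodule.span_le]
    rintro _ ⟨k, rfl⟩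
    obtain ⟨k, rfl⟩ := e.surjective k
    refine Submodule.subset_span fun i => ⟨z i k, ?_⟩
    rw [Pi.basisFun_apply]
    funext l
    obtain ⟨l, rfl⟩ := e.surjective l
    rw [hR', hR, Pi.smul_apply, Pi.single_apply, Matrix.diagonal_apply]
    by_cases h : l = k <;> simp [h]
  · ext X
    rw [hφ, matrixCoeff_apply, LinearMap.proj_apply, hR']

theorem map_Kinv_eq_diagonal (R : Uq D →ₐ[ℂ] Matrix κ κ ℂ) {z : I → κ → ℤ}
    (hR : ∀ i, R (Uq.K D i) = Matrix.diagonal fun k => ((D.qi i ^ z i k : ℝ) : ℂ)) (i : I) :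
    R (Uq.Kinv D i) = Matrix.diagonal fun k => ((D.qi i ^ (-z i k) : ℝ) : ℂ) := by
  refine left_inv_eq_right_inv (a := R (Uq.K D i)) ?_ ?_
  · rw [← map_mul, Uq.Kinv_K, map_one]
  · rw [hR, Matrix.diagonal_mul_diagonal, ← Matrix.diagonal_one]
    congr 1
    funext k
    rw [← Complex.ofReal_mul, ← zpow_add₀ (D.qi_pos i).ne']
    simp

/-- The contragredient of a matrix representation. -/
def contragredient (R : Uq D →ₐ[ℂ] Matrix κ κ ℂ) : Uq D →ₐ[ℂ] Matrix κ κ ℂ :=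
  ((Matrix.transposeAlgEquiv κ ℂ ℂ).symm.toAlgHom.comp (AlgHom.op R)).comp (Uq.antipodeHom D)

theorem contragredient_apply (R : Uq D →ₐ[ℂ] Matrix κ κ ℂ) (X : Uq D) (i j : κ) :
    contragredient R X i j = R (Uq.antipode D X) j i := rfl

/-- These are coefficients of the contragredient representation, which is again of type one, with
the exponents of the `K_i` negated. It will be applied to the functions `(u^i_j)^*`. -/
theorem antipode_entry_mem_coordRing (R : Uq D →ₐ[ℂ] Matrix κ κ ℂ) {z : I → κ → ℤ}
    (hR : ∀ i, R (Uq.K D i) = Matrix.diagonal fun k => ((D.qi i ^ z i k : ℝ) : ℂ))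
    {φ : UqDual D} {i j : κ} (hφ : ∀ X, φ X = R (Uq.antipode D X) j i) : φ ∈ coordRing D := by
  refine entry_mem_coordRing (contragredient R) (z := fun i k => -z i k) (fun i => ?_) hφ
  ext k l
  rw [contragredient_apply, Uq.antipode_K, map_Kinv_eq_diagonal R hR]
  exact congrFun (congrFun
    (Matrix.diagonal_transpose fun k => ((D.qi i ^ (-z i k) : ℝ) : ℂ)) k) l

end MatrixRep

/-! ### Point derivations on the flag algebras. -/

section Points

variable {I : Type*} {D : QuantumDatum I}

theorem UqDual.mul_apply_one (a b : UqDual D) : (a * b) 1 = a 1 * b 1 := by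
  simp [LinearMap.convMul_apply, Algebra.TensorProduct.one_def]

/-- Read off from `Δ(E_i)`. The only obstacle to a Leibniz rule at `1` is the value `b(K_i)`, which
equals `b(1)` on the flag algebras. -/
theorem UqDual.mul_apply_E (a b : UqDual D) (i : I) :
    (a * b) (Uq.E D i) = a (Uq.E D i) * b (Uq.K D i) + a 1 * b (Uq.E D i) := by
  simp [LinearMap.convMul_apply]

theorem UqDual.mul_apply_F (a b : UqDual D) (i : I) :
    (a * b) (Uq.F D i) = a (Uq.F D i) * b 1 + a (Uq.Kinv D i) * b (Uq.F D i) := by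
  simp [LinearMap.convMul_apply]

/-- The value of a functional at an element, as a linear map on a subalgebra of the dual. -/
def evalAt (S : Subalgebra ℂ (UqDual D)) (X : Uq D) : S →ₗ[ℂ] ℂ where
  toFun a := (a : UqDual D) X
  map_add' _ _ := rfl
  map_smul' _ _ := rfl

@[simp] theorem evalAt_apply (S : Subalgebra ℂ (UqDual D)) (X : Uq D) (a : S) :
    evalAt S X a = (a : UqDual D) X := rfl

/-- The character given by the unit of `U_q(𝔤)`. -/
def evalOne (S : Subalgebra ℂ (UqDual D)) : S →ₐ[ℂ] ℂ :=
  AlgHom.ofLinearMap (evalAt S 1) (by simp) (fun a b => UqDual.mul_apply_one a.1 b.1)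

@[simp] theorem evalOne_apply (S : Subalgebra ℂ (UqDual D)) (a : S) :
    evalOne S a = (a : UqDual D) 1 := rfl

variable [Fintype I]

theorem exists_Kpow_eq_K (i : I) : ∃ n : I → ℤ, (Uq.Kpow D n : Uq D) = Uq.K D i := by
  classical
  exact ⟨Pi.single i 1, by rw [Uq.Kpow_single, zpow_one]; rfl⟩

theorem exists_Kpow_eq_Kinv (i : I) : ∃ n : I → ℤ, (Uq.Kpow D n : Uq D) = Uq.Kinv D i := by
  classical
  exact ⟨Pi.single i (-1), by rw [Uq.Kpow_single, zpow_neg_one]; rfl⟩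

theorem flagLeft_apply_Kpow_mul {a : UqDual D} (ha : a ∈ flagLeft D) (n : I → ℤ) (X : Uq D) :
    a (Uq.Kpow D n * X) = a X := by
  rw [← UqDual.rightAct_apply, ha.2]

theorem flagRight_apply_mul_Kpow {a : UqDual D} (ha : a ∈ flagRight D) (n : I → ℤ) (X : Uq D) :
    a (X * Uq.Kpow D n) = a X := by
  rw [← UqDual.leftAct_apply, ha.2]

theorem flagLeft_apply_K {a : UqDual D} (ha : a ∈ flagLeft D) (i : I) : a (Uq.K D i) = a 1 := by
  obtain ⟨n, hn⟩ := exists_Kpow_eq_K (D := D) i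
  rw [← hn, ← flagLeft_apply_Kpow_mul ha n 1, mul_one]

theorem flagLeft_apply_Kinv {a : UqDual D} (ha : a ∈ flagLeft D) (i : I) :
    a (Uq.Kinv D i) = a 1 := by
  obtain ⟨n, hn⟩ := exists_Kpow_eq_Kinv (D := D) i
  rw [← hn, ← flagLeft_apply_Kpow_mul ha n 1, mul_one]

theorem flagRight_apply_K {a : UqDual D} (ha : a ∈ flagRight D) (i : I) :
    a (Uq.K D i) = a 1 := by
  obtain ⟨n, hn⟩ := exists_Kpow_eq_K (D := D) i
  rw [← hn, ← flagRight_apply_mul_Kpow ha n 1, one_mul]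

theorem flagRight_apply_Kinv {a : UqDual D} (ha : a ∈ flagRight D) (i : I) :
    a (Uq.Kinv D i) = a 1 := by
  obtain ⟨n, hn⟩ := exists_Kpow_eq_Kinv (D := D) i
  rw [← hn, ← flagRight_apply_mul_Kpow ha n 1, one_mul]

/-- The right action of `K_{2ρ}` in `θ` is trivial on this algebra, so a one-sided action remains.
-/
theorem coe_thetaLeft (n : I → ℤ) (a : flagLeft D) :
    (thetaLeft D n a : UqDual D) = UqDual.leftAct (Uq.Kpow D n : Uq D) a := by
  change UqDual.leftAct _ (UqDual.rightAct _ a.1) = _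
  rw [a.2.2]

theorem coe_thetaRight (n : I → ℤ) (a : flagRight D) :
    (thetaRight D n a : UqDual D) = UqDual.rightAct (Uq.Kpow D n : Uq D) a := by
  change UqDual.leftAct _ (UqDual.rightAct _ a.1) = _
  rw [UqDual.leftAct_rightAct, a.2.2]

/-- The value of `θ(a)` at `1` is `a(K_{2ρ})`, and invariance equates it with `a(1)`. Thus `1` is a
fixed point of `θ`, and twisting does not disturb the cocycle. -/
theorem evalOne_thetaLeft (n : I → ℤ) (a : flagLeft D) :
    evalOne _ (thetaLeft D n a) = evalOne _ a := by
  rw [evalOne_apply, coe_thetaLeft, UqDual.leftAct_apply, one_mul, evalOne_apply,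
    ← flagLeft_apply_Kpow_mul a.2 n 1, mul_one]

theorem evalOne_thetaRight (n : I → ℤ) (a : flagRight D) :
    evalOne _ (thetaRight D n a) = evalOne _ a := by
  rw [evalOne_apply, coe_thetaRight, UqDual.rightAct_apply, mul_one, evalOne_apply,
    ← flagRight_apply_mul_Kpow a.2 n 1, one_mul]

/-- The Leibniz rule at `E_i` uses invariance of the second factor under `K_i`, the one at `F_i`
invariance of the first factor under `K_i⁻¹`. -/
theorem flagLeft_hasNontrivialClass {n : I → ℤ}
    {z : flagLeft D ⊗[ℂ] (flagLeft D ⊗[ℂ] flagLeft D)}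
    (hz : z ∈ Hochschild.normalizedCycles (A := flagLeft D) (thetaLeft D n)) (i : I)
    (hne : Hochschild.pointFunctional (A := flagLeft D) (evalOne (flagLeft D)) (evalAt _ (Uq.E D i))
      (evalAt _ (Uq.F D i)) z ≠ 0) : Hochschild.HasNontrivialClass (A := flagLeft D) (thetaLeft D n) z := by
  refine Hochschild.hasNontrivialClass_of_derivations (A := flagLeft D) hz (evalOne_thetaLeft n)
    (fun a b => ?_) (fun a b => ?_) hne
  · exact (UqDual.mul_apply_E _ _ i).trans (by rw [flagLeft_apply_K b.2]; rfl)
  · exact (UqDual.mul_apply_F _ _ i).trans (by rw [flagLeft_apply_Kinv a.2]; rfl)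

theorem flagRight_hasNontrivialClass {n : I → ℤ}
    {z : flagRight D ⊗[ℂ] (flagRight D ⊗[ℂ] flagRight D)}
    (hz : z ∈ Hochschild.normalizedCycles (A := flagRight D) (thetaRight D n)) (i : I)
    (hne : Hochschild.pointFunctional (A := flagRight D) (evalOne (flagRight D)) (evalAt _ (Uq.E D i))
      (evalAt _ (Uq.F D i)) z ≠ 0) : Hochschild.HasNontrivialClass (A := flagRight D) (thetaRight D n) z := by
  refine Hochschild.hasNontrivialClass_of_derivations (A := flagRight D) hz (evalOne_thetaRight n)
    (fun a b => ?_) (fun a b => ?_) hne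
  · exact (UqDual.mul_apply_E _ _ i).trans (by rw [flagRight_apply_K b.2]; rfl)
  · exact (UqDual.mul_apply_F _ _ i).trans (by rw [flagRight_apply_Kinv a.2]; rfl)

end Points

/-! ### The trace computed by the pairing. -/

section Trace

variable {κ : Type*} [Fintype κ] [DecidableEq κ]

/-- Rewrites the values of the entries of the rank one matrices `M` and `N` as entries of products
with `e_{mm}` in the middle. -/
theorem mul_single_mul_apply (A B : Matrix κ κ ℂ) (m i j : κ) :
    (A * Matrix.single m m (1 : ℂ) * B : Matrix κ κ ℂ) i j = A i m * B m j := by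
  rw [Matrix.mul_apply, Finset.sum_eq_single m]
  · simp
  · intro k _ hk
    rw [Matrix.mul_single_apply_of_ne _ _ _ _ _ hk, zero_mul]
  · simp

/-- The pairing of the Chern character of a rank one projection with a pair of inner
derivations. -/
theorem trace_projection {m : κ} {p E F V Z : Matrix κ κ ℂ} {ζ ν c : ℂ}
    (hp : p = Matrix.single m m 1) (hζ : ζ ≠ 0) (hν : ν ≠ 0) (hc : c ≠ 1)
    (hpZ : p * Z = ζ • p) (hZp : Z * p = ζ • p) (hpV : p * V = ν • p) (hVp : V * p = ν • p)
    (hFV : F * V = c • (V * F)) (hEZ : E * Z = c • (Z * E)) :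
    Matrix.trace (V * ((2 • p - 1) * ((p * E - E * p) * (Z * (p * F - F * p))))) =
      ζ * ν * c * (F * E - E * F) m m := by
  have hpp : p * p = p := by simp [hp]
  -- `E` changes the eigenvalue of `Z` by the factor `c ≠ 1`, while `p` projects into a single
  -- eigenspace: evaluating `p E Z p` in two ways gives `c ζ pEp = ζ pEp`.
  have hpEp : p * E * p = 0 := by
    have h1 : p * (E * Z) * p = ζ • (p * E * p) := by
      rw [← mul_assoc, mul_assoc (p * E), hZp, mul_smul_comm]
    rw [hEZ, mul_smul_comm, ← mul_assoc, hpZ, smul_mul_assoc, smul_mul_assoc, smul_mul_assoc, smul_smul,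
      ← sub_eq_zero, ← sub_smul, smul_eq_zero] at h1
    refine h1.resolve_left fun h => ?_
    rw [← sub_one_mul, mul_eq_zero, sub_eq_zero] at h
    exact h.elim hc hζ
  -- The same argument with `V` in place of `Z`.
  have hpFp : p * F * p = 0 := by
    have h1 : p * (F * V) * p = ν • (p * F * p) := by
      rw [← mul_assoc, mul_assoc (p * F), hVp, mul_smul_comm]
    rw [hFV, mul_smul_comm, ← mul_assoc, hpV, smul_mul_assoc, smul_mul_assoc, smul_mul_assoc, smul_smul,
      ← sub_eq_zero, ← sub_smul, smul_eq_zero] at h1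
    refine h1.resolve_left fun h => ?_
    rw [← sub_one_mul, mul_eq_zero, sub_eq_zero] at h
    exact h.elim hc hν
  have htr (A : Matrix κ κ ℂ) : Matrix.trace (p * A) = A m m := by
    rw [hp, Matrix.trace_mul_comm, Matrix.trace_mul_single]; simp
  -- `[p, E]` is off-diagonal with respect to `p`, and the grading operator `2p - 1` changes the
  -- sign of one of its two blocks.
  have e1 : (2 • p - 1) * (p * E - E * p) = p * E + E * p := by
    have : (2 • p - 1) * (p * E - E * p) =
        2 • (p * p * E) - 2 • (p * E * p) - p * E + E * p := by noncomm_ring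
    rw [this, hpp, hpEp]
    noncomm_ring
  have e2 : (p * E + E * p) * (Z * (p * F - F * p)) =
      ζ • (E * p * F) - c • ζ • (p * E * F * p) := by
    have : (p * E + E * p) * (Z * (p * F - F * p)) =
      p * E * (Z * p) * F - p * (E * Z) * F * p + E * (p * Z) * p * F - E * (p * Z) * F * p := by
      noncomm_ring
    rw [this, hZp, hEZ, hpZ]
    simp only [mul_smul_comm, smul_mul_assoc, hpEp, ← mul_assoc, hpZ]
    rw [mul_assoc E p p, hpp, mul_assoc E p F, mul_assoc E (p * F) p, hpFp]
    simp only [mul_zero, smul_zero, sub_zero, zero_mul, zero_sub]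
    abel
  -- Here `c` arises from moving `F` past `V`; in the other term of `e2` it arose from moving `E`
  -- past `Z`. As the two factors agree, the two traces combine into a commutator.
  have t1 : Matrix.trace (V * (E * p * F)) = ν * c * (F * E) m m := by
    rw [← mul_assoc, ← mul_assoc, mul_assoc (V * E), Matrix.trace_mul_comm, mul_assoc p,
      ← mul_assoc F, hFV, smul_mul_assoc, mul_smul_comm, mul_assoc V, ← mul_assoc p, hpV,
      smul_mul_assoc, Matrix.trace_smul, Matrix.trace_smul, htr]
    simp only [smul_eq_mul]; ring
  have t2 : Matrix.trace (V * (p * E * F * p)) = ν * (E * F) m m := by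
    rw [Matrix.trace_mul_comm, mul_assoc _ p V, hpV, mul_smul_comm, Matrix.trace_smul,
      Matrix.trace_mul_comm, ← mul_assoc, ← mul_assoc, hpp, mul_assoc, htr, smul_eq_mul]
  rw [← mul_assoc (2 • p - 1), e1, e2, mul_sub, Matrix.trace_sub, mul_smul_comm, mul_smul_comm,
    mul_smul_comm, Matrix.trace_smul, Matrix.trace_smul, Matrix.trace_smul, t1, t2,
    Matrix.sub_apply]
  simp only [smul_eq_mul]
  ring

end Trace

end Quantum

namespace Quantum

/-! ### Coefficients of a unitary representation in a weight basis. -/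

section Unitary

variable {I : Type*} {D : QuantumDatum I} {V : Type*} [NormedAddCommGroup V]
  [InnerProductSpace ℂ V] {κ : Type*} [Fintype κ] [DecidableEq κ]
  (π : Uq D →ₐ[ℂ] Module.End ℂ V) (v : OrthonormalBasis κ ℂ V)

/-- The matrix form of a representation. -/
def repHom : Uq D →ₐ[ℂ] Matrix κ κ ℂ := (LinearMap.toMatrixAlgEquiv v.toBasis).toAlgHom.comp π

theorem repHom_apply (X : Uq D) : repHom π v X = repMatrix π v X := rfl

theorem coeffU_apply (i j : κ) (X : Uq D) : coeffU π v i j X = repHom π v X i j := by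
  rw [repHom_apply, repMatrix, LinearMap.toMatrix_apply]
  simp [coeffU]

theorem repHom_apply_eq_inner (X : Uq D) (i j : κ) :
    repHom π v X i j = inner ℂ (v i) (π X (v j)) := by
  rw [← coeffU_apply, coeffU, matrixCoeff_apply]
  simp [v.repr_apply_apply]

variable {π}

/-- By definition the left side is the conjugate of `⟨v_i, S(X)^* v_j⟩`; unitarity moves `S(X)` to
the first entry, and conjugate symmetry gives `⟨v_j, S(X) v_i⟩`. -/
theorem star_coeffU_apply (hπ : IsUnitaryRep π) (i j : κ) (X : Uq D) :
    (star (coeffU π v i j)) X = repHom π v (Uq.antipode D X) j i := by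
  rw [UqDual.star_apply, coeffU_apply, repHom_apply_eq_inner, repHom_apply_eq_inner, ← hπ,
    inner_conj_symm]

theorem repHom_eq_diagonal {u : Uq D} {c : κ → ℂ} (h : ∀ k, π u (v k) = c k • v k) :
    repHom π v u = Matrix.diagonal c := by
  ext i j
  rw [repHom_apply_eq_inner, h, inner_smul_right, v.inner_eq_ite, Matrix.diagonal_apply]
  by_cases hij : i = j <;> simp [hij]

section WeightUnits

variable (π)

/-- The units that act diagonally in the given basis. -/
def diagonalUnits : Subgroup (Uq D)ˣ where
  carrier := {u | ∀ k, ∃ c : ℂˣ, π (u : Uq D) (v k) = (c : ℂ) • v k}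
  one_mem' k := ⟨1, by simp⟩
  mul_mem' {a b} ha hb k := by
    obtain ⟨c, hc⟩ := ha k
    obtain ⟨d, hd⟩ := hb k
    refine ⟨d * c, ?_⟩
    rw [Units.val_mul, map_mul, Module.End.mul_apply, hd, map_smul, hc, smul_smul, Units.val_mul]
  inv_mem' {a} ha k := by
    obtain ⟨c, hc⟩ := ha k
    refine ⟨c⁻¹, ?_⟩
    have h : π ((a⁻¹ : (Uq D)ˣ) : Uq D) (π (a : Uq D) (v k)) = v k := by
      rw [← Module.End.mul_apply, ← map_mul, Units.inv_mul, map_one, Module.End.one_apply]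
    rw [hc, map_smul] at h
    nth_rewrite 2 [← h]
    rw [smul_smul, Units.inv_mul, one_smul]

variable {π v}

/-- Only diagonality and invertibility of the eigenvalues of `K_λ` are used later; their values play
no role. -/
theorem exists_repHom_Kpow [Fintype I] {z : I → κ → ℤ}
    (hz : ∀ i k, π (Uq.K D i) (v k) = ((D.qi i ^ z i k : ℝ) : ℂ) • v k) (n : I → ℤ) :
    ∃ c : κ → ℂˣ, repHom π v (Uq.Kpow D n : Uq D) = Matrix.diagonal fun k => (c k : ℂ) := by
  have h : Uq.Kpow D n ∈ diagonalUnits π v :=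
    Subgroup.noncommProd_mem _ _ fun i _ => Subgroup.zpow_mem _ (fun k =>
      ⟨Units.mk0 _ (Complex.ofReal_ne_zero.2 (zpow_ne_zero (z i k) (D.qi_pos i).ne')), hz i k⟩) _
  choose c hc using h
  exact ⟨c, repHom_eq_diagonal v hc⟩

end WeightUnits

section Actions

variable {v} {u : (Uq D)ˣ} {c : κ → ℂˣ}

theorem repHom_inv (hc : repHom π v (u : Uq D) = Matrix.diagonal fun k => (c k : ℂ)) :
    repHom π v ((u⁻¹ : (Uq D)ˣ) : Uq D) = Matrix.diagonal fun k => ((c k)⁻¹ : ℂ) := by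
  refine left_inv_eq_right_inv (a := repHom π v (u : Uq D)) ?_ ?_
  · rw [← map_mul, Units.inv_mul, map_one]
  · rw [hc, Matrix.diagonal_mul_diagonal, ← Matrix.diagonal_one]
    simp

theorem leftAct_coeffU (hc : repHom π v (u : Uq D) = Matrix.diagonal fun k => (c k : ℂ))
    (i j : κ) : UqDual.leftAct (u : Uq D) (coeffU π v i j) = (c j : ℂ) • coeffU π v i j := by
  ext X
  change coeffU π v i j (X * u) = (c j : ℂ) * coeffU π v i j X
  rw [coeffU_apply, coeffU_apply, map_mul, hc, Matrix.mul_diagonal, mul_comm]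

theorem rightAct_coeffU (hc : repHom π v (u : Uq D) = Matrix.diagonal fun k => (c k : ℂ))
    (i j : κ) : UqDual.rightAct (u : Uq D) (coeffU π v i j) = (c i : ℂ) • coeffU π v i j := by
  ext X
  change coeffU π v i j (u * X) = (c i : ℂ) * coeffU π v i j X
  rw [coeffU_apply, coeffU_apply, map_mul, hc, Matrix.diagonal_mul]

/-- The eigenvalue is inverted because `S(u) = u⁻¹` for a group-like unit. -/
theorem leftAct_star_coeffU (hπ : IsUnitaryRep π) (hu : IsGroupLikeElem ℂ (u : Uq D))
    (hc : repHom π v (u : Uq D) = Matrix.diagonal fun k => (c k : ℂ)) (i j : κ) :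
    UqDual.leftAct (u : Uq D) (star (coeffU π v i j)) =
      ((c j)⁻¹ : ℂ) • star (coeffU π v i j) := by
  ext X
  change (star (coeffU π v i j)) (X * u) = ((c j)⁻¹ : ℂ) * (star (coeffU π v i j)) X
  rw [star_coeffU_apply v hπ, star_coeffU_apply v hπ, Uq.antipode_mul,
    Uq.antipode_of_isGroupLikeElem hu, map_mul, repHom_inv hc, Matrix.diagonal_mul]

theorem rightAct_star_coeffU (hπ : IsUnitaryRep π) (hu : IsGroupLikeElem ℂ (u : Uq D))
    (hc : repHom π v (u : Uq D) = Matrix.diagonal fun k => (c k : ℂ)) (i j : κ) :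
    UqDual.rightAct (u : Uq D) (star (coeffU π v i j)) =
      ((c i)⁻¹ : ℂ) • star (coeffU π v i j) := by
  ext X
  change (star (coeffU π v i j)) (u * X) = ((c i)⁻¹ : ℂ) * (star (coeffU π v i j)) X
  rw [star_coeffU_apply v hπ, star_coeffU_apply v hπ, Uq.antipode_mul,
    Uq.antipode_of_isGroupLikeElem hu, map_mul, repHom_inv hc, Matrix.mul_diagonal, mul_comm]

end Actions

/-! ### Unitarity relations and quantum traces. -/

section Unitarity

/-- Evaluation of a sum of products of two families of functionals. -/
theorem sum_smul_mul_apply {ι : Type*} (s : Finset ι) (d : ι → ℂ) (φ ψ : ι → UqDual D)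
    (L : Uq D ⊗[ℂ] Uq D →ₗ[ℂ] ℂ) (h : ∀ x y, ∑ k ∈ s, d k * (φ k x * ψ k y) = L (x ⊗ₜ y))
    (X : Uq D) :
    (∑ k ∈ s, d k • (φ k * ψ k)) X = L (Coalgebra.comul (R := ℂ) X) := by
  have h1 : (∑ k ∈ s, d k • (φ k * ψ k)) X = ∑ k ∈ s, d k * (φ k * ψ k) X := by
    let e : UqDual D →ₗ[ℂ] ℂ := ⟨⟨fun φ => φ X, fun _ _ => rfl⟩, fun _ _ => rfl⟩
    change e _ = ∑ k ∈ s, d k * e (φ k * ψ k)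
    simp only [map_sum, map_smul, smul_eq_mul]
  rw [h1]
  simp only [LinearMap.convMul_apply]
  induction Coalgebra.comul (R := ℂ) X using TensorProduct.induction_on with
  | zero => simp
  | tmul x y => rw [← h]; rfl
  | add x y hx hy => simp only [map_add, mul_add, Finset.sum_add_distrib, hx, hy]

/-- The entry `X ↦ π(X)_{ij}` as a functional. -/
def entry (i j : κ) : Uq D →ₗ[ℂ] ℂ := (coeffU π v i j).ofConv

theorem entry_apply (i j : κ) (X : Uq D) : entry (π := π) v i j X = repHom π v X i j :=
  coeffU_apply π v i j X

variable {v}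

/-- At `X` the sum is the `(i, j)` entry of `π(X₁ S(X₂)) = ε(X)`. -/
theorem sum_coeffU_mul_star (hπ : IsUnitaryRep π) (i j : κ) :
    ∑ k, coeffU π v i k * star (coeffU π v j k) = if i = j then 1 else 0 := by
  have h := sum_smul_mul_apply Finset.univ (fun _ => 1) (fun k => coeffU π v i k)
    (fun k => star (coeffU π v j k)) (entry (π := π) v i j ∘ₗ Uq.sandwichAntipode D 1)
    (fun x y => by
      simp only [coeffU_apply, star_coeffU_apply v hπ, LinearMap.comp_apply, one_mul,
        Uq.sandwichAntipode_tmul, entry_apply, mul_one, map_mul, Matrix.mul_apply])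
  ext X
  simp only [one_smul] at h
  rw [h, LinearMap.comp_apply, Uq.sandwichAntipode_comul, map_smul, entry_apply, map_one,
    Matrix.one_apply]
  by_cases hij : i = j <;> simp [hij]

theorem sum_star_coeffU_mul (hπ : IsUnitaryRep π) (i j : κ) :
    ∑ k, star (coeffU π v k i) * coeffU π v k j = if i = j then 1 else 0 := by
  have h := sum_smul_mul_apply Finset.univ (fun _ => 1) (fun k => star (coeffU π v k i))
    (fun k => coeffU π v k j) (entry (π := π) v i j ∘ₗ Uq.antipodeSandwich D 1)
    (fun x y => by
      simp only [coeffU_apply, star_coeffU_apply v hπ, LinearMap.comp_apply, one_mul,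
        Uq.antipodeSandwich_tmul, entry_apply, mul_one, map_mul, Matrix.mul_apply])
  ext X
  simp only [one_smul] at h
  rw [h, LinearMap.comp_apply, Uq.antipodeSandwich_comul, map_smul, entry_apply, map_one,
    Matrix.one_apply]
  by_cases hij : i = j <;> simp [hij]

/-- The factors stand in the wrong order for the unitarity relations. At `X` the sum is the `(m, m)`
entry of `π(X₂ g S(X₁))`, so the flipped antipode identity applies; it dictates the weight
`K_{2ρ}⁻¹`. -/
theorem sum_unitM_diag (hπ : IsUnitaryRep π) {g : Uq D} (hg : Uq.QCommutes (-2) g) {d : κ → ℂ}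
    (hd : repHom π v g = Matrix.diagonal d) (m : κ) :
    ∑ k, d k • unitM π v m m k k = d m • (1 : UqDual D) := by
  ext X
  have h := sum_smul_mul_apply Finset.univ d (fun k => star (coeffU π v m k))
    (fun k => coeffU π v m k) (entry (π := π) v m m ∘ₗ Uq.sandwichAntipode D g ∘ₗ
      (TensorProduct.comm ℂ (Uq D) (Uq D)).toLinearMap)
    (fun x y => by
      simp only [coeffU_apply, star_coeffU_apply v hπ, LinearMap.comp_apply,
        LinearEquiv.coe_coe, TensorProduct.comm_tmul,
        Uq.sandwichAntipode_tmul, entry_apply, map_mul, hd, Matrix.mul_apply (M := _ * _),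
        Matrix.mul_diagonal]
      exact Finset.sum_congr rfl fun k _ => by ring) X
  refine h.trans ?_
  rw [LinearMap.comp_apply, LinearMap.comp_apply, LinearEquiv.coe_coe,
    Uq.sandwichAntipode_comm_comul hg, map_smul, entry_apply, hd, Matrix.diagonal_apply_eq]
  simp [mul_comm]

/-- Here the sum is the `(m, m)` entry of `π(S(X₂) g X₁)`, which dictates the weight `K_{2ρ}`. -/
theorem sum_unitN_diag (hπ : IsUnitaryRep π) {g : Uq D} (hg : Uq.QCommutes 2 g) {d : κ → ℂ}
    (hd : repHom π v g = Matrix.diagonal d) (m : κ) :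
    ∑ k, d k • unitN π v m m k k = d m • (1 : UqDual D) := by
  ext X
  have h := sum_smul_mul_apply Finset.univ d (fun k => coeffU π v k m)
    (fun k => star (coeffU π v k m)) (entry (π := π) v m m ∘ₗ Uq.antipodeSandwich D g ∘ₗ
      (TensorProduct.comm ℂ (Uq D) (Uq D)).toLinearMap)
    (fun x y => by
      simp only [coeffU_apply, star_coeffU_apply v hπ, LinearMap.comp_apply,
        LinearEquiv.coe_coe, TensorProduct.comm_tmul,
        Uq.antipodeSandwich_tmul, entry_apply, map_mul, hd, Matrix.mul_apply (M := _ * _),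
        Matrix.mul_diagonal]
      exact Finset.sum_congr rfl fun k _ => by ring) X
  refine h.trans ?_
  rw [LinearMap.comp_apply, LinearMap.comp_apply, LinearEquiv.coe_coe,
    Uq.antipodeSandwich_comm_comul hg, map_smul, entry_apply, hd, Matrix.diagonal_apply_eq]
  simp [mul_comm]

/-- The two middle factors, summed over `k`, collapse to `1` by unitarity. -/
theorem sum_unitM_mul_unitM (hπ : IsUnitaryRep π) (m i j : κ) :
    ∑ k, unitM π v m m i k * unitM π v m m k j = unitM π v m m i j := by
  have h (k : κ) : unitM π v m m i k * unitM π v m m k j =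
      star (coeffU π v m i) * (coeffU π v m k * star (coeffU π v m k)) * coeffU π v m j := by
    simp only [unitM, mul_assoc]
  simp only [h, ← Finset.sum_mul, ← Finset.mul_sum, sum_coeffU_mul_star hπ, if_true, mul_one]
  rfl

theorem sum_unitN_mul_unitN (hπ : IsUnitaryRep π) (m i j : κ) :
    ∑ k, unitN π v m m i k * unitN π v m m k j = unitN π v m m i j := by
  have h (k : κ) : unitN π v m m i k * unitN π v m m k j =
      coeffU π v i m * (star (coeffU π v k m) * coeffU π v k m) * star (coeffU π v j m) := by
    simp only [unitN, mul_assoc]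
  simp only [h, ← Finset.sum_mul, ← Finset.mul_sum, sum_star_coeffU_mul hπ, if_true, mul_one]
  rfl

end Unitarity

end Unitary

end Quantum

namespace Quantum

/-! ### The chains on the two flag algebras: cycles and pairings. -/

section Flag

variable {I : Type*} {D : QuantumDatum I} {V : Type*} [NormedAddCommGroup V]
  [InnerProductSpace ℂ V] {κ : Type*} [Fintype κ] [DecidableEq κ]
  {π : Uq D →ₐ[ℂ] Module.End ℂ V} {v : OrthonormalBasis κ ℂ V} {z : I → κ → ℤ}

theorem coeffU_mem_coordRing
    (hz : ∀ i k, π (Uq.K D i) (v k) = ((D.qi i ^ z i k : ℝ) : ℂ) • v k) (i j : κ) :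
    coeffU π v i j ∈ coordRing D :=
  entry_mem_coordRing (repHom π v) (fun i => repHom_eq_diagonal v (hz i)) (coeffU_apply π v i j)

theorem star_coeffU_mem_coordRing (hπ : IsUnitaryRep π)
    (hz : ∀ i k, π (Uq.K D i) (v k) = ((D.qi i ^ z i k : ℝ) : ℂ) • v k) (i j : κ) :
    star (coeffU π v i j) ∈ coordRing D :=
  antipode_entry_mem_coordRing (repHom π v) (fun i => repHom_eq_diagonal v (hz i))
    (star_coeffU_apply v hπ i j)

/-- The relation between `E_i` and `F_i` gives the entry `-(q_i^z - q_i^{-z}) / (q_i - q_i^{-1})`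
with `z = z i m`. It is non-zero because a positive real `q_i ≠ 1` is not a root of unity. -/
theorem repHom_commutator_ne_zero {i : I} {m : κ}
    (hz : ∀ k, π (Uq.K D i) (v k) = ((D.qi i ^ z i k : ℝ) : ℂ) • v k) (hm : z i m ≠ 0) :
    (repHom π v (Uq.F D i) * repHom π v (Uq.E D i) -
      repHom π v (Uq.E D i) * repHom π v (Uq.F D i)) m m ≠ 0 := by
  have hq := D.qi_pos i
  have hK := repHom_eq_diagonal v hz
  have hKinv : repHom π v (Uq.Kinv D i) = Matrix.diagonal fun k =>
      (((D.qi i ^ z i k)⁻¹ : ℝ) : ℂ) := by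
    refine left_inv_eq_right_inv (a := repHom π v (Uq.K D i)) ?_ ?_
    · rw [← map_mul, Uq.Kinv_K, map_one]
    · rw [hK, Matrix.diagonal_mul_diagonal, ← Matrix.diagonal_one]
      congr 1
      funext k
      rw [← Complex.ofReal_mul, mul_inv_cancel₀ (zpow_pos hq _).ne', Complex.ofReal_one]
  rw [← map_mul, ← map_mul, Uq.E_F_same, map_add, map_smul, map_sub, sub_add_cancel_left, hK,
    hKinv, Matrix.neg_apply, Matrix.smul_apply, Matrix.sub_apply, Matrix.diagonal_apply_eq,
    Matrix.diagonal_apply_eq, smul_eq_mul, ← Complex.ofReal_sub, ← Complex.ofReal_mul,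
    neg_ne_zero, Complex.ofReal_ne_zero]
  refine mul_ne_zero (inv_ne_zero (sub_inv_ne_zero' hq (D.qi_ne_one i)))
    (sub_inv_ne_zero' (zpow_pos hq _) fun h => hm ?_)
  exact (zpow_eq_one_iff_right₀ hq.le (D.qi_ne_one i)).1 h

theorem diagonal_mul_single (d : κ → ℂ) (m : κ) :
    Matrix.diagonal d * Matrix.single m m 1 = d m • Matrix.single m m (1 : ℂ) := by
  ext i j
  rw [Matrix.diagonal_mul, Matrix.smul_apply, Matrix.single_apply, smul_eq_mul]
  split_ifs with h
  · rw [h.1]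
  · simp

theorem single_mul_diagonal (d : κ → ℂ) (m : κ) :
    Matrix.single m m 1 * Matrix.diagonal d = d m • Matrix.single m m (1 : ℂ) := by
  ext i j
  rw [Matrix.mul_diagonal, Matrix.smul_apply, Matrix.single_apply, smul_eq_mul, mul_comm]
  split_ifs with h
  · rw [h.2]
  · simp

theorem zpow_ofReal_ne_one {q : ℝ} (hq : 0 < q) (hq1 : q ≠ 1) {e : ℤ} (he : e ≠ 0) :
    ((q ^ e : ℝ) : ℂ) ≠ 1 := fun h =>
  he ((zpow_eq_one_iff_right₀ hq.le hq1).1 (Complex.ofReal_eq_one.1 h))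

variable [Fintype I]

/-- The right action of `K_λ` sees only the first indices, both equal to `m`: the eigenvalues
`c_m⁻¹` and `c_m` cancel. -/
theorem unitM_mem_flagLeft (hπ : IsUnitaryRep π)
    (hz : ∀ i k, π (Uq.K D i) (v k) = ((D.qi i ^ z i k : ℝ) : ℂ) • v k) (m i j : κ) :
    unitM π v m m i j ∈ flagLeft D := by
  refine ⟨mul_mem (star_coeffU_mem_coordRing hπ hz m i) (coeffU_mem_coordRing hz m j), fun n => ?_⟩
  obtain ⟨c, hc⟩ := exists_repHom_Kpow hz n
  rw [unitM, UqDual.rightAct_mul (Uq.isGroupLikeElem_Kpow n),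
    rightAct_star_coeffU hπ (Uq.isGroupLikeElem_Kpow n) hc, rightAct_coeffU hc, smul_mul_smul_comm,
    inv_mul_cancel₀ (c m).ne_zero, one_smul]

theorem unitN_mem_flagRight (hπ : IsUnitaryRep π)
    (hz : ∀ i k, π (Uq.K D i) (v k) = ((D.qi i ^ z i k : ℝ) : ℂ) • v k) (m i j : κ) :
    unitN π v m m i j ∈ flagRight D := by
  refine ⟨mul_mem (coeffU_mem_coordRing hz i m) (star_coeffU_mem_coordRing hπ hz j m), fun n => ?_⟩
  obtain ⟨c, hc⟩ := exists_repHom_Kpow hz n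
  rw [unitN, UqDual.leftAct_mul (Uq.isGroupLikeElem_Kpow n),
    leftAct_star_coeffU hπ (Uq.isGroupLikeElem_Kpow n) hc, leftAct_coeffU hc, smul_mul_smul_comm,
    mul_inv_cancel₀ (c m).ne_zero, one_smul]

/-- `θ` multiplies the `(i, j)` entry by `c_i⁻¹ c_j`, which is conjugation by `π(K_{2ρ})⁻¹`. The
same weight makes the trace scalar, so all conditions of the cycle criterion hold at once. -/
theorem chernChain_matM_mem_normalizedCycles (hπ : IsUnitaryRep π) {n : I → ℤ} {c : κ → ℂˣ}
    (hn : Uq.QCommutes 2 (Uq.Kpow D n : Uq D))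
    (hc : repHom π v (Uq.Kpow D n : Uq D) = Matrix.diagonal fun k => (c k : ℂ)) (m : κ)
    (hM : ∀ i j, unitM π v m m i j ∈ flagLeft D) :
    Hochschild.chernChain (repMatrix π v ((Uq.Kpow D n)⁻¹ : (Uq D)ˣ)) (matM π v m m hM) ∈
      Hochschild.normalizedCycles (A := flagLeft D) (thetaLeft D n) := by
  rw [← repHom_apply, repHom_inv hc]
  refine Hochschild.chernChain_mem_normalizedCycles (A := flagLeft D) (c := (c m : ℂ)⁻¹) ?_ ?_ ?_
  · ext i j : 2
    rw [Matrix.mul_apply, AddSubmonoidClass.coe_finsetSum]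
    exact sum_unitM_mul_unitM hπ m i j
  · intro i j
    refine Subtype.ext ?_
    change ((c j)⁻¹ : ℂ) • (thetaLeft D n (matM π v m m hM i j) : UqDual D) =
      ((c i)⁻¹ : ℂ) • unitM π v m m i j
    rw [coe_thetaLeft]
    change _ • UqDual.leftAct _ (unitM π v m m i j) = _
    rw [unitM, UqDual.leftAct_mul (Uq.isGroupLikeElem_Kpow n),
      leftAct_star_coeffU hπ (Uq.isGroupLikeElem_Kpow n) hc, leftAct_coeffU hc,
      smul_mul_smul_comm, smul_smul, mul_left_comm, inv_mul_cancel₀ (c j).ne_zero, mul_one]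
  · refine Subtype.ext ?_
    rw [AddSubmonoidClass.coe_finsetSum]
    exact sum_unitM_diag hπ hn.inv (repHom_inv hc) m

theorem chernChain_matN_mem_normalizedCycles (hπ : IsUnitaryRep π) {n : I → ℤ} {c : κ → ℂˣ}
    (hn : Uq.QCommutes 2 (Uq.Kpow D n : Uq D))
    (hc : repHom π v (Uq.Kpow D n : Uq D) = Matrix.diagonal fun k => (c k : ℂ)) (m : κ)
    (hN : ∀ i j, unitN π v m m i j ∈ flagRight D) :
    Hochschild.chernChain (repMatrix π v (Uq.Kpow D n : Uq D)) (matN π v m m hN) ∈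
      Hochschild.normalizedCycles (A := flagRight D) (thetaRight D n) := by
  rw [← repHom_apply, hc]
  refine Hochschild.chernChain_mem_normalizedCycles (A := flagRight D) (c := (c m : ℂ)) ?_ ?_ ?_
  · ext i j : 2
    rw [Matrix.mul_apply, AddSubmonoidClass.coe_finsetSum]
    exact sum_unitN_mul_unitN hπ m i j
  · intro i j
    refine Subtype.ext ?_
    change (c j : ℂ) • (thetaRight D n (matN π v m m hN i j) : UqDual D) =
      (c i : ℂ) • unitN π v m m i j
    rw [coe_thetaRight]
    change _ • UqDual.rightAct _ (unitN π v m m i j) = _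
    rw [unitN, UqDual.rightAct_mul (Uq.isGroupLikeElem_Kpow n),
      rightAct_star_coeffU hπ (Uq.isGroupLikeElem_Kpow n) hc, rightAct_coeffU hc,
      smul_mul_smul_comm, smul_smul, mul_left_comm, mul_inv_cancel₀ (c j).ne_zero, mul_one]
  · refine Subtype.ext ?_
    rw [AddSubmonoidClass.coe_finsetSum]
    exact sum_unitN_diag hπ hn hc m


/-- The trace formula applies with `Z = π(K_i)` and `V = π(K_{2ρ})⁻¹`. Both commutation factors are
`q_i^{-2}`: one is `q_i^{-a_ii}`, the other comes from `⟨2ρ, α_i^∨⟩ = 2`. -/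
theorem pairing_matM_ne_zero (hπ : IsUnitaryRep π) {n : I → ℤ} {c : κ → ℂˣ}
    (hn : Uq.QCommutes 2 (Uq.Kpow D n : Uq D))
    (hc : repHom π v (Uq.Kpow D n : Uq D) = Matrix.diagonal fun k => (c k : ℂ)) {m : κ}
    (hM : ∀ i j, unitM π v m m i j ∈ flagLeft D) {i : I}
    (hz : ∀ k, π (Uq.K D i) (v k) = ((D.qi i ^ z i k : ℝ) : ℂ) • v k) (hm : z i m ≠ 0) :
    Hochschild.pointFunctional (A := flagLeft D) (evalOne (flagLeft D)) (evalAt _ (Uq.E D i))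
      (evalAt _ (Uq.F D i)) (Hochschild.chernChain
        (repMatrix π v ((Uq.Kpow D n)⁻¹ : (Uq D)ˣ)) (matM π v m m hM)) ≠ 0 := by
  set ρ := repHom π v
  have hK : ρ (Uq.K D i) = _ := repHom_eq_diagonal v hz
  have hqm : ((D.qi i ^ z i m : ℝ) : ℂ) ≠ 0 :=
    Complex.ofReal_ne_zero.2 (zpow_pos (D.qi_pos i) _).ne'
  have hc2 : ((D.qi i ^ (-2 : ℤ) : ℝ) : ℂ) ≠ 0 :=
    Complex.ofReal_ne_zero.2 (zpow_pos (D.qi_pos i) _).ne'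
  let p : Matrix κ κ ℂ := Matrix.single m m 1
  have hpK : p * ρ (Uq.K D i) = ((D.qi i ^ z i m : ℝ) : ℂ) • p := by
    rw [hK]; exact single_mul_diagonal _ m
  have hKp : ρ (Uq.K D i) * p = ((D.qi i ^ z i m : ℝ) : ℂ) • p := by
    rw [hK]; exact diagonal_mul_single _ m
  have e0 : (matM π v m m hM).map (evalOne (flagLeft D)) = p := by
    ext k l
    change unitM π v m m k l 1 = _
    rw [unitM, UqDual.mul_apply_one, star_coeffU_apply v hπ, coeffU_apply, Uq.antipode_one,
      ← mul_single_mul_apply, map_one, one_mul, mul_one]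
  have eE : (matM π v m m hM).map (evalAt (flagLeft D) (Uq.E D i)) =
      p * ρ (Uq.E D i) - ρ (Uq.E D i) * p := by
    have h : (matM π v m m hM).map (evalAt (flagLeft D) (Uq.E D i)) =
        ρ (Uq.antipode D (Uq.E D i)) * p * ρ (Uq.K D i) +
          ρ (Uq.antipode D 1) * p * ρ (Uq.E D i) := by
      ext k l
      change unitM π v m m k l (Uq.E D i) = _
      rw [unitM, UqDual.mul_apply_E, star_coeffU_apply v hπ, coeffU_apply,
        star_coeffU_apply v hπ, coeffU_apply, Matrix.add_apply, mul_single_mul_apply,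
        mul_single_mul_apply]
    -- `S(E_i) p K_i = -E_i K_i⁻¹ p K_i = -E_i p`, as `p` commutes with the diagonal matrix of
    -- `K_i`.
    rw [h, Uq.antipode_one, Uq.antipode_E, map_neg, map_mul, map_one, one_mul, neg_mul, neg_mul,
      mul_assoc _ p, hpK, ← hKp, mul_assoc, ← mul_assoc (ρ (Uq.Kinv D i)), ← map_mul, Uq.Kinv_K,
      map_one, one_mul]
    abel
  have eF : (matM π v m m hM).map (evalAt (flagLeft D) (Uq.F D i)) =
      ρ (Uq.K D i) * (p * ρ (Uq.F D i) - ρ (Uq.F D i) * p) := by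
    have h : (matM π v m m hM).map (evalAt (flagLeft D) (Uq.F D i)) =
        ρ (Uq.antipode D (Uq.F D i)) * p * ρ 1 +
          ρ (Uq.antipode D (Uq.Kinv D i)) * p * ρ (Uq.F D i) := by
      ext k l
      change unitM π v m m k l (Uq.F D i) = _
      rw [unitM, UqDual.mul_apply_F, star_coeffU_apply v hπ, coeffU_apply,
        star_coeffU_apply v hπ, coeffU_apply, Matrix.add_apply, mul_single_mul_apply,
        mul_single_mul_apply]
    rw [h, Uq.antipode_Kinv, Uq.antipode_F, map_neg, map_mul, map_one]
    noncomm_ring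
  rw [Hochschild.pointFunctional_chernChain, e0, eE, eF, ← repHom_apply]
  rw [trace_projection (ν := ((c m : ℂ))⁻¹) rfl hqm (inv_ne_zero (c m).ne_zero)
    (zpow_ofReal_ne_one (D.qi_pos i) (D.qi_ne_one i) (by decide : (-2 : ℤ) ≠ 0)) hpK hKp
    (by rw [repHom_inv hc]; exact single_mul_diagonal _ m)
    (by rw [repHom_inv hc]; exact diagonal_mul_single _ m)
    (by rw [← map_mul, hn.inv.F_mul, map_smul, map_mul])
    (by rw [← map_mul, Uq.E_K, D.a_self, map_smul, map_mul])]
  exact mul_ne_zero (mul_ne_zero (mul_ne_zero hqm (inv_ne_zero (c m).ne_zero)) hc2)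
    (repHom_commutator_ne_zero hz hm)

/-- Now `Z = π(K_i⁻¹)`, `V = π(K_{2ρ})`, and the common commutation factor is `q_i^2`. The `K_i⁻¹`
stands to the right of the first commutator, so it again lies between the two; their minus signs
cancel. -/
theorem pairing_matN_ne_zero (hπ : IsUnitaryRep π) {n : I → ℤ} {c : κ → ℂˣ}
    (hn : Uq.QCommutes 2 (Uq.Kpow D n : Uq D))
    (hc : repHom π v (Uq.Kpow D n : Uq D) = Matrix.diagonal fun k => (c k : ℂ)) {m : κ}
    (hN : ∀ i j, unitN π v m m i j ∈ flagRight D) {i : I}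
    (hz : ∀ k, π (Uq.K D i) (v k) = ((D.qi i ^ z i k : ℝ) : ℂ) • v k) (hm : z i m ≠ 0) :
    Hochschild.pointFunctional (A := flagRight D) (evalOne (flagRight D)) (evalAt _ (Uq.E D i))
      (evalAt _ (Uq.F D i)) (Hochschild.chernChain
        (repMatrix π v (Uq.Kpow D n : Uq D)) (matN π v m m hN)) ≠ 0 := by
  set ρ := repHom π v
  have hK : ρ (Uq.K D i) = Matrix.diagonal fun k => ((Units.mk0 ((D.qi i ^ z i k : ℝ) : ℂ)
      (Complex.ofReal_ne_zero.2 (zpow_pos (D.qi_pos i) _).ne') : ℂˣ) : ℂ) :=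
    repHom_eq_diagonal v hz
  have hKinv : ρ (Uq.Kinv D i) = _ := repHom_inv (u := Uq.Kunit D i) hK
  have hqm : ((D.qi i ^ z i m : ℝ) : ℂ)⁻¹ ≠ 0 :=
    inv_ne_zero (Complex.ofReal_ne_zero.2 (zpow_pos (D.qi_pos i) _).ne')
  have hc2 : ((D.qi i ^ (2 : ℤ) : ℝ) : ℂ) ≠ 0 :=
    Complex.ofReal_ne_zero.2 (zpow_pos (D.qi_pos i) _).ne'
  let p : Matrix κ κ ℂ := Matrix.single m m 1
  have hpK : p * ρ (Uq.Kinv D i) = ((D.qi i ^ z i m : ℝ) : ℂ)⁻¹ • p := by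
    rw [hKinv]; exact single_mul_diagonal _ m
  have hKp : ρ (Uq.Kinv D i) * p = ((D.qi i ^ z i m : ℝ) : ℂ)⁻¹ • p := by
    rw [hKinv]; exact diagonal_mul_single _ m
  have e0 : (matN π v m m hN).map (evalOne (flagRight D)) = p := by
    ext k l
    change unitN π v m m k l 1 = _
    rw [unitN, UqDual.mul_apply_one, star_coeffU_apply v hπ, coeffU_apply, Uq.antipode_one,
      ← mul_single_mul_apply, map_one, one_mul, mul_one]
  have eE : (matN π v m m hN).map (evalAt (flagRight D) (Uq.E D i)) =
      -((p * ρ (Uq.E D i) - ρ (Uq.E D i) * p) * ρ (Uq.Kinv D i)) := by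
    have h : (matN π v m m hN).map (evalAt (flagRight D) (Uq.E D i)) =
        ρ (Uq.E D i) * p * ρ (Uq.antipode D (Uq.K D i)) +
          ρ 1 * p * ρ (Uq.antipode D (Uq.E D i)) := by
      ext k l
      change unitN π v m m k l (Uq.E D i) = _
      rw [unitN, UqDual.mul_apply_E, star_coeffU_apply v hπ, coeffU_apply,
        star_coeffU_apply v hπ, coeffU_apply, Matrix.add_apply, mul_single_mul_apply,
        mul_single_mul_apply]
    rw [h, Uq.antipode_K, Uq.antipode_E, map_neg, map_mul, map_one]
    noncomm_ring
  have eF : (matN π v m m hN).map (evalAt (flagRight D) (Uq.F D i)) =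
      -(p * ρ (Uq.F D i) - ρ (Uq.F D i) * p) := by
    have h : (matN π v m m hN).map (evalAt (flagRight D) (Uq.F D i)) =
        ρ (Uq.F D i) * p * ρ (Uq.antipode D 1) +
          ρ (Uq.Kinv D i) * p * ρ (Uq.antipode D (Uq.F D i)) := by
      ext k l
      change unitN π v m m k l (Uq.F D i) = _
      rw [unitN, UqDual.mul_apply_F, star_coeffU_apply v hπ, coeffU_apply,
        star_coeffU_apply v hπ, coeffU_apply, Matrix.add_apply, mul_single_mul_apply,
        mul_single_mul_apply]
    rw [h, Uq.antipode_one, Uq.antipode_F, map_neg, map_mul, map_one, hKp, ← hpK, mul_one,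
      mul_neg, mul_assoc p, ← mul_assoc (ρ (Uq.Kinv D i)), ← map_mul, Uq.Kinv_K, map_one, one_mul]
    abel
  rw [Hochschild.pointFunctional_chernChain, e0, eE, eF, ← repHom_apply, neg_mul_neg,
    mul_assoc (_ - _)]
  rw [trace_projection (ν := (c m : ℂ)) rfl hqm (c m).ne_zero
    (zpow_ofReal_ne_one (D.qi_pos i) (D.qi_ne_one i) (by decide : (2 : ℤ) ≠ 0)) hpK hKp
    (by rw [hc]; exact single_mul_diagonal _ m)
    (by rw [hc]; exact diagonal_mul_single _ m)
    (by rw [← map_mul, hn.F_mul, map_smul, map_mul])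
    (by rw [← map_mul, Uq.E_Kinv, D.a_self, map_smul, map_mul])]
  exact mul_ne_zero (mul_ne_zero (mul_ne_zero hqm (c m).ne_zero) hc2)
    (repHom_commutator_ne_zero hz hm)

end Flag

end Quantum

namespace SimpleLie

open LieAlgebra LieAlgebra.IsKilling Module

/-! ### Pairings of `2ρ` and of weights with simple coroots. -/

section RootPairing

variable {ι R M N : Type*} [Fintype ι] [CommRing R] [CharZero R] [IsDomain R] [AddCommGroup M]
  [Module R M] [AddCommGroup N] [Module R N] {P : RootPairing ι R M N} [P.IsCrystallographic]
  [P.IsReduced] (b : P.Base)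

open Classical in
/-- `⟨2ρ, α_i^∨⟩ = 2` for a simple root `α_i`. -/
theorem sum_pos_pairing {i : ι} (hi : i ∈ b.support) :
    ∑ α ∈ Finset.univ.filter b.IsPos, P.pairing α i = 2 := by
  have hmem : i ∈ Finset.univ.filter b.IsPos := by
    simpa using RootPairing.Base.isPos_of_mem_support hi
  rw [← Finset.add_sum_erase _ _ hmem, P.pairing_same, add_eq_left]
  have hneg (α : ι) : P.pairing (P.reflectionPerm i α) i = -P.pairing α i := by
    rw [← P.pairing_reflectionPerm, P.pairing_reflectionPerm_self_right]
  -- The simple reflection `s_i` permutes the positive roots other than `α_i` and negates their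
  -- pairing with `α_i^∨`, so these terms cancel; `α_i` itself contributes `2`.
  refine Finset.sum_involution (fun α _ => P.reflectionPerm i α) ?_ ?_ ?_ ?_
  · intro α _
    rw [hneg, add_neg_cancel]
  · intro α _ h0 h
    have := hneg α
    rw [h, self_eq_neg] at this
    exact h0 this
  · intro α hα
    simp only [Finset.mem_erase, Finset.mem_filter, Finset.mem_univ, true_and] at hα ⊢
    have h := hα.2.reflectionPerm hi hα.1
    refine ⟨fun h' => ?_, h⟩
    -- If `s_i α` were `α_i`, then `α = -α_i` would have height `-1`, contradicting positivity.
    have h2 : P.reflectionPerm i i = α :=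
      (congrArg (P.reflectionPerm i) h').symm.trans (P.reflectionPerm_self i α)
    have h3 := b.height_reflectionPerm_self i
    rw [P.indexNeg_neg, h2, RootPairing.Base.height_one_of_mem_support hi] at h3
    have h4 := hα.2
    rw [RootPairing.Base.isPos_iff] at h4
    omega
  · intro α _
    simp

end RootPairing

variable {𝔤 : Type*} [LieRing 𝔤] [LieAlgebra ℂ 𝔤] [FiniteDimensional ℂ 𝔤]
  [LieAlgebra.IsSimple ℂ 𝔤] {H : LieSubalgebra ℂ 𝔤} [H.IsCartanSubalgebra]
  (b : (rootSystem H).Base)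

/-- Evaluate `2ρ = ∑ n_j α_j` at `α_i^∨`. In the convention of `datum`, the transpose of
`b.cartanMatrix`, the entry `a i j` is `α_j(α_i^∨)`. -/
theorem sum_twoRho_mul_a {q : ℝ} (hq0 : 0 < q) (hq1 : q ≠ 1) (i : b.support) :
    ∑ j, twoRho b j * (datum b q hq0 hq1).a i j = 2 := by
  classical
  have h := congrArg (fun f : Dual ℂ H => f ((rootSystem H).coroot i)) (twoRho_spec b)
  have h2 : twoRhoVec b ((rootSystem H).coroot i) = 2 := by
    rw [twoRhoVec, LinearMap.sum_apply, ← sum_pos_pairing b i.2]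
    rfl
  simp only [h2, LinearMap.sum_apply] at h
  apply Int.cast_injective (α := ℂ)
  rw [Int.cast_sum]
  refine Eq.trans (Finset.sum_congr rfl fun j _ => ?_) (h.trans (by norm_num))
  rw [Int.cast_mul, LinearMap.smul_apply, zsmul_eq_mul]
  congr 1
  exact b.algebraMap_cartanMatrixIn_apply ℤ j i

/-- The simple coroots span the Cartan subalgebra, so a functional vanishing on all of them is zero.
-/
theorem exists_coroot_ne_zero {wt : Dual ℂ H} (h : wt ≠ 0) :
    ∃ i : b.support, wt ((rootSystem H).coroot i) ≠ 0 := by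
  by_contra! hc
  refine h (LinearMap.ext_on (s := (rootSystem H).coroot '' b.support) ?_ ?_)
  · rw [b.span_coroot_support]
    exact RootPairing.IsRootSystem.span_coroot_eq_top
  · rintro _ ⟨i, hi, rfl⟩
    exact hc ⟨i, hi⟩

end SimpleLie

end

theorem mainTheorem7 {𝔤 : Type*} [LieRing 𝔤] [LieAlgebra ℂ 𝔤] [FiniteDimensional ℂ 𝔤]
    [LieAlgebra.IsSimple ℂ 𝔤] (H : LieSubalgebra ℂ 𝔤) [H.IsCartanSubalgebra]
    (b : (LieAlgebra.IsKilling.rootSystem H).Base)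
    (q : ℝ) (hq0 : 0 < q) (hq1 : q ≠ 1)
    {V : Type*} [NormedAddCommGroup V] [InnerProductSpace ℂ V] [FiniteDimensional ℂ V]
    (π : SimpleLie.Uqg b q hq0 hq1 →ₐ[ℂ] Module.End ℂ V)
    (Λ : Module.Dual ℂ H) (hΛ : SimpleLie.IsIrrepOfHighestWeight π Λ)
    (hunit : Quantum.IsUnitaryRep π)
    {κ : Type*} [Fintype κ] [DecidableEq κ] (v : OrthonormalBasis κ ℂ V)
    (wt : κ → Module.Dual ℂ H) (hwt : ∀ k, SimpleLie.IsWeightVector π (wt k) (v k))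
    (m : κ) (hm : wt m ≠ 0) :
    (∃ hM : ∀ i j, Quantum.unitM π v m m i j ∈
        Quantum.flagLeft (SimpleLie.datum b q hq0 hq1),
      Hochschild.HasNontrivialClass
        (A := Quantum.flagLeft (SimpleLie.datum b q hq0 hq1))
        (Quantum.thetaLeft (SimpleLie.datum b q hq0 hq1) (SimpleLie.twoRho b))
        (Hochschild.chernChain
          (Quantum.repMatrix π v ((Quantum.Uq.Kpow _ (SimpleLie.twoRho b))⁻¹ :
            (SimpleLie.Uqg b q hq0 hq1)ˣ))
          (Quantum.matM π v m m hM))) ∧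
    (∃ hN : ∀ i j, Quantum.unitN π v m m i j ∈
        Quantum.flagRight (SimpleLie.datum b q hq0 hq1),
      Hochschild.HasNontrivialClass
        (A := Quantum.flagRight (SimpleLie.datum b q hq0 hq1))
        (Quantum.thetaRight (SimpleLie.datum b q hq0 hq1) (SimpleLie.twoRho b))
        (Hochschild.chernChain
          (Quantum.repMatrix π v (Quantum.Uq.Kpow _ (SimpleLie.twoRho b) :
            (SimpleLie.Uqg b q hq0 hq1)ˣ))
          (Quantum.matN π v m m hN))) := by
  choose z hz hK using hwt
  have hw : ∀ i k, π (Quantum.Uq.K _ i) (v k) =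
      (((SimpleLie.datum b q hq0 hq1).qi i ^ z k i : ℝ) : ℂ) • v k := fun i k => hK k i
  -- This simple root determines the pair `E_i`, `F_i` used as derivations, for both flag algebras
  -- at once.
  obtain ⟨i, hi⟩ := SimpleLie.exists_coroot_ne_zero b hm
  have hzi : z m i ≠ 0 := fun h => hi (by rw [hz, h, Int.cast_zero])
  have hn := Quantum.Uq.qCommutes_Kpow (SimpleLie.sum_twoRho_mul_a b hq0 hq1)
  obtain ⟨c, hc⟩ := Quantum.exists_repHom_Kpow (z := fun i k => z k i) hw (SimpleLie.twoRho b)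
  have hM := Quantum.unitM_mem_flagLeft (z := fun i k => z k i) hunit hw m
  have hN := Quantum.unitN_mem_flagRight (z := fun i k => z k i) hunit hw m
  exact ⟨⟨hM, Quantum.flagLeft_hasNontrivialClass
      (Quantum.chernChain_matM_mem_normalizedCycles hunit hn hc m hM) i
      (Quantum.pairing_matM_ne_zero (z := fun i k => z k i) hunit hn hc hM (hw i) hzi)⟩,
    ⟨hN, Quantum.flagRight_hasNontrivialClass
      (Quantum.chernChain_matN_mem_normalizedCycles hunit hn hc m hN) i
      (Quantum.pairing_matN_ne_zero (z := fun i k => z k i) hunit hn hc hN (hw i) hzi)⟩⟩
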